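/- For a digraph $D=(V,A)$ (loops and pairs of opposite arcs are allowed) and $Y\subseteq V$, the inversion $D\oplus Y$ is obtained from $D$ by reversing every arc with both endpoints in $Y$. A tuple $(Y_1,\dots,Y_\ell)$ of vertex sets is a decycling family of $D$ of size $\ell$ if the digraph obtained from $D$ by successively applying the inversions with respect to $Y_1,\dots,Y_\ell$ has no directed cycle (loops and pairs of opposite arcs count as directed cycles). In the problem $k$-Inversion, the input is a digraph $D$ and an integer $k\ge 0$, and the question is whether $D$ has a decycling family of size at most $k$. Theorem. $k$-Inversion on arbitrary digraphs can be decided by an algorithm with running time $2^{O(\mathrm{tw}\,(k+\mathrm{tw}))}\cdot n^{O(1)}$, where $n$ is the number of vertices of $D$ and $\mathrm{tw}$ is the treewidth of the underlying undirected graph of $D$. Precisely: there are a single program of a random access machine (unit-cost steps, whose arithmetic operations are addition and truncated subtraction of natural numbers) and a constant $c$ such that, for every digraph $D$ on $n\ge 0$ vertices, given by $n$ and its adjacency matrix, and every $k\ge 0$, the program halts on input $(D,k)$ after at most $c\cdot 2^{c\,\mathrm{tw}\,(k+\mathrm{tw})}\cdot (n+1)^{c}$ steps, with output $1$ if $D$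 has a decycling family of size at most $k$ and output $0$ otherwise. -/

import Mathlib

/-! ## Inversions of digraphs -/

namespace Digraph

variable {V : Type*}

/-- The inversion `D ⊕ Y`: every arc with both endpoints in `Y` is reversed. -/
def invert (D : Digraph V) (Y : Set V) : Digraph V where
  Adj u v := (u ∈ Y ∧ v ∈ Y ∧ D.Adj v u) ∨ (¬ (u ∈ Y ∧ v ∈ Y) ∧ D.Adj u v)

/-- The inversion of `D` with respect to a tuple of vertex sets: the sets are applied one after
the other. -/
def invertAll (D : Digraph V) (Ys : List (Set V)) : Digraph V :=
  Ys.foldl invert D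

/-- A digraph is acyclic if it has no directed cycle (loops and pairs of opposite arcs are directed
cycles), i.e. no vertex reaches itself by a directed walk with at least one arc. -/
def Acyclic (D : Digraph V) : Prop :=
  ∀ v, ¬ Relation.TransGen D.Adj v v

/-- A decycling family of `D`: a tuple of vertex sets whose inversion makes `D` acyclic. -/
def IsDecyclingFamily (D : Digraph V) (Ys : List (Set V)) : Prop :=
  (D.invertAll Ys).Acyclic

/-- `(D, k)` is a yes-instance of `k`-Inversion: `D` has a decycling family of size at most `k`. -/
def IsInvertibleWith (D : Digraph V) (k : ℕ) : Prop :=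
  ∃ Ys : List (Set V), Ys.length ≤ k ∧ D.IsDecyclingFamily Ys

end Digraph

/-! ## Treewidth -/

namespace SimpleGraph

variable {V : Type*}

/-- A tree decomposition of a graph `G`. The nodes of the (finite, nonempty) tree are labelled by
`Fin size`. -/
structure TreeDecomposition (G : SimpleGraph V) where
  /-- The number of nodes. -/
  size : ℕ
  /-- The decomposition tree. -/
  tree : SimpleGraph (Fin size)
  isTree : tree.IsTree
  /-- The bag of a node. -/
  bag : Fin size → Finset V
  /-- Every edge of `G` lies in some bag. -/
  exists_bag_of_adj : ∀ u v, G.Adj u v → ∃ t, u ∈ bag t ∧ v ∈ bag t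
  /-- The nodes whose bag contains a given vertex induce a (nonempty) connected subtree;
  in particular every vertex lies in some bag. -/
  connected : ∀ v, (tree.induce {t | v ∈ bag t}).Connected

/-- The width of a tree decomposition: the maximum size of a bag minus one (and `0` if all bags
are empty, which is possible only for the graph with no vertices). -/
def TreeDecomposition.width {G : SimpleGraph V} (T : G.TreeDecomposition) : ℕ :=
  (Finset.univ.sup fun t => (T.bag t).card) - 1

/-- A finite graph has a tree decomposition: a single bag with all the vertices. -/
instance TreeDecomposition.instNonempty [Fintype V] (G : SimpleGraph V) :
    Nonempty G.TreeDecomposition :=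
  ⟨{ size := 1
     tree := ⊥
     isTree := ⟨Connected.of_subsingleton, isAcyclic_bot⟩
     bag := fun _ => Finset.univ
     exists_bag_of_adj := fun u v _ => ⟨0, Finset.mem_univ u, Finset.mem_univ v⟩
     connected := fun v =>
      haveI : Nonempty {t : Fin 1 | v ∈ (Finset.univ : Finset V)} := ⟨⟨0, Finset.mem_univ v⟩⟩
      Connected.of_subsingleton }⟩

/-- The treewidth of a finite graph: the minimum width of a tree decomposition. -/
noncomputable def treewidth [Fintype V] (G : SimpleGraph V) : ℕ :=
  ⨅ T : G.TreeDecomposition, T.width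

end SimpleGraph

/-! ## Random access machines

A structured random access machine over the natural numbers, with the uniform cost criterion.
The only arithmetic operations are addition and truncated subtraction (no multiplication at unit
cost), so that each step increases the maximal bit length of the stored numbers by at most one,
beyond the constants of the program, and running times agree with those of the other standard
models of sequential computation up to a polynomial. -/

namespace RAM

/-- A memory configuration: registers `reg x`, and arrays `arr a` with cells `arr a i`. A program
names its registers and arrays explicitly, so it uses only finitely many of them; the cells of an
array are accessed by computed indices. -/
structure State where
  reg : ℕ → ℕ
  arr : ℕ → ℕ → ℕ

/-- Write the value `m` to register `x`. -/
def State.setReg (s : State) (x m : ℕ) : State :=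
  { s with reg := Function.update s.reg x m }

/-- Write the value `m` to cell `i` of array `a`. -/
def State.setArr (s : State) (a i m : ℕ) : State :=
  { s with arr := Function.update s.arr a (Function.update (s.arr a) i m) }

/-- Programs. Register and array names and the constants `m` are fixed in the program. -/
inductive Prog where
  /-- `x := m` -/
  | const (x m : ℕ)
  /-- `x := y + z` -/
  | add (x y z : ℕ)
  /-- `x := y - z` (truncated at zero) -/
  | sub (x y z : ℕ)
  /-- `x := a[y]` -/
  | load (x a y : ℕ)
  /-- `a[y] := x` -/
  | store (a y x : ℕ)
  /-- `p; q` -/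
  | seq (p q : Prog)
  /-- `if x ≠ 0 then p else q` -/
  | ite (x : ℕ) (p q : Prog)
  /-- `while x ≠ 0 do p` -/
  | loop (x : ℕ) (p : Prog)

/-- `Exec p s T s'`: the program `p`, started in the state `s`, halts after exactly `T` steps in the
state `s'`. Every assignment, load, store and every test of a register counts as one step. -/
inductive Exec : Prog → State → ℕ → State → Prop where
  | const (x m : ℕ) (s : State) : Exec (.const x m) s 1 (s.setReg x m)
  | add (x y z : ℕ) (s : State) : Exec (.add x y z) s 1 (s.setReg x (s.reg y + s.reg z))
  | sub (x y z : ℕ) (s : State) : Exec (.sub x y z) s 1 (s.setReg x (s.reg y - s.reg z))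
  | load (x a y : ℕ) (s : State) : Exec (.load x a y) s 1 (s.setReg x (s.arr a (s.reg y)))
  | store (a y x : ℕ) (s : State) : Exec (.store a y x) s 1 (s.setArr a (s.reg y) (s.reg x))
  | seq {p q : Prog} {s₁ s₂ s₃ : State} {T₁ T₂ : ℕ} :
      Exec p s₁ T₁ s₂ → Exec q s₂ T₂ s₃ → Exec (.seq p q) s₁ (T₁ + T₂) s₃
  | ite_then {x : ℕ} {p q : Prog} {s s' : State} {T : ℕ} :
      s.reg x ≠ 0 → Exec p s T s' → Exec (.ite x p q) s (T + 1) s'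
  | ite_else {x : ℕ} {p q : Prog} {s s' : State} {T : ℕ} :
      s.reg x = 0 → Exec q s T s' → Exec (.ite x p q) s (T + 1) s'
  | loop_stop {x : ℕ} {p : Prog} {s : State} :
      s.reg x = 0 → Exec (.loop x p) s 1 s
  | loop_step {x : ℕ} {p : Prog} {s₁ s₂ s₃ : State} {T₁ T₂ : ℕ} :
      s₁.reg x ≠ 0 → Exec p s₁ T₁ s₂ → Exec (.loop x p) s₂ T₂ s₃ →
      Exec (.loop x p) s₁ (T₁ + T₂ + 1) s₃

/-- Programs are deterministic: the number of steps and the final state are determined by the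
program and the initial state. -/
theorem Exec.deterministic {p : Prog} {s s' s'' : State} {T T' : ℕ}
    (h : Exec p s T s') (h' : Exec p s T' s'') : T = T' ∧ s' = s'' := by
  induction h generalizing T' s'' with
  | const | add | sub | load | store => cases h'; exact ⟨rfl, rfl⟩
  | seq _ _ ih₁ ih₂ =>
    cases h' with
    | seq g₁ g₂ =>
      obtain ⟨rfl, rfl⟩ := ih₁ g₁
      obtain ⟨rfl, rfl⟩ := ih₂ g₂
      exact ⟨rfl, rfl⟩
  | ite_then hx _ ih =>
    cases h' with
    | ite_then _ g => obtain ⟨rfl, rfl⟩ := ih g; exact ⟨rfl, rfl⟩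
    | ite_else hx' _ => exact absurd hx' hx
  | ite_else hx _ ih =>
    cases h' with
    | ite_then hx' _ => exact absurd hx hx'
    | ite_else _ g => obtain ⟨rfl, rfl⟩ := ih g; exact ⟨rfl, rfl⟩
  | loop_stop hx =>
    cases h' with
    | loop_stop _ => exact ⟨rfl, rfl⟩
    | loop_step hx' _ _ => exact absurd hx hx'
  | loop_step hx _ _ ih₁ ih₂ =>
    cases h' with
    | loop_stop hx' => exact absurd hx' hx
    | loop_step _ g₁ g₂ =>
      obtain ⟨rfl, rfl⟩ := ih₁ g₁
      obtain ⟨rfl, rfl⟩ := ih₂ g₂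
      exact ⟨rfl, rfl⟩

open Classical in
/-- The input of `k`-Inversion: the number `n` of vertices in register `0`, the number `k` in
register `1`, and the adjacency matrix of the digraph, row by row, in array `0`. All other registers
and cells hold `0`. -/
noncomputable def inversionInput {n : ℕ} (D : Digraph (Fin n)) (k : ℕ) : State where
  reg x := if x = 0 then n else if x = 1 then k else 0
  arr a i :=
    if a = 0 ∧ ∃ u v : Fin n, i = (u : ℕ) * n + (v : ℕ) ∧ D.Adj u v then 1 else 0

end RAM

/-!
The algorithm tries the widths `w = 0, 1, 2, …` one after the other. An attempt with the width `w`
either gives the correct answer or reports that `w` is too small, which happens only for `w` below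
the treewidth (`Inversion.attempt_spec`, `Inversion.attempt_ne_zero`). It takes time polynomial in
`2 ^ (w * (k + w)) * (n + 2)`, called the budget below, so all attempts together obey the bound.

*Elimination orders.* The vertices are placed one group after the other. If the width is at
least the treewidth, each component of the remaining graph has at most `9 * w` placed neighbours,
its front. A round takes a vertex `v` of a component and, if two subsets of the front have a
separator that is smaller than both of them, also the part of a minimum separator in the
component. In a tree decomposition of width `w`, some bag splits a front with `9 * w` elements into
two parts with at most two thirds of its elements each
(`SimpleGraph.TreeDecomposition.exists_balanced_bag`), so that suitable subsets exist; each new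
component loses the neighbours in one of the two subsets and gains only the separator and `v`. In
the resulting order, the bag of a vertex `v`, which consists of `v` and the earlier neighbours of
the component of `v` in the graph of the vertices not before `v`, has at most `12 * w` elements
(`Elimination.cnt_bag_le`). Minimum separators are found by augmenting paths
(`MinCut.residual_spec`).

*Dynamic programming.* A decycling family of size at most `k` amounts to a colour in
`{0, …, 2 ^ k - 1}` and a position for each vertex, such that an arc goes backward in the order of
the positions exactly if the colours of its ends have an odd number of common binary digits `1`
(`Digraph.IsInvertibleWith.exists_isSolution`, `Digraph.isInvertibleWith_of_isSolution`). Partial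
solutions for the bags consist of colours and relative positions; there are
`2 ^ O(w * (k + w))` of them for each bag. Those which do not extend to the later bags are deleted
in `n` rounds. The partial solutions left are combined along the order: the earlier neighbours of
the component of a vertex all lie in the bag of the last one of them (`Elimination.exists_parent`),
and with rational positions a new vertex can always be inserted in the prescribed relative order.

*The machine.* Apart from its outer loop, the program is not written out. A function of the
memory is called computable if for each large `d` some program computes it into register `d` within
a power of the budget, and does not touch the registers and arrays below `d`. This class is closed
under composition and under iterated recomputation of an array (`RAM.CNat.arrIter`), whose body may
use any functions that are computable when the array and the loop variables are; bounded
quantifiers, counting, multiplication, reachability and all parts of the algorithm are obtained from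
this single loop.
-/

namespace RAM

/-! ### Verified execution of machine programs -/

/-- Started in `s`, the program `p` halts within `b` steps in a state satisfying `Q`. -/
def Runs (p : Prog) (s : State) (b : ℕ) (Q : State → Prop) : Prop :=
  ∃ T s', Exec p s T s' ∧ T ≤ b ∧ Q s'

namespace Runs

variable {p q : Prog} {s : State} {b b' : ℕ} {Q Q' : State → Prop}

theorem mono (h : Runs p s b Q) (hb : b ≤ b') (hQ : ∀ s', Q s' → Q' s') : Runs p s b' Q' := by
  obtain ⟨T, s', h1, h2, h3⟩ := h
  exact ⟨T, s', h1, h2.trans hb, hQ _ h3⟩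

theorem seq (h : Runs p s b Q) (h' : ∀ s', Q s' → Runs q s' b' Q') :
    Runs (.seq p q) s (b + b') Q' := by
  obtain ⟨T, s', h1, h2, h3⟩ := h
  obtain ⟨T', s'', h1', h2', h3'⟩ := h' _ h3
  exact ⟨_, _, .seq h1 h1', by omega, h3'⟩

theorem const {x m : ℕ} (h : Q (s.setReg x m)) : Runs (.const x m) s 1 Q :=
  ⟨_, _, .const x m s, le_rfl, h⟩

theorem add {x y z : ℕ} (h : Q (s.setReg x (s.reg y + s.reg z))) : Runs (.add x y z) s 1 Q :=
  ⟨_, _, .add x y z s, le_rfl, h⟩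

theorem sub {x y z : ℕ} (h : Q (s.setReg x (s.reg y - s.reg z))) : Runs (.sub x y z) s 1 Q :=
  ⟨_, _, .sub x y z s, le_rfl, h⟩

theorem load {x a y : ℕ} (h : Q (s.setReg x (s.arr a (s.reg y)))) : Runs (.load x a y) s 1 Q :=
  ⟨_, _, .load x a y s, le_rfl, h⟩

theorem store {a y x : ℕ} (h : Q (s.setArr a (s.reg y) (s.reg x))) :
    Runs (.store a y x) s 1 Q :=
  ⟨_, _, .store a y x s, le_rfl, h⟩

end Runs

@[simp] theorem setReg_reg_self (s : State) (x m : ℕ) : (s.setReg x m).reg x = m := by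
  simp [State.setReg]

theorem setReg_reg_ne (s : State) {x y : ℕ} (m : ℕ) (h : y ≠ x) :
    (s.setReg x m).reg y = s.reg y := by
  simp [State.setReg, h]

@[simp] theorem setReg_arr (s : State) (x m : ℕ) : (s.setReg x m).arr = s.arr := rfl

@[simp] theorem setArr_reg (s : State) (a i m : ℕ) : (s.setArr a i m).reg = s.reg := rfl

theorem setArr_arr_ne (s : State) {a b : ℕ} (i m : ℕ) (h : b ≠ a) :
    (s.setArr a i m).arr b = s.arr b := by
  simp [State.setArr, h]

theorem setArr_arr_self (s : State) (a i m j : ℕ) :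
    (s.setArr a i m).arr a j = if j = i then m else s.arr a j := by
  simp [State.setArr, Function.update_apply]

/-- `for i < N do p`, with `tmp` as an auxiliary register. -/
def forLoop (i N tmp : ℕ) (p : Prog) : Prog :=
  .seq (.const i 0) (.seq (.sub tmp N i)
    (.loop tmp (.seq p (.seq (.const tmp 1) (.seq (.add i i tmp) (.sub tmp N i))))))

/-- The invariant rule for `forLoop`. -/
theorem Runs.forLoop {i N tmp B b : ℕ} {p : Prog} {s : State} (I : ℕ → State → Prop)
    (hiN : i ≠ N) (hit : i ≠ tmp) (hNt : N ≠ tmp)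
    (hI : ∀ j s v, I j s → I j (s.setReg i v)) (hI' : ∀ j s v, I j s → I j (s.setReg tmp v))
    (hp : ∀ j < B, ∀ s, I j s → s.reg i = j → s.reg N = B →
      Runs p s b (fun s' => I (j + 1) s' ∧ s'.reg i = j ∧ s'.reg N = B))
    (h0 : I 0 s) (hN : s.reg N = B) :
    Runs (RAM.forLoop i N tmp p) s (3 + B * (b + 4)) (fun s' => I B s' ∧ s'.reg N = B) := by
  have key : ∀ m j s, m + j = B → I j s → s.reg i = j → s.reg N = B → s.reg tmp = B - j →
      Runs (.loop tmp (.seq p (.seq (.const tmp 1) (.seq (.add i i tmp) (.sub tmp N i))))) s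
        (1 + m * (b + 4)) (fun s' => I B s' ∧ s'.reg N = B) := by
    intro m
    induction m with
    | zero =>
      intro j s hj h1 h2 h3 h4
      obtain rfl : j = B := by omega
      exact ⟨_, _, Exec.loop_stop (by omega), by omega, h1, h3⟩
    | succ m ih =>
      intro j s hj h1 h2 h3 h4
      have hstep : Runs (.seq p (.seq (.const tmp 1) (.seq (.add i i tmp) (.sub tmp N i)))) s
          (b + (1 + (1 + 1))) (fun s' => I (j + 1) s' ∧ s'.reg i = j + 1 ∧ s'.reg N = B ∧
            s'.reg tmp = B - (j + 1)) := by
        refine (hp j (by omega) s h1 h2 h3).seq fun s1 ⟨g1, g2, g3⟩ => ?_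
        refine Runs.seq (Runs.const (Q := fun s' => s' = s1.setReg tmp 1) rfl) ?_
        rintro _ rfl
        refine Runs.seq (Runs.add (Q := fun s' => s' = (s1.setReg tmp 1).setReg i (j + 1)) ?_) ?_
        · simp [setReg_reg_ne _ _ hit, g2]
        rintro _ rfl
        refine Runs.sub ⟨hI' _ _ _ (hI _ _ _ (hI' _ _ _ g1)), ?_, ?_, ?_⟩
        · rw [setReg_reg_ne _ _ hit]; simp
        · rw [setReg_reg_ne _ _ hNt, setReg_reg_ne _ _ hiN.symm, setReg_reg_ne _ _ hNt, g3]
        · simp [setReg_reg_ne _ _ hNt, setReg_reg_ne _ _ hiN.symm, g3]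
      obtain ⟨T1, s1, e1, b1, g1, g2, g3, g4⟩ := hstep
      obtain ⟨T2, s2, e2, b2, g⟩ := ih (j + 1) s1 (by omega) g1 g2 g3 g4
      refine ⟨_, _, .loop_step (by omega) e1 e2, ?_, g⟩
      have : (m + 1) * (b + 4) = m * (b + 4) + (b + 4) := by ring
      omega
  have : 3 + B * (b + 4) = 1 + (1 + (1 + B * (b + 4))) := by ring
  rw [this]
  refine Runs.seq (Runs.const (Q := fun s' => s' = s.setReg i 0) rfl) ?_
  rintro _ rfl
  refine Runs.seq (Runs.sub (Q := fun s' => s' = (s.setReg i 0).setReg tmp B) ?_) ?_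
  · simp [setReg_reg_ne _ _ hiN.symm, hN]
  rintro _ rfl
  refine key B 0 _ rfl (hI' _ _ _ (hI _ _ _ h0)) ?_ ?_ ?_
  · rw [setReg_reg_ne _ _ hit]; simp
  · rw [setReg_reg_ne _ _ hNt, setReg_reg_ne _ _ hiN.symm, hN]
  · simp

/-! ### Functions computable within a polynomial budget -/

/-- Two states agree on all registers and arrays with names below `L`. -/
def Agree (L : ℕ) (s s' : State) : Prop :=
  (∀ x < L, s'.reg x = s.reg x) ∧ ∀ a < L, s'.arr a = s.arr a

namespace Agree

variable {L L' : ℕ} {s s' s'' : State}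

theorem refl (L : ℕ) (s : State) : Agree L s s := ⟨fun _ _ => rfl, fun _ _ => rfl⟩

theorem trans (h : Agree L s s') (h' : Agree L s' s'') : Agree L s s'' :=
  ⟨fun x hx => (h'.1 x hx).trans (h.1 x hx), fun x hx => (h'.2 x hx).trans (h.2 x hx)⟩

theorem mono (h : Agree L s s') (hL : L' ≤ L) : Agree L' s s' :=
  ⟨fun x hx => h.1 x (hx.trans_le hL), fun x hx => h.2 x (hx.trans_le hL)⟩

theorem setReg (h : Agree L s s') {x : ℕ} (hx : L ≤ x) (m : ℕ) : Agree L s (s'.setReg x m) :=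
  ⟨fun y hy => by rw [setReg_reg_ne _ _ (by omega), h.1 y hy], fun y hy => h.2 y hy⟩

theorem setArr (h : Agree L s s') {a : ℕ} (ha : L ≤ a) (i m : ℕ) :
    Agree L s (s'.setArr a i m) :=
  ⟨fun y hy => h.1 y hy, fun y hy => by rw [setArr_arr_ne _ _ _ (by omega), h.2 y hy]⟩

end Agree

/-- The quantity in which all running times are polynomial. The registers `0`, `1`, `2` are reserved
for the number `n` of vertices, the number `k` of inversions and the current width `w`. -/
def budget (s : State) : ℕ := 2 ^ (s.reg 2 * (s.reg 1 + s.reg 2)) * (s.reg 0 + 2)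

theorem two_le_budget (s : State) : 2 ≤ budget s :=
  (by omega : 2 ≤ 1 * (s.reg 0 + 2)).trans (Nat.mul_le_mul_right _ Nat.one_le_two_pow)

theorem Agree.budget_eq {L : ℕ} {s s' : State} (h : Agree L s s') (hL : 3 ≤ L) :
    budget s' = budget s := by
  simp only [budget, h.1 0 (by omega), h.1 1 (by omega), h.1 2 (by omega)]

/-- Bounded by a fixed power of the budget, in all states. -/
def PolyBdd (f : State → ℕ) : Prop := ∃ c, ∀ s, f s ≤ budget s ^ c

namespace PolyBdd

variable {f g : State → ℕ}

theorem of_le (hg : PolyBdd g) (h : ∀ s, f s ≤ g s) : PolyBdd f := by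
  obtain ⟨c, hc⟩ := hg
  exact ⟨c, fun s => (h s).trans (hc s)⟩

theorem const (m : ℕ) : PolyBdd fun _ => m :=
  ⟨m, fun s => Nat.lt_two_pow_self.le.trans (Nat.pow_le_pow_left (two_le_budget s) m)⟩

theorem mul (hf : PolyBdd f) (hg : PolyBdd g) : PolyBdd fun s => f s * g s := by
  obtain ⟨c, hc⟩ := hf
  obtain ⟨e, he⟩ := hg
  exact ⟨c + e, fun s => by rw [pow_add]; exact Nat.mul_le_mul (hc s) (he s)⟩

theorem add (hf : PolyBdd f) (hg : PolyBdd g) : PolyBdd fun s => f s + g s := by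
  have h : PolyBdd fun s => (f s + 1) * (g s + 1) := by
    have h1 : ∀ {f : State → ℕ}, PolyBdd f → PolyBdd fun s => f s + 1 := by
      rintro f ⟨c, hc⟩
      refine ⟨c + 1, fun s => ?_⟩
      have := hc s
      have := two_le_budget s
      have : 1 ≤ budget s ^ c := Nat.one_le_pow _ _ (by omega)
      rw [pow_succ]
      nlinarith
    exact (h1 hf).mul (h1 hg)
  exact h.of_le fun s => by nlinarith

end PolyBdd

/-- A context: registers and arrays with names below `L` are in use. If `b` fails, then only the
dependence on these registers and arrays is recorded, and not computability. Such contexts admit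
arbitrary fixed functions as arrays, so that the body of a loop can be shown to depend only on the
memory below `L` and on the current array. The condition `3 ≤ L` protects the registers that
determine the budget. -/
structure Ctx where
  L : ℕ
  hL : 3 ≤ L
  b : Prop

instance : LE Ctx := ⟨fun Γ Γ' => Γ.L ≤ Γ'.L ∧ (Γ'.b → Γ.b)⟩

theorem Ctx.le_rfl {Γ : Ctx} : Γ ≤ Γ := ⟨Nat.le_refl _, id⟩

theorem Ctx.le_trans {Γ Γ' Γ'' : Ctx} (h : Γ ≤ Γ') (h' : Γ' ≤ Γ'') : Γ ≤ Γ'' :=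
  ⟨Nat.le_trans h.1 h'.1, fun hb => h.2 (h'.2 hb)⟩

/-- The function depends only on registers and arrays with names below `L`. -/
def Dep (L : ℕ) (f : State → ℕ) : Prop := ∀ s s', Agree L s s' → f s' = f s

/-- For every `d ≥ L` there is a program that computes `f` into register `d` in polynomial time,
and which keeps all registers and arrays below `d`. -/
def Comp (L : ℕ) (f : State → ℕ) : Prop :=
  ∀ d ≥ L, ∃ p c, ∀ s, Runs p s (budget s ^ c) fun s' => s'.reg d = f s ∧ Agree d s s'

/-- The number-valued function `f` of the machine state is computable in the context `Γ`. -/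
def CNat (Γ : Ctx) (f : State → ℕ) : Prop := Dep Γ.L f ∧ (Γ.b → Comp Γ.L f)

/-- A computable function with polynomially bounded values; these serve as indices and as bounds of
loops. -/
def CIdx (Γ : Ctx) (f : State → ℕ) : Prop := CNat Γ f ∧ PolyBdd f

/-- A state-dependent function `ℕ → ℕ` is computable if applying it to computable indices
gives computable numbers, also in larger contexts. -/
def CFun (Γ : Ctx) (a : State → ℕ → ℕ) : Prop :=
  ∀ Γ', Γ ≤ Γ' → ∀ i, CIdx Γ' i → CNat Γ' fun s => a s (i s)

variable {Γ Γ' : Ctx}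

theorem CNat.mono {f : State → ℕ} (h : CNat Γ f) (hΓ : Γ ≤ Γ') : CNat Γ' f :=
  ⟨fun s s' hs => h.1 s s' (hs.mono hΓ.1), fun hb d hd => h.2 (hΓ.2 hb) d (hΓ.1.trans hd)⟩

theorem CIdx.mono {f : State → ℕ} (h : CIdx Γ f) (hΓ : Γ ≤ Γ') : CIdx Γ' f :=
  ⟨h.1.mono hΓ, h.2⟩

theorem CFun.mono {a : State → ℕ → ℕ} (h : CFun Γ a) (hΓ : Γ ≤ Γ') : CFun Γ' a :=
  fun Γ'' h' i hi => h Γ'' (Ctx.le_trans hΓ h') i hi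

theorem CNat.congr {f g : State → ℕ} (h : CNat Γ f) (hfg : ∀ s, g s = f s) : CNat Γ g := by
  obtain rfl : g = f := funext hfg
  exact h

/-- Running `p` after computing finitely many things: the composition of polynomial running times
is polynomial. -/
theorem budget_pow_add_le (s : State) (c e : ℕ) :
    budget s ^ c + budget s ^ e ≤ budget s ^ (c + e + 1) := by
  have h := two_le_budget s
  have h1 : budget s ^ c ≤ budget s ^ (c + e) := Nat.pow_le_pow_right (by omega) (by omega)
  have h2 : budget s ^ e ≤ budget s ^ (c + e) := Nat.pow_le_pow_right (by omega) (by omega)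
  rw [pow_succ]
  have := Nat.mul_le_mul_left (budget s ^ (c + e)) h
  omega

theorem CNat.const (m : ℕ) : CNat Γ fun _ => m :=
  ⟨fun _ _ _ => rfl, fun _ d _ => ⟨.const d m, 0, fun s => Runs.const
    ⟨by simp, (Agree.refl d s).setReg le_rfl _⟩⟩⟩

theorem CNat.reg {x : ℕ} (hx : x < Γ.L) : CNat Γ fun s => s.reg x :=
  ⟨fun _ _ h => h.1 x hx, fun _ d hd => by
    have hxd : x ≠ d := (hx.trans_le hd).ne
    refine ⟨.seq (.const d 0) (.add d x d), 1, fun s => ?_⟩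
    refine (Runs.seq (Runs.const (Q := fun s' => s' = s.setReg d 0) rfl) ?_).mono (b := 1 + 1)
      (by simpa using two_le_budget s) fun _ h => h
    rintro _ rfl
    refine Runs.add ⟨by simp [setReg_reg_ne _ _ hxd],
      ((Agree.refl d s).setReg le_rfl _).setReg le_rfl _⟩⟩

/-- Computation of `g` from the values of `f₁` and `f₂` by a program that runs in constant time. -/
theorem CNat.map₂ {f₁ f₂ : State → ℕ} {g : ℕ → ℕ → ℕ} (h₁ : CNat Γ f₁) (h₂ : CNat Γ f₂)
    (hg : ∀ d, ∃ q, ∀ s, Runs q s 1 fun s' =>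
      s' = s.setReg d (g (s.reg d) (s.reg (d + 1)))) :
    CNat Γ fun s => g (f₁ s) (f₂ s) := by
  refine ⟨fun s s' h => by simp only [h₁.1 s s' h, h₂.1 s s' h], fun hb d hd => ?_⟩
  obtain ⟨p₁, c₁, hp₁⟩ := h₁.2 hb d hd
  obtain ⟨p₂, c₂, hp₂⟩ := h₂.2 hb (d + 1) (by omega)
  obtain ⟨q, hq⟩ := hg d
  have hd3 : 3 ≤ d := Γ.hL.trans hd
  refine ⟨.seq p₁ (.seq p₂ q), c₁ + (c₂ + 0 + 1) + 1, fun s => ?_⟩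
  have hrun : Runs (.seq p₁ (.seq p₂ q)) s (budget s ^ c₁ + (budget s ^ c₂ + 1))
      fun s' => s'.reg d = g (f₁ s) (f₂ s) ∧ Agree d s s' := by
    refine (hp₁ s).seq fun s₁ ⟨e₁, a₁⟩ => ?_
    rw [← a₁.budget_eq hd3]
    refine (hp₂ s₁).seq fun s₂ ⟨e₂, a₂⟩ => (hq s₂).mono le_rfl ?_
    rintro _ rfl
    refine ⟨?_, (a₁.trans (a₂.mono (by omega))).setReg le_rfl _⟩
    rw [setReg_reg_self, e₂, a₂.1 d (by omega), e₁, h₂.1 s s₁ (a₁.mono hd)]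
  refine hrun.mono ?_ fun _ h => h
  have h1 := budget_pow_add_le s c₁ (c₂ + 0 + 1)
  have h2 := budget_pow_add_le s c₂ 0
  simp only [pow_zero] at h2
  omega

theorem CNat.add {f g : State → ℕ} (hf : CNat Γ f) (hg : CNat Γ g) :
    CNat Γ fun s => f s + g s :=
  hf.map₂ hg fun d => ⟨.add d d (d + 1), fun _ => Runs.add rfl⟩

theorem CNat.sub {f g : State → ℕ} (hf : CNat Γ f) (hg : CNat Γ g) :
    CNat Γ fun s => f s - g s :=
  hf.map₂ hg fun d => ⟨.sub d d (d + 1), fun _ => Runs.sub rfl⟩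

theorem CNat.load {a : ℕ} {f : State → ℕ} (ha : a < Γ.L) (hf : CNat Γ f) :
    CNat Γ fun s => s.arr a (f s) := by
  refine ⟨fun s s' h => by simp only [hf.1 s s' h, h.2 a ha], fun hb d hd => ?_⟩
  obtain ⟨p, c, hp⟩ := hf.2 hb d hd
  refine ⟨.seq p (.load d a d), c + 0 + 1, fun s => ?_⟩
  refine ((hp s).seq (b' := 1) fun s₁ ⟨e₁, a₁⟩ => Runs.load ⟨?_, a₁.setReg le_rfl _⟩).mono
    ?_ fun _ h => h
  · simpa using budget_pow_add_le s c 0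
  · rw [setReg_reg_self, e₁, a₁.2 a (ha.trans_le hd)]

theorem CNat.ite_ne_zero {c f g : State → ℕ} (hc : CNat Γ c) (hf : CNat Γ f) (hg : CNat Γ g) :
    CNat Γ fun s => if c s ≠ 0 then f s else g s := by
  refine ⟨fun s s' h => by simp only [hf.1 s s' h, hg.1 s s' h, hc.1 s s' h], fun hb d hd => ?_⟩
  obtain ⟨p₀, c₀, hp₀⟩ := hc.2 hb d hd
  obtain ⟨p₁, c₁, hp₁⟩ := hf.2 hb d hd
  obtain ⟨p₂, c₂, hp₂⟩ := hg.2 hb d hd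
  have hd3 : 3 ≤ d := Γ.hL.trans hd
  refine ⟨.seq p₀ (.ite d p₁ p₂), c₀ + (c₁ + c₂ + 1) + 1, fun s => ?_⟩
  refine Runs.mono (b := budget s ^ c₀ + budget s ^ (c₁ + c₂ + 1))
    (Q := fun s' => s'.reg d = (if c s ≠ 0 then f s else g s) ∧ Agree d s s') ?_
    (budget_pow_add_le s _ _) fun _ h => h
  refine (hp₀ s).seq fun s₁ ⟨e₁, a₁⟩ => ?_
  rw [← a₁.budget_eq hd3]
  have h1 := budget_pow_add_le s₁ c₁ c₂
  have h2 : 1 ≤ budget s₁ ^ c₁ := Nat.one_le_pow _ _ (by have := two_le_budget s₁; omega)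
  have h3 : 1 ≤ budget s₁ ^ c₂ := Nat.one_le_pow _ _ (by have := two_le_budget s₁; omega)
  by_cases h : c s = 0
  · obtain ⟨T, s', h4, h5, h6, h7⟩ := hp₂ s₁
    refine ⟨_, s', .ite_else (by rw [e₁, h]) h4, by omega, ?_, a₁.trans h7⟩
    rw [h6, hg.1 s s₁ (a₁.mono hd)]
    simp [h]
  · obtain ⟨T, s', h4, h5, h6, h7⟩ := hp₁ s₁
    refine ⟨_, s', .ite_then (by rwa [e₁]) h4, by omega, ?_, a₁.trans h7⟩
    rw [h6, hf.1 s s₁ (a₁.mono hd)]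
    simp [h]

theorem CIdx.const (m : ℕ) : CIdx Γ fun _ => m := ⟨.const m, .const m⟩

theorem CIdx.add {f g : State → ℕ} (hf : CIdx Γ f) (hg : CIdx Γ g) :
    CIdx Γ fun s => f s + g s := ⟨hf.1.add hg.1, hf.2.add hg.2⟩

theorem CIdx.sub {f g : State → ℕ} (hf : CIdx Γ f) (hg : CNat Γ g) :
    CIdx Γ fun s => f s - g s := ⟨hf.1.sub hg, hf.2.of_le fun _ => Nat.sub_le _ _⟩

/-- Capping the values makes a computable number an admissible index. -/
theorem CNat.cap {f g : State → ℕ} (hf : CNat Γ f) (hg : CIdx Γ g) :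
    CIdx Γ fun s => min (f s) (g s) :=
  ⟨(hf.sub (hf.sub hg.1)).congr fun s => by omega, hg.2.of_le fun _ => min_le_right _ _⟩

/-! ### Iterated arrays -/

/-- The array `A` with all cells from `B` on replaced by `0`. -/
def clip (B : ℕ) (A : ℕ → ℕ) (i : ℕ) : ℕ := if i < B then A i else 0

/-- The array of `B` cells that arises from `init` by `T` simultaneous updates of all cells. The
`t`-th update of the array `A` is `step t A`. -/
def arrIter (B : ℕ) (init : ℕ → ℕ) (step : ℕ → (ℕ → ℕ) → ℕ → ℕ) : ℕ → ℕ → ℕ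
  | 0 => clip B init
  | t + 1 => clip B (step t (arrIter B init step t))

theorem arrIter_eq_clip (B : ℕ) (init : ℕ → ℕ) (step : ℕ → (ℕ → ℕ) → ℕ → ℕ) (t : ℕ) :
    clip B (arrIter B init step t) = arrIter B init step t := by
  cases t <;> (ext i; simp only [arrIter, clip]; split_ifs <;> rfl)

/-- Computability of an array that is recomputed cell by cell in each of polynomially many rounds.
The bodies of the loops are given in higher-order abstract syntax. -/
theorem CNat.arrIter {B T u : State → ℕ} {init : State → ℕ → ℕ}
    {step : State → ℕ → (ℕ → ℕ) → ℕ → ℕ}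
    (hB : CIdx Γ B) (hT : CIdx Γ T)
    (hinit : CFun Γ init)
    (hstep : ∀ Γ', Γ ≤ Γ' → ∀ t A i, CIdx Γ' t → CFun Γ' A → CIdx Γ' i →
      CNat Γ' fun s => step s (t s) (A s) (i s)) (hu : CNat Γ u) :
    CNat Γ fun s => arrIter (B s) (init s) (step s) (T s) (u s) := by
  obtain ⟨L, hL, b⟩ := Γ
  have dinit : ∀ s s', Agree L s s' → init s' = init s := fun s s' h => funext fun i =>
    (hinit ⟨L, hL, False⟩ ⟨le_rfl, False.elim⟩ _ (.const i)).1 s s' h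
  have dstep : ∀ s s', Agree L s s' → step s' = step s := fun s s' h =>
    funext fun t => funext fun A => funext fun i =>
      (hstep ⟨L, hL, False⟩ ⟨le_rfl, False.elim⟩ _ (fun _ => A) _ (.const t)
        (fun Γ' hΓ j hj => ⟨fun s s' h => congrArg A (hj.1.1 s s' h), fun hb =>
          (hΓ.2 hb).elim⟩) (.const i)).1 s s' h
  refine ⟨fun s s' h => by
    simp only [dinit s s' h, dstep s s' h, hB.1.1 s s' h, hT.1.1 s s' h, hu.1 s s' h],
    fun hb d hd => ?_⟩
  -- Registers: `d` holds `B`, `d + 1` holds `T`, `d + 2` and `d + 3` are the loop variables,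
  -- `d + 4` and `d + 5` are auxiliary, and `d + 6` receives results. Arrays: `d` is the current
  -- array and `d + 1` the next one.
  have hd3 : 3 ≤ d := hL.trans hd
  let Γ₆ : Ctx := ⟨d + 6, by omega, b⟩
  have hΓ₆ : (⟨L, hL, b⟩ : Ctx) ≤ Γ₆ := ⟨Nat.le_add_right_of_le hd, id⟩
  have hB₆ : CIdx Γ₆ B := hB.mono hΓ₆
  -- Indices have to be bounded in all states, not only in those that the program reaches; hence the
  -- loop variables are capped.
  let X : State → ℕ := fun s => min (s.reg (d + 3)) (B s)
  let t' : State → ℕ := fun s => min (s.reg (d + 2)) (T s)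
  let A : State → ℕ → ℕ := fun s => clip (B s) (s.arr d)
  have hX : CIdx Γ₆ X := (CNat.reg (by change d + 3 < d + 6; omega)).cap hB₆
  have ht' : CIdx Γ₆ t' := (CNat.reg (by change d + 2 < d + 6; omega)).cap (hT.mono hΓ₆)
  have hA' : ∀ Γ', Γ₆ ≤ Γ' → ∀ i, CNat Γ' i → CNat Γ' fun s => A s (i s) := fun Γ' hΓ' i hi =>
    (CNat.ite_ne_zero ((hB₆.mono hΓ').1.sub hi)
      (CNat.load (lt_of_lt_of_le (by change d < d + 6; omega) hΓ'.1) hi) (.const 0)).congr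
      fun s => by
        simp only [A, clip, ne_eq, Nat.sub_eq_zero_iff_le, not_le]
  have hA : CFun Γ₆ A := fun Γ' hΓ' i hi => hA' Γ' hΓ' i hi.1
  obtain ⟨pB, cB, hpB⟩ := hB.1.2 hb d hd
  obtain ⟨pT, cT, hpT⟩ := hT.1.2 hb (d + 1) (hd.trans (Nat.le_succ d))
  obtain ⟨pi, ci, hpi⟩ := (hinit Γ₆ hΓ₆ X hX).2 hb (d + 6) le_rfl
  obtain ⟨ps, cs, hps⟩ := (hstep Γ₆ hΓ₆ t' A X ht' hA hX).2 hb (d + 6) le_rfl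
  obtain ⟨pa, ca, hpa⟩ := (hA' Γ₆ Ctx.le_rfl u (hu.mono hΓ₆)).2 hb (d + 6) le_rfl
  let time : State → ℕ := fun s => budget s ^ cB + (budget s ^ cT +
    (3 + B s * (budget s ^ ci + 1 + 4) + (3 + T s * (3 + B s * (budget s ^ cs + 1 + 4) +
      (3 + B s * (1 + 1 + 4)) + 4) + (budget s ^ ca + (1 + 1)))))
  have htime : PolyBdd time := by
    have hpow : ∀ c, PolyBdd fun s => budget s ^ c := fun c => ⟨c, fun _ => le_rfl⟩
    have hc : ∀ m, PolyBdd fun _ => m := PolyBdd.const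
    exact (hpow _).add ((hpow _).add (((hc 3).add (hB.2.mul (((hpow _).add (hc 1)).add (hc 4)))).add
      (((hc 3).add (hT.2.mul ((((hc 3).add (hB.2.mul (((hpow _).add (hc 1)).add (hc 4)))).add
        ((hc 3).add (hB.2.mul (((hc 1).add (hc 1)).add (hc 4))))).add (hc 4)))).add
          ((hpow _).add ((hc 1).add (hc 1))))))
  obtain ⟨c, hc⟩ := htime
  refine ⟨.seq pB (.seq pT (.seq (forLoop (d + 3) d (d + 4) (.seq pi (.store d (d + 3) (d + 6))))
    (.seq (forLoop (d + 2) (d + 1) (d + 5) (.seq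
      (forLoop (d + 3) d (d + 4) (.seq ps (.store (d + 1) (d + 3) (d + 6))))
      (forLoop (d + 3) d (d + 4) (.seq (.load (d + 6) (d + 1) (d + 3))
        (.store d (d + 3) (d + 6))))))
      (.seq pa (.seq (.const d 0) (.add d (d + 6) d)))))), c, fun s₀ => ?_⟩
  refine Runs.mono (b := time s₀) (Q := fun s' => s'.reg d =
    RAM.arrIter (B s₀) (init s₀) (step s₀) (T s₀) (u s₀) ∧ Agree d s₀ s') ?_ (hc s₀) fun _ h => h
  let At : ℕ → ℕ → ℕ := RAM.arrIter (B s₀) (init s₀) (step s₀)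
  let K : State → Prop := fun s => Agree d s₀ s ∧ s.reg d = B s₀ ∧ s.reg (d + 1) = T s₀
  have KB : ∀ {s}, K s → B s = B s₀ := fun h => hB.1.1 _ _ (h.1.mono hd)
  have KT : ∀ {s}, K s → T s = T s₀ := fun h => hT.1.1 _ _ (h.1.mono hd)
  have Kb : ∀ {s}, K s → budget s = budget s₀ := fun h => h.1.budget_eq hd3
  have Kreg : ∀ s x v, d + 2 ≤ x → K s → K (s.setReg x v) := fun s x v hx h =>
    ⟨h.1.setReg (by omega) _, by rw [setReg_reg_ne _ _ (by omega), h.2.1],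
      by rw [setReg_reg_ne _ _ (by omega), h.2.2]⟩
  have Karr : ∀ s a i v, d ≤ a → K s → K (s.setArr a i v) := fun s a i v ha h =>
    ⟨h.1.setArr ha _ _, h.2⟩
  have Kagree : ∀ {s s'}, K s → Agree (d + 6) s s' → K s' := fun h h' =>
    ⟨h.1.trans (h'.mono (by omega)), by rw [h'.1 d (by omega), h.2.1],
      by rw [h'.1 (d + 1) (by omega), h.2.2]⟩
  refine (hpB s₀).seq fun s₁ ⟨e₁, a₁⟩ => ?_
  rw [← a₁.budget_eq hd3]
  refine (hpT s₁).seq fun s₂ ⟨e₂, a₂⟩ => ?_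
  have K₂ : K s₂ := ⟨a₁.trans (a₂.mono (by omega)), by rw [a₂.1 d (by omega), e₁],
    by rw [e₂, hT.1.1 _ _ (a₁.mono hd)]⟩
  rw [a₁.budget_eq hd3]
  clear e₁ a₁ e₂ a₂
  refine (Runs.forLoop (fun j s => K s ∧ ∀ i < j, s.arr d i = init s₀ i) (by omega) (by omega)
    (by omega) ?_ ?_ ?_ ⟨K₂, by simp⟩ K₂.2.1).seq ?_
  · exact fun j s v h => ⟨Kreg _ _ _ (by omega) h.1, h.2⟩
  · exact fun j s v h => ⟨Kreg _ _ _ (by omega) h.1, h.2⟩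
  · rintro j hj s ⟨hK, hs⟩ hi hN
    have h := hpi s
    rw [Kb hK] at h
    refine h.seq fun s₁ ⟨e₁, a₁⟩ => Runs.store ?_
    have r3 : s₁.reg (d + 3) = j := by rw [a₁.1 _ (by omega), hi]
    have K₁ := Kagree hK a₁
    refine ⟨⟨Karr _ _ _ _ le_rfl K₁, fun i hij => ?_⟩, by simpa, by simpa using K₁.2.1⟩
    dsimp only at e₁
    rw [setArr_arr_self, r3, e₁, show init s = init s₀ from dinit s₀ s (hK.1.mono hd),
      a₁.2 d (by omega)]
    have : X s = j := by simp only [X, hi, KB hK]; omega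
    rw [this]
    split_ifs with h
    · rw [h]
    · exact hs i (by omega)
  rintro s₃ ⟨⟨K₃, h₃⟩, -⟩
  refine (Runs.forLoop (fun t s => K s ∧ ∀ i < B s₀, s.arr d i = At t i) (by omega) (by omega)
    (by omega) ?_ ?_ ?_ ⟨K₃, fun i hi => ?_⟩ K₃.2.2).seq ?_
  · exact fun j s v h => ⟨Kreg _ _ _ (by omega) h.1, h.2⟩
  · exact fun j s v h => ⟨Kreg _ _ _ (by omega) h.1, h.2⟩
  · rintro t ht s ⟨hK, hs⟩ hti htN
    refine ((Runs.forLoop (fun j s => K s ∧ s.reg (d + 2) = t ∧ (∀ i < B s₀, s.arr d i = At t i) ∧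
      ∀ i < j, s.arr (d + 1) i = At (t + 1) i) (by omega) (by omega)
      (by omega) ?_ ?_ ?_ ⟨hK, hti, hs, by simp⟩ hK.2.1).seq ?_)
    · exact fun j s v h => ⟨Kreg _ _ _ (by omega) h.1,
        by rw [setReg_reg_ne _ _ (by omega), h.2.1], h.2.2⟩
    · exact fun j s v h => ⟨Kreg _ _ _ (by omega) h.1,
        by rw [setReg_reg_ne _ _ (by omega), h.2.1], h.2.2⟩
    · rintro j hj s ⟨hK, hst, hs, hs'⟩ hi hN
      have h := hps s
      rw [Kb hK] at h
      refine h.seq fun s₁ ⟨e₁, a₁⟩ => Runs.store ?_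
      have r3 : s₁.reg (d + 3) = j := by rw [a₁.1 _ (by omega), hi]
      have K₁ := Kagree hK a₁
      refine ⟨⟨Karr _ _ _ _ (by omega) K₁, ?_, fun i hi => ?_, fun i hij => ?_⟩, by simpa,
        by simpa using K₁.2.1⟩
      · simpa [hst] using a₁.1 (d + 2) (by omega)
      · rw [setArr_arr_ne _ _ _ (by omega), a₁.2 d (by omega), hs i hi]
      · dsimp only at e₁
        rw [setArr_arr_self, r3, e₁, dstep s₀ s (hK.1.mono hd), a₁.2 (d + 1) (by omega)]
        have h1 : X s = j := by simp only [X, hi, KB hK]; omega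
        have h2 : t' s = t := by simp only [t', hst, KT hK]; omega
        have h3 : A s = At t := by
          simp only [A, At, KB hK]
          rw [← arrIter_eq_clip]
          funext i
          simp only [clip]
          split_ifs with h
          · exact hs i h
          · rfl
        rw [h1, h2, h3]
        split_ifs with h
        · rw [h]
          simp [At, RAM.arrIter, clip, hj]
        · exact hs' i (by omega)
    rintro s₄ ⟨⟨K₄, ht₄, -, h₄⟩, -⟩
    refine (Runs.forLoop (fun j s => K s ∧ s.reg (d + 2) = t ∧
      (∀ i < B s₀, s.arr (d + 1) i = At (t + 1) i) ∧
      ∀ i < j, s.arr d i = At (t + 1) i) (by omega) (by omega)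
      (by omega) ?_ ?_ ?_ ⟨K₄, ht₄, h₄, by simp⟩ K₄.2.1).mono le_rfl ?_
    · exact fun j s v h => ⟨Kreg _ _ _ (by omega) h.1,
        by rw [setReg_reg_ne _ _ (by omega), h.2.1], h.2.2⟩
    · exact fun j s v h => ⟨Kreg _ _ _ (by omega) h.1,
        by rw [setReg_reg_ne _ _ (by omega), h.2.1], h.2.2⟩
    · rintro j hj s ⟨hK, hst, hs, hs'⟩ hi hN
      refine Runs.seq (Runs.load (Q := fun s' => s' = s.setReg (d + 6) (At (t + 1) j)) ?_) ?_
      · rw [hi, hs j hj]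
      rintro _ rfl
      refine Runs.store ?_
      have K₁ := Kreg s (d + 6) (At (t + 1) j) (by omega) hK
      have r3 : (s.setReg (d + 6) (At (t + 1) j)).reg (d + 3) = j := by
        rw [setReg_reg_ne _ _ (by omega), hi]
      refine ⟨⟨Karr _ _ _ _ (by omega) K₁, ?_, fun i hi => ?_, fun i hij => ?_⟩, by simpa,
        by simpa using K₁.2.1⟩
      · rw [setArr_reg, setReg_reg_ne _ _ (by omega), hst]
      · rw [setArr_arr_ne _ _ _ (by omega), setReg_arr, hs i hi]
      · rw [setArr_arr_self, r3, setReg_reg_self, setReg_arr]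
        split_ifs with h
        · rw [h]
        · exact hs' i (by omega)
    · rintro s₅ ⟨⟨K₅, ht₅, -, h₅⟩, -⟩
      exact ⟨⟨K₅, h₅⟩, ht₅, K₅.2.2⟩
  · rw [h₃ i hi]
    simp [At, RAM.arrIter, clip, hi]
  rintro s₄ ⟨⟨K₄, h₄⟩, -⟩
  have h := hpa s₄
  rw [Kb K₄] at h
  refine h.seq fun s₅ ⟨e₅, a₅⟩ => ?_
  refine Runs.seq (Runs.const (Q := fun s' => s' = s₅.setReg d 0) rfl) ?_
  rintro _ rfl
  refine Runs.add ⟨?_, (((K₄.1.trans (a₅.mono (by omega))).setReg le_rfl _).setReg le_rfl _)⟩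
  rw [setReg_reg_self, setReg_reg_self, setReg_reg_ne _ _ (by omega), e₅, Nat.add_zero]
  simp only [A, KB K₄, hu.1 _ _ (K₄.1.mono hd)]
  rw [← arrIter_eq_clip]
  simp only [clip]
  split_ifs with h
  · exact h₄ _ h
  · rfl

end RAM

namespace RAM

variable {Γ Γ' : Ctx}

/-! ### Computable predicates and bounded quantifiers -/

open Classical in
/-- The indicator of a proposition, as a number. -/
noncomputable def ind (p : Prop) : ℕ := if p then 1 else 0

theorem ind_ne_zero {p : Prop} : ind p ≠ 0 ↔ p := by simp [ind]

/-- A computable predicate of the machine state. -/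
def CProp (Γ : Ctx) (p : State → Prop) : Prop := CNat Γ fun s => ind (p s)

/-- A state-dependent predicate on `ℕ` is computable if it is so at computable indices, also in
larger contexts. -/
def CPred (Γ : Ctx) (A : State → ℕ → Prop) : Prop :=
  ∀ Γ', Γ ≤ Γ' → ∀ i, CIdx Γ' i → CProp Γ' fun s => A s (i s)

/-- The analogue of `CPred` for binary relations. -/
def CRel (Γ : Ctx) (R : State → ℕ → ℕ → Prop) : Prop :=
  ∀ Γ', Γ ≤ Γ' → ∀ i j, CIdx Γ' i → CIdx Γ' j → CProp Γ' fun s => R s (i s) (j s)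

theorem CPred.mono {A : State → ℕ → Prop} (h : CPred Γ A) (hΓ : Γ ≤ Γ') : CPred Γ' A :=
  fun Γ'' h' i hi => h Γ'' (Ctx.le_trans hΓ h') i hi

theorem CRel.mono {R : State → ℕ → ℕ → Prop} (h : CRel Γ R) (hΓ : Γ ≤ Γ') : CRel Γ' R :=
  fun Γ'' h' i j hi hj => h Γ'' (Ctx.le_trans hΓ h') i j hi hj

theorem CFun.app {a : State → ℕ → ℕ} (h : CFun Γ a) {i : State → ℕ} (hi : CIdx Γ i) :
    CNat Γ fun s => a s (i s) := h Γ Ctx.le_rfl i hi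

theorem CPred.app {A : State → ℕ → Prop} (h : CPred Γ A) {i : State → ℕ} (hi : CIdx Γ i) :
    CProp Γ fun s => A s (i s) := h Γ Ctx.le_rfl i hi

theorem CRel.app {R : State → ℕ → ℕ → Prop} (h : CRel Γ R) {i j : State → ℕ} (hi : CIdx Γ i)
    (hj : CIdx Γ j) : CProp Γ fun s => R s (i s) (j s) := h Γ Ctx.le_rfl i j hi hj

theorem CProp.congr {p q : State → Prop} (h : CProp Γ p) (hpq : ∀ s, q s ↔ p s) : CProp Γ q :=
  CNat.congr h fun s => by simp only [hpq s]

theorem CProp.ne_zero {f : State → ℕ} (hf : CNat Γ f) : CProp Γ fun s => f s ≠ 0 :=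
  (hf.ite_ne_zero (.const 1) (.const 0)).congr fun s => by simp [ind]

theorem CNat.ite {p : State → Prop} [∀ s, Decidable (p s)] {f g : State → ℕ} (hp : CProp Γ p)
    (hf : CNat Γ f) (hg : CNat Γ g) : CNat Γ fun s => if p s then f s else g s :=
  (CNat.ite_ne_zero hp hf hg).congr fun s => by simp only [ind_ne_zero]

theorem CProp.lt {f g : State → ℕ} (hf : CNat Γ f) (hg : CNat Γ g) : CProp Γ fun s => f s < g s :=
  (CProp.ne_zero (hg.sub hf)).congr fun s => by omega

theorem CProp.not {p : State → Prop} (hp : CProp Γ p) : CProp Γ fun s => ¬ p s :=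
  (CProp.ne_zero (CNat.sub (.const 1) hp)).congr fun s => by
    simp only [ind]; split_ifs <;> simp_all

theorem CProp.and {p q : State → Prop} (hp : CProp Γ p) (hq : CProp Γ q) :
    CProp Γ fun s => p s ∧ q s :=
  (CProp.ne_zero (CNat.ite_ne_zero hp hq (.const 0))).congr fun s => by
    simp only [ind]; split_ifs <;> simp_all

theorem CProp.or {p q : State → Prop} (hp : CProp Γ p) (hq : CProp Γ q) :
    CProp Γ fun s => p s ∨ q s :=
  (hp.not.and hq.not).not.congr fun s => by tauto

theorem CProp.imp {p q : State → Prop} (hp : CProp Γ p) (hq : CProp Γ q) :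
    CProp Γ fun s => p s → q s :=
  (hp.and hq.not).not.congr fun s => by tauto

theorem CProp.iff {p q : State → Prop} (hp : CProp Γ p) (hq : CProp Γ q) :
    CProp Γ fun s => p s ↔ q s :=
  ((hp.imp hq).and (hq.imp hp)).congr fun s => by tauto

theorem CProp.le {f g : State → ℕ} (hf : CNat Γ f) (hg : CNat Γ g) : CProp Γ fun s => f s ≤ g s :=
  (CProp.lt hg hf).not.congr fun s => by omega

theorem CProp.eq {f g : State → ℕ} (hf : CNat Γ f) (hg : CNat Γ g) : CProp Γ fun s => f s = g s :=
  ((CProp.le hf hg).and (CProp.le hg hf)).congr fun s => by omega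

/-- Iteration of `f` on a number: `natIter z f (t + 1) = f t (natIter z f t)`. -/
def natIter (z : ℕ) (f : ℕ → ℕ → ℕ) : ℕ → ℕ
  | 0 => z
  | t + 1 => f t (natIter z f t)

theorem arrIter_one (z : ℕ) (f : ℕ → ℕ → ℕ) (T : ℕ) :
    arrIter 1 (fun _ => z) (fun t A _ => f t (A 0)) T 0 = natIter z f T := by
  induction T with
  | zero => simp [arrIter, natIter, clip]
  | succ T ih => simp [arrIter, natIter, clip, ih]

theorem CNat.natIter {T z : State → ℕ} {f : State → ℕ → ℕ → ℕ} (hT : CIdx Γ T) (hz : CNat Γ z)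
    (hf : ∀ Γ', Γ ≤ Γ' → ∀ t a, CIdx Γ' t → CNat Γ' a → CNat Γ' fun s => f s (t s) (a s)) :
    CNat Γ fun s => natIter (z s) (f s) (T s) :=
  (CNat.arrIter (.const 1) hT (init := fun s _ => z s)
    (step := fun s t A _ => f s t (A 0)) (fun _ hΓ _ _ => hz.mono hΓ)
    (fun Γ' hΓ t _ _ ht hA _ => hf Γ' hΓ t _ ht (hA.app (.const 0))) (.const 0)).congr
    fun _ => (arrIter_one _ _ _).symm

theorem CProp.exists_lt {n : State → ℕ} {p : State → ℕ → Prop} (hn : CIdx Γ n) (hp : CPred Γ p) :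
    CProp Γ fun s => ∃ x < n s, p s x := by
  have h : ∀ (n : ℕ) (p : ℕ → Prop),
      natIter 0 (fun t a => ind (a ≠ 0 ∨ p t)) n ≠ 0 ↔ ∃ x < n, p x := by
    intro n p
    induction n with
    | zero => simp [RAM.natIter]
    | succ n ih =>
      rw [RAM.natIter, ind_ne_zero, ih]
      constructor
      · rintro (⟨x, hx, h⟩ | h)
        · exact ⟨x, by omega, h⟩
        · exact ⟨n, by omega, h⟩
      · rintro ⟨x, hx, h⟩
        rcases Nat.lt_succ_iff_lt_or_eq.1 hx with hx | rfl
        · exact .inl ⟨x, hx, h⟩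
        · exact .inr h
  exact (CProp.ne_zero (CNat.natIter hn (.const 0) (f := fun s t a => ind (a ≠ 0 ∨ p s t))
    fun Γ' hΓ t a ht ha => (CProp.ne_zero ha).or (hp Γ' hΓ t ht))).congr fun s => (h _ _).symm

theorem CProp.forall_lt {n : State → ℕ} {p : State → ℕ → Prop} (hn : CIdx Γ n) (hp : CPred Γ p) :
    CProp Γ fun s => ∀ x < n s, p s x :=
  (CProp.exists_lt hn (p := fun s x => ¬ p s x) fun Γ' hΓ i hi => (hp Γ' hΓ i hi).not).not.congr
    fun s => by push Not; rfl

open Classical in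
/-- The number of `x < n` with `p x`. -/
noncomputable def cnt (n : ℕ) (p : ℕ → Prop) : ℕ := ((Finset.range n).filter p).card

theorem cnt_le (n : ℕ) (p : ℕ → Prop) : cnt n p ≤ n := by
  classical
  exact (Finset.card_filter_le _ _).trans (by simp)

theorem CNat.cnt {n : State → ℕ} {p : State → ℕ → Prop} (hn : CIdx Γ n) (hp : CPred Γ p) :
    CNat Γ fun s => cnt (n s) (p s) := by
  have h : ∀ (n : ℕ) (p : ℕ → Prop), RAM.natIter 0 (fun t a => a + ind (p t)) n = RAM.cnt n p := by
    intro n p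
    induction n with
    | zero => simp [RAM.natIter, RAM.cnt]
    | succ n ih =>
      rw [RAM.natIter, ih, RAM.cnt, RAM.cnt, Finset.range_add_one, Finset.filter_insert, ind]
      split_ifs <;> simp
  exact (CNat.natIter hn (.const 0) fun Γ' hΓ t a ht ha => ha.add (hp Γ' hΓ t ht)).congr
    fun s => (h _ _).symm

theorem CIdx.cnt {n : State → ℕ} {p : State → ℕ → Prop} (hn : CIdx Γ n) (hp : CPred Γ p) :
    CIdx Γ fun s => RAM.cnt (n s) (p s) :=
  ⟨.cnt hn hp, hn.2.of_le fun _ => cnt_le _ _⟩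

/-- The least `x < n` with `p x`, or `n` if there is none. -/
noncomputable def leastLT (n : ℕ) (p : ℕ → Prop) : ℕ := cnt n fun x => ∀ y < x + 1, ¬ p y

theorem leastLT_le (n : ℕ) (p : ℕ → Prop) : leastLT n p ≤ n := cnt_le _ _

theorem leastLT_spec {n : ℕ} {p : ℕ → Prop} (h : ∃ x < n, p x) :
    leastLT n p < n ∧ p (leastLT n p) := by
  classical
  have h' : ∃ x, p x := h.imp fun _ => And.right
  obtain ⟨x, hx, hpx⟩ := h
  have hlt : Nat.find h' < n := (Nat.find_min' h' hpx).trans_lt hx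
  have : leastLT n p = Nat.find h' := by
    rw [leastLT, cnt]
    conv_rhs => rw [← Finset.card_range (Nat.find h')]
    congr 1
    ext y
    simp only [Finset.mem_filter, Finset.mem_range]
    constructor
    · rintro ⟨-, hy⟩
      by_contra hcon
      exact hy _ (by omega) (Nat.find_spec h')
    · exact fun hy => ⟨by omega, fun z hz => Nat.find_min h' (by omega)⟩
  rw [this]
  exact ⟨hlt, Nat.find_spec h'⟩

theorem leastLT_eq_of_not {n : ℕ} {p : ℕ → Prop} (h : ¬ ∃ x < n, p x) : leastLT n p = n := by
  classical
  rw [leastLT, cnt]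
  conv_rhs => rw [← Finset.card_range n]
  congr 1
  ext x
  simp only [Finset.mem_filter, Finset.mem_range]
  exact ⟨And.left, fun hx => ⟨hx, fun y hy hp => h ⟨y, by omega, hp⟩⟩⟩

theorem CIdx.leastLT {n : State → ℕ} {p : State → ℕ → Prop} (hn : CIdx Γ n) (hp : CPred Γ p) :
    CIdx Γ fun s => leastLT (n s) (p s) :=
  CIdx.cnt hn fun _ hΓ _ hi => CProp.forall_lt (hi.add (.const 1)) fun _ hΓ' _ hj =>
    ((hp.mono hΓ).mono hΓ' |>.app hj).not

/-! ### Arithmetic -/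

theorem CNat.mul {f g : State → ℕ} (hf : CNat Γ f) (hg : CIdx Γ g) :
    CNat Γ fun s => f s * g s := by
  have h : ∀ m n, RAM.natIter 0 (fun _ a => a + m) n = m * n := by
    intro m n
    induction n with
    | zero => rfl
    | succ n ih => rw [RAM.natIter, ih, Nat.mul_succ]
  exact (CNat.natIter hg (.const 0) fun Γ' hΓ t a ht ha => ha.add (hf.mono hΓ)).congr
    fun s => (h _ _).symm

theorem CIdx.mul {f g : State → ℕ} (hf : CIdx Γ f) (hg : CIdx Γ g) :
    CIdx Γ fun s => f s * g s := ⟨hf.1.mul hg, hf.2.mul hg.2⟩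

theorem CNat.pow {f g : State → ℕ} (hf : CIdx Γ f) (hg : CIdx Γ g) :
    CNat Γ fun s => f s ^ g s := by
  have h : ∀ m n, RAM.natIter 1 (fun _ a => a * m) n = m ^ n := by
    intro m n
    induction n with
    | zero => rfl
    | succ n ih => rw [RAM.natIter, ih, pow_succ]
  exact (CNat.natIter hg (.const 1) fun Γ' hΓ t a ht ha => ha.mul (hf.mono hΓ)).congr
    fun s => (h _ _).symm

theorem CIdx.div {f g : State → ℕ} (hf : CIdx Γ f) (hg : CNat Γ g) :
    CIdx Γ fun s => f s / g s := by
  have h : ∀ m n, RAM.cnt m (fun q => 0 < n ∧ (q + 1) * n ≤ m) = m / n := by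
    intro m n
    classical
    rcases Nat.eq_zero_or_pos n with rfl | hn
    · simp [RAM.cnt]
    rw [RAM.cnt]
    conv_rhs => rw [← Finset.card_range (m / n)]
    congr 1
    ext q
    simp only [Finset.mem_filter, Finset.mem_range, Nat.lt_iff_add_one_le, Nat.le_div_iff_mul_le hn]
    constructor
    · exact fun h => h.2.2
    · intro h
      exact ⟨le_trans (Nat.le_mul_of_pos_right _ hn) h, hn, h⟩
  refine ⟨(CNat.cnt hf (p := fun s q => 0 < g s ∧ (q + 1) * g s ≤ f s) fun Γ' hΓ i hi =>
    (CProp.lt (.const 0) (hg.mono hΓ)).and (CProp.le ?_ (hf.1.mono hΓ))).congr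
      fun s => (h _ _).symm, hf.2.of_le fun _ => Nat.div_le_self _ _⟩
  exact ((hg.mono hΓ).mul (hi.add (.const 1))).congr fun s => Nat.mul_comm _ _

theorem CIdx.mod {f g : State → ℕ} (hf : CIdx Γ f) (hg : CNat Γ g) :
    CIdx Γ fun s => f s % g s := by
  refine ⟨(hf.1.sub (hg.mul (hf.div hg))).congr fun s => ?_, hf.2.of_le fun _ => Nat.mod_le _ _⟩
  have := Nat.mod_add_div (f s) (g s)
  omega

theorem CProp.testBit {f g : State → ℕ} (hf : CIdx Γ f) (hg : CIdx Γ g) :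
    CProp Γ fun s => (f s).testBit (g s) = true :=
  (CProp.eq ((hf.div (CNat.pow (.const 2) hg)).mod (.const 2)).1 (.const 1)).congr fun s => by
    simp [Nat.testBit_eq_decide_div_mod_eq]

/-! ### Iterated predicates and reachability -/

/-- The predicate on `{0, …, B - 1}` that arises from `init` by iterating `step`. -/
def predIter (B : ℕ) (init : ℕ → Prop) (step : (ℕ → Prop) → ℕ → Prop) : ℕ → ℕ → Prop
  | 0 => fun i => i < B ∧ init i
  | t + 1 => fun i => i < B ∧ step (predIter B init step t) i

theorem arrIter_ne_zero_iff (B : ℕ) (init : ℕ → Prop) (step : (ℕ → Prop) → ℕ → Prop) (t i : ℕ) :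
    arrIter B (fun i => ind (init i)) (fun _ A i => ind (step (fun j => A j ≠ 0) i)) t i ≠ 0 ↔
      predIter B init step t i := by
  induction t generalizing i with
  | zero => by_cases h : i < B <;> simp [arrIter, predIter, clip, ind, h]
  | succ t ih =>
    by_cases h : i < B
    · simp only [arrIter, predIter, clip, h, if_true, true_and, ind_ne_zero]
      rw [funext fun j => propext (ih j)]
    · simp [arrIter, predIter, clip, h]

theorem CProp.predIter {B T u : State → ℕ} {init : State → ℕ → Prop}
    {step : State → (ℕ → Prop) → ℕ → Prop}
    (hB : CIdx Γ B) (hT : CIdx Γ T) (hinit : CPred Γ init)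
    (hstep : ∀ Γ', Γ ≤ Γ' → ∀ A i, CPred Γ' A → CIdx Γ' i → CProp Γ' fun s => step s (A s) (i s))
    (hu : CNat Γ u) : CProp Γ fun s => predIter (B s) (init s) (step s) (T s) (u s) :=
  (CProp.ne_zero (CNat.arrIter hB hT (init := fun s i => ind (init s i))
    (step := fun s _ A i => ind (step s (fun j => A j ≠ 0) i)) hinit
    (fun Γ' hΓ _ A i _ hA hi => hstep Γ' hΓ (fun s j => A s j ≠ 0) i
      (fun Γ'' hΓ' j hj => CProp.ne_zero (hA Γ'' hΓ' j hj)) hi) hu)).congr fun _ =>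
        (arrIter_ne_zero_iff _ _ _ _ _).symm

/-- The binary relation on `{0, …, B₁ - 1} × {0, …, B₂ - 1}` that arises from `init` by iterating
`step`. -/
def relIter (B₁ B₂ : ℕ) (init : ℕ → ℕ → Prop) (step : (ℕ → ℕ → Prop) → ℕ → ℕ → Prop) :
    ℕ → ℕ → ℕ → Prop
  | 0 => fun x y => x < B₁ ∧ y < B₂ ∧ init x y
  | t + 1 => fun x y => x < B₁ ∧ y < B₂ ∧ step (relIter B₁ B₂ init step t) x y

theorem predIter_mul_iff (B₁ B₂ : ℕ) (init : ℕ → ℕ → Prop) (step : (ℕ → ℕ → Prop) → ℕ → ℕ → Prop)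
    (t x y : ℕ) :
    (x < B₁ ∧ y < B₂ ∧ predIter (B₁ * B₂) (fun i => init (i / B₂) (i % B₂))
      (fun A i => step (fun x y => x < B₁ ∧ y < B₂ ∧ A (x * B₂ + y)) (i / B₂) (i % B₂)) t
        (x * B₂ + y)) ↔ relIter B₁ B₂ init step t x y := by
  induction t generalizing x y with
  | zero =>
    simp only [predIter, relIter]
    refine and_congr_right fun hx => and_congr_right fun hy => ?_
    have h1 : x * B₂ + y < B₁ * B₂ := by nlinarith
    have h2 : (x * B₂ + y) / B₂ = x := by
      rw [Nat.mul_comm, Nat.mul_add_div (by omega), Nat.div_eq_of_lt hy, Nat.add_zero]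
    have h3 : (x * B₂ + y) % B₂ = y := by rw [Nat.mul_comm, Nat.mul_add_mod, Nat.mod_eq_of_lt hy]
    simp [h1, h2, h3]
  | succ t ih =>
    simp only [predIter, relIter]
    refine and_congr_right fun hx => and_congr_right fun hy => ?_
    have h1 : x * B₂ + y < B₁ * B₂ := by nlinarith
    have h2 : (x * B₂ + y) / B₂ = x := by
      rw [Nat.mul_comm, Nat.mul_add_div (by omega), Nat.div_eq_of_lt hy, Nat.add_zero]
    have h3 : (x * B₂ + y) % B₂ = y := by rw [Nat.mul_comm, Nat.mul_add_mod, Nat.mod_eq_of_lt hy]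
    simp only [h1, h2, h3, true_and]
    rw [funext fun x => funext fun y => propext (ih x y)]

theorem CProp.relIter {B₁ B₂ T u v : State → ℕ} {init : State → ℕ → ℕ → Prop}
    {step : State → (ℕ → ℕ → Prop) → ℕ → ℕ → Prop}
    (hB₁ : CIdx Γ B₁) (hB₂ : CIdx Γ B₂) (hT : CIdx Γ T) (hinit : CRel Γ init)
    (hstep : ∀ Γ', Γ ≤ Γ' → ∀ R i j, CRel Γ' R → CIdx Γ' i → CIdx Γ' j →
      CProp Γ' fun s => step s (R s) (i s) (j s))
    (hu : CNat Γ u) (hv : CNat Γ v) :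
    CProp Γ fun s => relIter (B₁ s) (B₂ s) (init s) (step s) (T s) (u s) (v s) := by
  refine ((CProp.lt hu hB₁.1).and ((CProp.lt hv hB₂.1).and
    (CProp.predIter (hB₁.mul hB₂) hT
      (init := fun s i => init s (i / B₂ s) (i % B₂ s))
      (step := fun s A i => step s (fun x y => x < B₁ s ∧ y < B₂ s ∧ A (x * B₂ s + y))
        (i / B₂ s) (i % B₂ s)) (fun Γ' hΓ i hi => ?_)
      (fun Γ' hΓ A i hA hi => ?_) ((hu.mul hB₂).add hv)))).congr
    fun s => (predIter_mul_iff _ _ _ _ _ _ _).symm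
  · exact hinit Γ' hΓ _ _ (hi.div (hB₂.1.mono hΓ)) (hi.mod (hB₂.1.mono hΓ))
  · refine hstep Γ' hΓ (fun s x y => x < B₁ s ∧ y < B₂ s ∧ A s (x * B₂ s + y)) _ _ ?_
      (hi.div (hB₂.1.mono hΓ)) (hi.mod (hB₂.1.mono hΓ))
    intro Γ'' hΓ' x y hx hy
    have h := Ctx.le_trans hΓ hΓ'
    exact (CProp.lt hx.1 (hB₁.1.mono h)).and ((CProp.lt hy.1 (hB₂.1.mono h)).and
      ((hA.mono hΓ').app ((hx.mul (hB₂.mono h)).add hy)))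

end RAM

/-- Reachability by at most `i` arcs of `R`, all of whose ends are below `n`. -/
def reachIn (n : ℕ) (R : ℕ → ℕ → Prop) (u : ℕ) : ℕ → ℕ → Prop
  | 0 => fun y => y = u
  | i + 1 => fun y => reachIn n R u i y ∨ ∃ x < n, y < n ∧ reachIn n R u i x ∧ R x y

/-- Reachability by arcs of `R`, all of whose ends are below `n`. -/
def Reach (n : ℕ) (R : ℕ → ℕ → Prop) : ℕ → ℕ → Prop :=
  Relation.ReflTransGen fun x y => x < n ∧ y < n ∧ R x y

theorem reachIn.mono {n : ℕ} {R : ℕ → ℕ → Prop} {u i j y : ℕ} (hij : i ≤ j)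
    (h : reachIn n R u i y) : reachIn n R u j y := by
  induction hij with
  | refl => exact h
  | step _ ih => exact .inl ih

theorem reachIn.reach {n : ℕ} {R : ℕ → ℕ → Prop} {u i y : ℕ} (h : reachIn n R u i y) :
    Reach n R u y := by
  induction i generalizing y with
  | zero => obtain rfl : y = u := h; exact .refl
  | succ i ih =>
    rcases h with h | ⟨x, hx, hy, h, hxy⟩
    · exact ih h
    · exact (ih h).tail ⟨hx, hy, hxy⟩

/-- As long as the sets of reachable vertices have not become stable, they grow. -/
theorem reachIn_stable_or_card (n : ℕ) (R : ℕ → ℕ → Prop) {u : ℕ} (hu : u < n) (i : ℕ) :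
    (∀ y, reachIn n R u (i + 1) y → reachIn n R u i y) ∨ i + 1 ≤ RAM.cnt n (reachIn n R u i) := by
  classical
  induction i with
  | zero =>
    right
    exact Finset.card_pos.2 ⟨u, Finset.mem_filter.2 ⟨Finset.mem_range.2 hu, rfl⟩⟩
  | succ i ih =>
    by_cases hs : ∀ y, reachIn n R u (i + 1) y → reachIn n R u i y
    · left
      rintro y (h | ⟨x, hx, hy, h, hxy⟩)
      · exact h
      · exact .inr ⟨x, hx, hy, hs x h, hxy⟩
    · right
      have ih := ih.resolve_left hs
      push Not at hs
      obtain ⟨y, hy, hy'⟩ := hs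
      have hyn : y < n := by
        rcases hy with h | ⟨x, hx, hy, h, hxy⟩
        · exact absurd h hy'
        · exact hy
      refine lt_of_le_of_lt ih (Finset.card_lt_card ⟨?_, fun h => hy' ?_⟩)
      · exact fun z hz => by
          simp only [Finset.mem_filter] at hz ⊢
          exact ⟨hz.1, .inl hz.2⟩
      · exact (Finset.mem_filter.1 (h (Finset.mem_filter.2 ⟨Finset.mem_range.2 hyn, hy⟩))).2

theorem reachIn_iff_reach {n : ℕ} {R : ℕ → ℕ → Prop} {u y : ℕ} :
    reachIn n R u n y ↔ Reach n R u y := by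
  refine ⟨reachIn.reach, fun h => ?_⟩
  induction h with
  | refl => exact reachIn.mono (Nat.zero_le _) rfl
  | @tail x y hx hxy ih =>
    have hu : u < n := by
      rcases Relation.ReflTransGen.cases_head hx with rfl | ⟨z, hz, -⟩
      exacts [hxy.1, hz.1]
    rcases reachIn_stable_or_card n R hu n with h | h
    · exact h y (.inr ⟨x, hxy.1, hxy.2.1, ih, hxy.2.2⟩)
    · have := RAM.cnt_le n (reachIn n R u n)
      omega

namespace RAM

variable {Γ Γ' : Ctx}

theorem CProp.reachIn {n u v i : State → ℕ} {R : State → ℕ → ℕ → Prop} (hn : CIdx Γ n)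
    (hR : CRel Γ R) (hu : CNat Γ u) (hi : CIdx Γ i) (hv : CNat Γ v) :
    CProp Γ fun s => reachIn (n s) (R s) (u s) (i s) (v s) := by
  have h : ∀ (n : ℕ) (R : ℕ → ℕ → Prop) (u i v : ℕ), _root_.reachIn n R u i v ↔
      v = u ∨ RAM.predIter n (fun y => y = u) (fun A y => A y ∨ ∃ x < n, A x ∧ R x y) i v := by
    intro n R u i v
    induction i generalizing v with
    | zero => simp only [_root_.reachIn, RAM.predIter]; tauto
    | succ i ih =>
      simp only [_root_.reachIn, RAM.predIter, ih]
      have key : ∀ t y, RAM.predIter n (fun y => y = u)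
          (fun A y => A y ∨ ∃ x < n, A x ∧ R x y) t y → y < n := by
        intro t y h; cases t <;> exact h.1
      have key' : ∀ t, u < n → RAM.predIter n (fun y => y = u)
          (fun A y => A y ∨ ∃ x < n, A x ∧ R x y) t u := by
        intro t h
        induction t with
        | zero => exact ⟨h, rfl⟩
        | succ t ih => exact ⟨h, .inl ih⟩
      constructor
      · rintro ((h | h) | ⟨x, hx, hv, rfl | h, hR⟩)
        · exact .inl h
        · exact .inr ⟨key _ _ h, .inl h⟩
        · exact .inr ⟨hv, .inr ⟨_, hx, key' _ hx, hR⟩⟩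
        · exact .inr ⟨hv, .inr ⟨_, hx, h, hR⟩⟩
      · rintro (h | ⟨h, h' | ⟨x, hx, h', hR⟩⟩)
        · exact .inl (.inl h)
        · exact .inl (.inr h')
        · exact .inr ⟨x, hx, h, .inr h', hR⟩
  refine ((CProp.eq hv hu).or (CProp.predIter hn hi (init := fun s y => y = u s)
    (step := fun s A y => A y ∨ ∃ x < n s, A x ∧ R s x y)
    (fun Γ' hΓ i hi => CProp.eq hi.1 (hu.mono hΓ))
    (fun Γ' hΓ A i hA hi => (hA.app hi).or (CProp.exists_lt (hn.mono hΓ)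
      fun Γ'' hΓ' x hx => ((hA.mono hΓ').app hx).and
        (((hR.mono hΓ).mono hΓ').app hx (hi.mono hΓ')))) hv)).congr fun s => h _ _ _ _ _

theorem CProp.reach {n u v : State → ℕ} {R : State → ℕ → ℕ → Prop} (hn : CIdx Γ n)
    (hR : CRel Γ R) (hu : CNat Γ u) (hv : CNat Γ v) :
    CProp Γ fun s => Reach (n s) (R s) (u s) (v s) :=
  (CProp.reachIn hn hR hu hn hv).congr fun _ => reachIn_iff_reach.symm

end RAM

/-! ### Augmenting paths -/

namespace MinCut

open RAM

/-- In breadth-first search from `a`, the vertex `x` is a possible predecessor of `y`: some ball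
around `a` contains `x`, but not `y`. -/
def IsPred (N : ℕ) (R : ℕ → ℕ → Prop) (a y x : ℕ) : Prop :=
  R x y ∧ ∃ i < N, reachIn N R a i x ∧ ¬ reachIn N R a i y

/-- The predecessor of `y` on a shortest path from `a`, or `N` if there is none. -/
noncomputable def prevNode (N : ℕ) (R : ℕ → ℕ → Prop) (a y : ℕ) : ℕ :=
  leastLT N (IsPred N R a y)

/-- The vertices of a shortest path from `a` to `b`, listed from the end. -/
noncomputable def backPath (N : ℕ) (R : ℕ → ℕ → Prop) (a b : ℕ) : ℕ → ℕ :=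
  natIter b fun _ y => prevNode N R a y

/-- The arcs of a shortest path from `a` to `b`. -/
def OnPath (N : ℕ) (R : ℕ → ℕ → Prop) (a b x y : ℕ) : Prop :=
  x < N ∧ y < N ∧ ∃ i < N, y = backPath N R a b i ∧ x = prevNode N R a y

/-- The residual graph after augmentation: the arcs of a shortest path from `a` to `b` are
reversed. -/
def augment (N a b : ℕ) (R : ℕ → ℕ → Prop) (x y : ℕ) : Prop :=
  R x y ∧ ¬ OnPath N R a b x y ∨ OnPath N R a b y x

/-- The residual graph of a maximum flow of unit capacities from `a` to `b`. -/
def residual (N a b : ℕ) (R : ℕ → ℕ → Prop) : ℕ → ℕ → Prop :=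
  relIter N N R (augment N a b) (N + 1)

open Classical in
/-- The arcs of `R` that leave the set `X`. -/
noncomputable def outArcs (N : ℕ) (R : ℕ → ℕ → Prop) (X : ℕ → Prop) : Finset (ℕ × ℕ) :=
  {e ∈ Finset.range N ×ˢ Finset.range N | R e.1 e.2 ∧ X e.1 ∧ ¬ X e.2}

variable {N a b : ℕ} {R : ℕ → ℕ → Prop}

theorem exists_isPred {y : ℕ} (hy : Reach N R a y) (hya : y ≠ a) : ∃ x < N, IsPred N R a y x := by
  classical
  have h : ∃ i, reachIn N R a i y := ⟨N, reachIn_iff_reach.2 hy⟩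
  have h0 : Nat.find h ≠ 0 := fun h0 => hya (by
    have := Nat.find_spec h
    rw [h0] at this
    exact this)
  obtain ⟨i, hi⟩ := Nat.exists_eq_succ_of_ne_zero h0
  have h1 : ¬ reachIn N R a i y := Nat.find_min h (by omega)
  have h2 := Nat.find_spec h
  rw [hi] at h2
  have h3 : Nat.find h ≤ N := Nat.find_min' h (reachIn_iff_reach.2 hy)
  rcases h2 with h2 | ⟨x, hx, hyN, h2, hR⟩
  · exact absurd h2 h1
  · exact ⟨x, hx, hR, i, by omega, h2, h1⟩

theorem prevNode_spec {y : ℕ} (hy : Reach N R a y) (hya : y ≠ a) :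
    prevNode N R a y < N ∧ IsPred N R a y (prevNode N R a y) :=
  leastLT_spec (exists_isPred hy hya)

/-- The distance from `a`. -/
noncomputable def dist (N : ℕ) (R : ℕ → ℕ → Prop) (a y : ℕ) : ℕ := sInf {i | reachIn N R a i y}

theorem reachIn_dist {y : ℕ} (hy : Reach N R a y) : reachIn N R a (dist N R a y) y :=
  Nat.sInf_mem (s := {i | reachIn N R a i y}) ⟨N, reachIn_iff_reach.2 hy⟩

theorem dist_le {y i : ℕ} (h : reachIn N R a i y) : dist N R a y ≤ i := Nat.sInf_le h

theorem IsPred.dist_lt {x y : ℕ} (hy : Reach N R a y) (h : IsPred N R a y x) :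
    dist N R a x < dist N R a y := by
  obtain ⟨-, i, -, hx, hy'⟩ := h
  refine (dist_le hx).trans_lt ?_
  by_contra hcon
  exact hy' ((reachIn_dist hy).mono (by omega))

/-- If `b` is reachable, then `OnPath` consists of the arcs of a simple path from `a` to `b`. -/
theorem exists_path (hR : ∀ x y, R x y → x < N ∧ y < N) (hb : Reach N R a b) :
    ∃ (l : ℕ) (z : ℕ → ℕ), z 0 = b ∧ z l = a ∧ (∀ i < l, R (z (i + 1)) (z i)) ∧
      (∀ i ≤ l, ∀ j ≤ l, z i = z j → i = j) ∧
      ∀ x y, OnPath N R a b x y ↔ ∃ i < l, x = z (i + 1) ∧ y = z i := by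
  classical
  set z := backPath N R a b with hz
  have hz0 : z 0 = b := rfl
  have hzs : ∀ i, z (i + 1) = prevNode N R a (z i) := fun _ => rfl
  have hreach : ∀ i, (∀ j < i, z j ≠ a) →
      Reach N R a (z i) ∧ dist N R a (z i) + i ≤ dist N R a b := by
    intro i
    induction i with
    | zero => exact fun _ => ⟨hb, le_rfl⟩
    | succ i ih =>
      intro h
      obtain ⟨h1, h2⟩ := ih fun j hj => h j (by omega)
      obtain ⟨h3, h4⟩ := prevNode_spec h1 (h i (by omega))
      have := h4.dist_lt h1
      rw [← hzs] at this h4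
      obtain ⟨-, j, -, h5, -⟩ := h4
      exact ⟨h5.reach, by omega⟩
  have hex : ∃ i, z i = a := by
    by_contra hcon
    push Not at hcon
    have := (hreach (dist N R a b + 1) fun j _ => hcon j).2
    omega
  set l := Nat.find hex with hl
  have hza : z l = a := Nat.find_spec hex
  have hne : ∀ i < l, z i ≠ a := fun i hi => Nat.find_min hex hi
  have hlN : l ≤ N := by
    have h1 := (hreach l hne).2
    have h2 := dist_le (reachIn_iff_reach.2 hb)
    omega
  have hpred : ∀ i < l, z (i + 1) < N ∧ IsPred N R a (z i) (z (i + 1)) := fun i hi =>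
    prevNode_spec (hreach i fun j hj => hne j (by omega)).1 (hne i hi)
  have hdist : ∀ i < l, dist N R a (z (i + 1)) < dist N R a (z i) := fun i hi =>
    (hpred i hi).2.dist_lt (hreach i fun j hj => hne j (by omega)).1
  have hanti : ∀ i j, i < j → j ≤ l → dist N R a (z j) < dist N R a (z i) := by
    intro i j hij
    induction hij with
    | refl => exact fun h => hdist i h
    | @step m _ ih => exact fun h => (hdist m h).trans (ih (by omega))
  have hafter : ∀ i, z (l + 1 + i) = N := by
    intro i
    induction i with
    | zero =>
      rw [Nat.add_zero, hzs, hza]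
      refine leastLT_eq_of_not ?_
      rintro ⟨x, -, -, i, -, -, h⟩
      exact h (reachIn.mono (Nat.zero_le i) rfl)
    | succ i ih =>
      rw [← Nat.add_assoc, hzs, ih]
      refine leastLT_eq_of_not ?_
      rintro ⟨x, -, h, -⟩
      exact absurd (hR _ _ h).2 (lt_irrefl _)
  refine ⟨l, z, hz0, hza, fun i hi => (hpred i hi).2.1, fun i hi j hj hij => ?_, fun x y => ?_⟩
  · rcases lt_trichotomy i j with h | h | h
    · have := hanti i j h hj; rw [hij] at this; omega
    · exact h
    · have := hanti j i h hi; rw [hij] at this; omega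
  · constructor
    · rintro ⟨hx, hy, i, -, rfl, rfl⟩
      rw [← hz] at hx hy ⊢
      refine ⟨i, ?_, rfl, rfl⟩
      by_contra hcon
      rw [← hzs] at hx
      obtain ⟨j, rfl⟩ := Nat.exists_eq_add_of_le (not_lt.1 hcon)
      have := hafter j
      rw [show l + 1 + j = l + j + 1 by omega] at this
      omega
    · rintro ⟨i, hi, rfl, rfl⟩
      exact ⟨(hR _ _ (hpred i hi).2.1).1, (hR _ _ (hpred i hi).2.1).2, i, by omega, rfl, rfl⟩

theorem onPath_subset (hR : ∀ x y, R x y → x < N ∧ y < N) (hb : Reach N R a b) {x y : ℕ}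
    (h : OnPath N R a b x y) : R x y := by
  obtain ⟨l, z, -, -, hz, -, hp⟩ := exists_path hR hb
  obtain ⟨i, hi, rfl, rfl⟩ := (hp x y).1 h
  exact hz i hi

theorem ite_reverse {q r o o' : Prop} [Decidable q] [Decidable r] [Decidable o] [Decidable o']
    {c : ℤ} (hq : q ↔ r ∧ ¬ o ∨ o') (ho : o → r) (ho' : o' → ¬ r) : (if q then c else 0) =
      (if r then c else 0) - (if o then c else 0) + (if o' then c else 0) := by
  by_cases q <;> by_cases r <;> by_cases o <;> by_cases o' <;> simp_all

/-- Reversing a path from `a ∈ X` to `b ∉ X` decreases the number of arcs leaving `X` by one: the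
path leaves `X` once more than it enters it. -/
theorem card_outArcs_augment (hR : ∀ x y, R x y → x < N ∧ y < N)
    (hanti : ∀ x y, R x y → ¬ R y x) (hb : Reach N R a b) {X : ℕ → Prop} (ha : X a) (hbX : ¬ X b) :
    (outArcs N (augment N a b R) X).card + 1 = (outArcs N R X).card := by
  classical
  obtain ⟨l, z, hz0, hzl, hz, hinj, hp⟩ := exists_path hR hb
  have hsub := @onPath_subset N a b R hR hb
  let χ : ℕ → ℤ := fun x => if X x then 1 else 0
  have hcard : ∀ Q : ℕ → ℕ → Prop, ((outArcs N Q X).card : ℤ) =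
      ∑ x ∈ Finset.range N, ∑ y ∈ Finset.range N, (if Q x y then χ x * (1 - χ y) else 0) := by
    intro Q
    rw [outArcs, Finset.card_filter, Finset.sum_product]
    push_cast
    refine Finset.sum_congr rfl fun x _ => Finset.sum_congr rfl fun y _ => ?_
    by_cases h1 : Q x y <;> by_cases h2 : X x <;> by_cases h3 : X y <;> simp [h1, h2, h3, χ]
  have hpath : ∑ x ∈ Finset.range N, ∑ y ∈ Finset.range N,
      (if OnPath N R a b x y then χ y - χ x else 0) = -1 := by
    have him : {e ∈ Finset.range N ×ˢ Finset.range N | OnPath N R a b e.1 e.2} =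
        (Finset.range l).image fun i => (z (i + 1), z i) := by
      ext ⟨x, y⟩
      simp only [Finset.mem_filter, Finset.mem_product, Finset.mem_range, Finset.mem_image,
        Prod.mk.injEq, hp]
      constructor
      · rintro ⟨-, i, hi, rfl, rfl⟩
        exact ⟨i, hi, rfl, rfl⟩
      · rintro ⟨i, hi, rfl, rfl⟩
        exact ⟨hR _ _ (hz i hi), i, hi, rfl, rfl⟩
    rw [← Finset.sum_product' (f := fun x y => if OnPath N R a b x y then χ y - χ x else 0),
      ← Finset.sum_filter, him, Finset.sum_image]
    · have := Finset.sum_range_sub' (fun i => χ (z i)) l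
      simp only at this ⊢
      rw [this, hz0, hzl]
      simp [χ, ha, hbX]
    · intro i hi j hj hij
      simp only [Finset.coe_range, Set.mem_Iio, Prod.mk.injEq] at hi hj hij
      exact hinj i hi.le j hj.le hij.2
  have hdiff : ((outArcs N (augment N a b R) X).card : ℤ) = (outArcs N R X).card +
      ∑ x ∈ Finset.range N, ∑ y ∈ Finset.range N,
        (if OnPath N R a b x y then χ y - χ x else 0) := by
    have hcomm : ∑ x ∈ Finset.range N, ∑ y ∈ Finset.range N,
        (if OnPath N R a b y x then χ x * (1 - χ y) else 0) =
        ∑ x ∈ Finset.range N, ∑ y ∈ Finset.range N,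
        (if OnPath N R a b x y then χ y * (1 - χ x) else 0) := Finset.sum_comm
    have h : ∀ x y, (if augment N a b R x y then χ x * (1 - χ y) else 0) =
        (if R x y then χ x * (1 - χ y) else 0) - (if OnPath N R a b x y then χ x * (1 - χ y) else 0)
        + (if OnPath N R a b y x then χ x * (1 - χ y) else 0) := by
      intro x y
      have h1 := @hsub x y
      have h2 : OnPath N R a b y x → ¬ R x y := fun h => hanti _ _ (hsub h)
      exact ite_reverse Iff.rfl h1 h2
    rw [hcard, hcard]
    simp only [h, Finset.sum_add_distrib, Finset.sum_sub_distrib, hcomm]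
    rw [sub_add, sub_eq_add_neg]
    congr 1
    simp only [← Finset.sum_sub_distrib, ← Finset.sum_neg_distrib]
    refine Finset.sum_congr rfl fun x _ => Finset.sum_congr rfl fun y _ => ?_
    split_ifs <;> ring
  rw [hpath] at hdiff
  omega

theorem augment_of_not_reach (hR : ∀ x y, R x y → x < N ∧ y < N) (hb : ¬ Reach N R a b) :
    augment N a b R = R := by
  have h0 : prevNode N R a b = N := leastLT_eq_of_not (by
    rintro ⟨x, hx, h1, i, -, h2, -⟩
    exact hb (h2.reach.tail ⟨hx, (hR _ _ h1).2, h1⟩))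
  have h1 : ∀ i, backPath N R a b (i + 1) = N := by
    intro i
    induction i with
    | zero => exact h0
    | succ i ih =>
      have : backPath N R a b (i + 1 + 1) = prevNode N R a (backPath N R a b (i + 1)) := rfl
      rw [this, ih]
      refine leastLT_eq_of_not ?_
      rintro ⟨x, -, h, -⟩
      exact absurd (hR _ _ h).2 (lt_irrefl _)
  have h2 : ∀ x y, ¬ OnPath N R a b x y := by
    rintro x y ⟨hx, hy, i, -, rfl, rfl⟩
    cases i with
    | zero => exact absurd h0 (Nat.ne_of_lt hx)
    | succ i => exact absurd (h1 i) (Nat.ne_of_lt hy)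
  funext x y
  simp [augment, h2]

theorem augment_lt (hR : ∀ x y, R x y → x < N ∧ y < N) {x y : ℕ} (h : augment N a b R x y) :
    x < N ∧ y < N := by
  rcases h with h | h
  · exact hR _ _ h.1
  · exact ⟨h.2.1, h.1⟩

theorem augment_antisymm (hR : ∀ x y, R x y → x < N ∧ y < N) (hanti : ∀ x y, R x y → ¬ R y x)
    {x y : ℕ} (h : augment N a b R x y) : ¬ augment N a b R y x := by
  by_cases hb : Reach N R a b
  · have hsub := @onPath_subset N a b R hR hb
    have := @hsub x y
    have := @hsub y x
    have := hanti x y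
    simp only [augment] at h ⊢
    tauto
  · rw [augment_of_not_reach hR hb] at h ⊢
    exact hanti _ _ h

/-- The maximum flow theorem, for residual graphs: if `p` is the value of the flow, then `p` fewer
arcs leave each set that separates `a` from `b`, and `b` is not reachable any more. -/
theorem residual_spec (hR : ∀ x y, R x y → x < N ∧ y < N) (hanti : ∀ x y, R x y → ¬ R y x)
    (hab : a ≠ b) : ¬ Reach N (residual N a b R) a b ∧
      ∃ p, ∀ X : ℕ → Prop, X a → ¬ X b →
        (outArcs N (residual N a b R) X).card + p = (outArcs N R X).card := by
  have key : ∀ T, (∀ x y, relIter N N R (augment N a b) T x y → x < N ∧ y < N) ∧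
      (∀ x y, relIter N N R (augment N a b) T x y → ¬ relIter N N R (augment N a b) T y x) ∧
      ∃ p, (Reach N (relIter N N R (augment N a b) T) a b → T ≤ p) ∧
        ∀ X : ℕ → Prop, X a → ¬ X b →
          (outArcs N (relIter N N R (augment N a b) T) X).card + p = (outArcs N R X).card := by
    intro T
    induction T with
    | zero =>
      have : relIter N N R (augment N a b) 0 = R := by
        funext x y
        exact propext ⟨fun h => h.2.2, fun h => ⟨(hR _ _ h).1, (hR _ _ h).2, h⟩⟩
      rw [this]
      exact ⟨hR, hanti, 0, fun _ => le_rfl, fun _ _ _ => rfl⟩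
    | succ T ih =>
      obtain ⟨h1, h2, p, h3, h4⟩ := ih
      set Q := relIter N N R (augment N a b) T with hQ
      have : relIter N N R (augment N a b) (T + 1) = augment N a b Q := by
        funext x y
        exact propext ⟨fun h => h.2.2, fun h => ⟨(augment_lt h1 h).1, (augment_lt h1 h).2, h⟩⟩
      rw [this]
      refine ⟨fun x y => augment_lt h1, fun x y => augment_antisymm h1 h2, ?_⟩
      by_cases hb : Reach N Q a b
      · refine ⟨p + 1, fun _ => by have := h3 hb; omega, fun X ha hbX => ?_⟩
        have := card_outArcs_augment h1 h2 hb ha hbX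
        have := h4 X ha hbX
        omega
      · rw [augment_of_not_reach h1 hb]
        exact ⟨p, fun h => absurd h hb, h4⟩
  obtain ⟨h1, h2, p, h3, h4⟩ := key (N + 1)
  refine ⟨fun h => ?_, p, h4⟩
  have hp := h3 h
  have h5 := h4 (fun x => x = a) rfl (Ne.symm hab)
  have h6 : (outArcs N R fun x => x = a).card ≤ (({a} : Finset ℕ) ×ˢ Finset.range N).card :=
    Finset.card_le_card fun e he => by
      simp only [outArcs, Finset.mem_filter, Finset.mem_product, Finset.mem_range] at he
      exact Finset.mem_product.2 ⟨Finset.mem_singleton.2 he.2.2.1, Finset.mem_range.2 he.1.2⟩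
  simp only [Finset.card_product, Finset.card_singleton, Finset.card_range] at h6
  omega

/-! ### Minimum vertex separators -/

/-- The set `S` meets every walk in the graph `E` on `{0, …, n - 1}` that starts in `A` and ends
in `B`. -/
def Separates (n : ℕ) (E : ℕ → ℕ → Prop) (A B S : ℕ → Prop) : Prop :=
  ∀ u v, u < n → A u → ¬ S u → Reach n (fun x y => E x y ∧ ¬ S x ∧ ¬ S y) u v → ¬ B v

/-- The flow network for vertex separators: each vertex `v < n` is split into an arc from `v` to
`n + v`; the source `2 * n` is joined to `A` and `B` to the sink `2 * n + 1`. -/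
def network (n : ℕ) (E : ℕ → ℕ → Prop) (A B : ℕ → Prop) (x y : ℕ) : Prop :=
  (x = 2 * n ∧ y < n ∧ A y) ∨ (x < n ∧ y = n + x) ∨
    (n ≤ x ∧ x < 2 * n ∧ y < n ∧ E (x - n) y) ∨
    (n ≤ x ∧ x < 2 * n ∧ B (x - n) ∧ y = 2 * n + 1)

/-- The nodes that are reachable from the source in the residual network of a maximum flow. -/
def sourceSide (n : ℕ) (E : ℕ → ℕ → Prop) (A B : ℕ → Prop) : ℕ → Prop :=
  Reach (2 * n + 2) (residual (2 * n + 2) (2 * n) (2 * n + 1) (network n E A B)) (2 * n)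

/-- A minimum vertex separator of `A` and `B`: each arc of a minimum cut of the network is replaced
by a vertex of the graph on it. -/
def minSep (n : ℕ) (E : ℕ → ℕ → Prop) (A B : ℕ → Prop) (v : ℕ) : Prop :=
  v < n ∧ ((A v ∧ ¬ sourceSide n E A B v) ∨
    (sourceSide n E A B v ∧ ¬ sourceSide n E A B (n + v)) ∨
    (sourceSide n E A B (n + v) ∧ B v) ∨
    ∃ u < n, sourceSide n E A B (n + u) ∧ ¬ sourceSide n E A B v ∧ E u v)

variable {n : ℕ} {E : ℕ → ℕ → Prop} {A B : ℕ → Prop}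

theorem minSep_separates : Separates n E A B (minSep n E A B) := by
  intro u v hu hA hS h hB
  set X := sourceSide n E A B
  have hstep : ∀ v < n, X v → ¬ minSep n E A B v → X (n + v) := fun v hv h1 h2 => by
    by_contra h3
    exact h2 ⟨hv, .inr (.inl ⟨h1, h3⟩)⟩
  have key : v < n ∧ ¬ minSep n E A B v ∧ X (n + v) := by
    clear hB
    induction h with
    | refl =>
      refine ⟨hu, hS, hstep u hu ?_ hS⟩
      by_contra h
      exact hS ⟨hu, .inl ⟨hA, h⟩⟩
    | @tail x y _ hxy ih =>
      obtain ⟨hx, hy, hE, -, hSy⟩ := hxy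
      refine ⟨hy, hSy, hstep y hy ?_ hSy⟩
      by_contra h
      exact hSy ⟨hy, .inr (.inr (.inr ⟨x, hx, ih.2.2, h, hE⟩))⟩
  exact key.2.1 ⟨key.1, .inr (.inr (.inl ⟨key.2.2, hB⟩))⟩

theorem network_lt {x y : ℕ} (h : network n E A B x y) : x < 2 * n + 2 ∧ y < 2 * n + 2 := by
  rcases h with h | h | h | h <;> omega

theorem network_antisymm (hE : ∀ v, ¬ E v v) {x y : ℕ} (h : network n E A B x y) :
    ¬ network n E A B y x := by
  intro h'
  rcases h with h | h | h | h <;> rcases h' with h' | h' | h' | h' <;> try omega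
  · refine hE x ?_
    have := h'.2.2.2
    rwa [h.2, Nat.add_sub_cancel_left] at this
  · refine hE y ?_
    have := h.2.2.2
    rwa [h'.2, Nat.add_sub_cancel_left] at this

theorem cnt_minSep_le (hE : ∀ v, ¬ E v v) {S : ℕ → Prop} (hS : Separates n E A B S) :
    cnt n (minSep n E A B) ≤ cnt n S := by
  classical
  obtain ⟨hnr, p, hp⟩ := residual_spec (N := 2 * n + 2) (a := 2 * n) (b := 2 * n + 1)
    (R := network n E A B) (fun x y => network_lt) (fun x y => network_antisymm hE) (by omega)
  set X := sourceSide n E A B with hX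
  have hXs : X (2 * n) := .refl
  -- The minimum cut has `p` arcs, and each vertex of `minSep` is an end of one of them.
  have h1 : (outArcs (2 * n + 2) (network n E A B) X).card = p := by
    rw [← hp X hXs hnr]
    have : outArcs (2 * n + 2)
        (residual (2 * n + 2) (2 * n) (2 * n + 1) (network n E A B)) X = ∅ := by
      rw [outArcs, Finset.filter_eq_empty_iff]
      rintro ⟨x, y⟩ hxy ⟨h1, h2, h3⟩
      simp only [Finset.mem_product, Finset.mem_range] at hxy
      exact h3 (Relation.ReflTransGen.tail h2 ⟨hxy.1, hxy.2, h1⟩)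
    simp [this]
  have h2 : cnt n (minSep n E A B) ≤ p := by
    rw [← h1, cnt]
    let g : ℕ × ℕ → ℕ := fun e => if e.2 < n then e.2 else if e.2 < 2 * n then e.2 - n else e.1 - n
    refine (Finset.card_le_card (t := (outArcs (2 * n + 2) (network n E A B) X).image g) ?_).trans
      Finset.card_image_le
    intro v hv
    simp only [Finset.mem_filter, Finset.mem_range, Finset.mem_image] at hv ⊢
    have mem : ∀ x y, network n E A B x y → X x → ¬ X y →
        (x, y) ∈ outArcs (2 * n + 2) (network n E A B) X := fun x y h h' h'' =>
      Finset.mem_filter.2 ⟨Finset.mem_product.2 ⟨Finset.mem_range.2 (network_lt h).1,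
        Finset.mem_range.2 (network_lt h).2⟩, h, h', h''⟩
    obtain ⟨hvn, -, h | h | h | ⟨u, hu, h⟩⟩ := hv
    · exact ⟨(2 * n, v), mem _ _ (.inl ⟨rfl, hvn, h.1⟩) hXs h.2, by simp [g, hvn]⟩
    · refine ⟨(v, n + v), mem _ _ (.inr (.inl ⟨hvn, rfl⟩)) h.1 h.2, ?_⟩
      simp only [g]
      split_ifs <;> omega
    · refine ⟨(n + v, 2 * n + 1), mem _ _ (.inr (.inr (.inr ⟨by omega, by omega, ?_, rfl⟩)))
        h.1 hnr, ?_⟩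
      · rw [Nat.add_sub_cancel_left]; exact h.2
      · simp only [g]
        split_ifs <;> omega
    · refine ⟨(n + u, v), mem _ _ (.inr (.inr (.inl ⟨by omega, by omega, hvn, ?_⟩)))
        h.1 h.2.1, by simp [g, hvn]⟩
      rw [Nat.add_sub_cancel_left]; exact h.2.2
  -- The vertices of `S` give a cut with one arc for each vertex of `S`.
  let Q : ℕ → Prop := fun v => ∃ u < n, A u ∧ ¬ S u ∧ Reach n (fun x y => E x y ∧ ¬ S x ∧ ¬ S y) u v
  have hQS : ∀ v, Q v → ¬ S v := by
    rintro v ⟨u, hu, hA, hSu, h⟩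
    rcases Relation.ReflTransGen.cases_tail h with rfl | ⟨w, -, -, -, -, -, h⟩
    exacts [hSu, h]
  have hQE : ∀ v w, Q v → v < n → w < n → E v w → ¬ S w → Q w := by
    rintro v w ⟨u, hu, hA, hSu, h⟩ hv hw hvw hSw
    exact ⟨u, hu, hA, hSu, h.tail ⟨hv, hw, hvw, hQS v ⟨u, hu, hA, hSu, h⟩, hSw⟩⟩
  let Y : ℕ → Prop := fun x => x = 2 * n ∨ (x < n ∧ (S x ∨ Q x)) ∨
    (n ≤ x ∧ x < 2 * n ∧ Q (x - n))
  have hYb : ¬ Y (2 * n + 1) := by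
    rintro (h | h | h) <;> omega
  have h3 := hp Y (.inl rfl) hYb
  refine h2.trans ((by omega : p ≤ (outArcs (2 * n + 2) (network n E A B) Y).card).trans ?_)
  rw [cnt]
  refine (Finset.card_le_card (t := ((Finset.range n).filter S).image fun v => (v, n + v)) ?_).trans
    Finset.card_image_le
  rintro ⟨x, y⟩ hxy
  simp only [outArcs, Finset.mem_filter, Finset.mem_product, Finset.mem_range, Finset.mem_image,
    Prod.mk.injEq] at hxy ⊢
  obtain ⟨-, hxy, hYx, hYy⟩ := hxy
  rcases hxy with ⟨rfl, hy, hA⟩ | ⟨hx, rfl⟩ | ⟨hx, hx', hy, hE'⟩ | ⟨hx, hx', hB, rfl⟩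
  · refine absurd (.inr (.inl ⟨hy, ?_⟩)) hYy
    by_cases hS' : S y
    · exact .inl hS'
    · exact .inr ⟨y, hy, hA, hS', .refl⟩
  · rcases hYx with h | ⟨-, h | h⟩ | h
    · omega
    · exact ⟨x, ⟨hx, h⟩, rfl, rfl⟩
    · refine absurd (.inr (.inr ⟨by omega, by omega, ?_⟩)) hYy
      rwa [Nat.add_sub_cancel_left]
    · omega
  · rcases hYx with h | h | ⟨-, -, h⟩
    · omega
    · omega
    · refine absurd (.inr (.inl ⟨hy, ?_⟩)) hYy
      by_cases hS' : S y
      · exact .inl hS'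
      · exact .inr (hQE _ _ h (by omega) hy hE' hS')
  · rcases hYx with h | h | ⟨-, -, u, hu, hA, hSu, h⟩
    · omega
    · omega
    · exact absurd hB (hS u _ hu hA hSu h)

end MinCut

namespace RAM

variable {Γ : Ctx}

theorem CRel.augment {N a b : State → ℕ} {R : State → ℕ → ℕ → Prop} (hN : CIdx Γ N)
    (ha : CIdx Γ a) (hb : CIdx Γ b) (hR : CRel Γ R) :
    CRel Γ fun s => MinCut.augment (N s) (a s) (b s) (R s) := by
  have hprev : CFun Γ fun s => MinCut.prevNode (N s) (R s) (a s) := fun Γ₁ h₁ y hy =>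
    (CIdx.leastLT (hN.mono h₁) fun Γ₂ h₂ x hx =>
      have h := Ctx.le_trans h₁ h₂
      ((hR.mono h).app hx (hy.mono h₂)).and (CProp.exists_lt (hN.mono h) fun Γ₃ h₃ i hi =>
        have h' := Ctx.le_trans h h₃
        (CProp.reachIn (hN.mono h') (hR.mono h') (ha.mono h').1 hi (hx.mono h₃).1).and
          (CProp.reachIn (hN.mono h') (hR.mono h') (ha.mono h').1 hi
            ((hy.mono h₂).mono h₃).1).not)).1
  have hback : CFun Γ fun s => MinCut.backPath (N s) (R s) (a s) (b s) := by
    intro Γ₁ h₁ i hi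
    -- The iterated number is used as an index, so it has to be capped by a bound for its values.
    refine (CNat.natIter hi (hb.mono h₁).1
      (f := fun s _ y => MinCut.prevNode (N s) (R s) (a s) (min y (N s + b s)))
      fun Γ₂ h₂ t y _ hy => (hprev.mono (Ctx.le_trans h₁ h₂)).app
        (hy.cap ((hN.add hb).mono (Ctx.le_trans h₁ h₂)))).congr fun s => ?_
    have key : ∀ t, MinCut.backPath (N s) (R s) (a s) (b s) t =
        RAM.natIter (b s) (fun _ y => MinCut.prevNode (N s) (R s) (a s) (min y (N s + b s))) t ∧
        MinCut.backPath (N s) (R s) (a s) (b s) t ≤ N s + b s := by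
      intro t
      induction t with
      | zero => exact ⟨rfl, Nat.le_add_left _ _⟩
      | succ t ih =>
        have h : MinCut.backPath (N s) (R s) (a s) (b s) (t + 1) = MinCut.prevNode (N s) (R s) (a s)
          (MinCut.backPath (N s) (R s) (a s) (b s) t) := rfl
        refine ⟨?_, ?_⟩
        · rw [h, RAM.natIter, ← ih.1, min_eq_left ih.2]
        · rw [h]
          exact (leastLT_le _ _).trans (Nat.le_add_right _ _)
    exact (key _).1
  have hon : CRel Γ fun s => MinCut.OnPath (N s) (R s) (a s) (b s) := fun Γ₁ h₁ x y hx hy =>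
    (CProp.lt hx.1 (hN.mono h₁).1).and ((CProp.lt hy.1 (hN.mono h₁).1).and
      (CProp.exists_lt (hN.mono h₁) fun Γ₂ h₂ i hi =>
        have h := Ctx.le_trans h₁ h₂
        (CProp.eq (hy.mono h₂).1 ((hback.mono h).app hi)).and
          (CProp.eq (hx.mono h₂).1 ((hprev.mono h).app (hy.mono h₂)))))
  exact fun Γ₁ h₁ x y hx hy => (((hR.mono h₁).app hx hy).and ((hon.mono h₁).app hx hy).not).or
    ((hon.mono h₁).app hy hx)

theorem CPred.minSep {n : State → ℕ} {E : State → ℕ → ℕ → Prop} {A B : State → ℕ → Prop}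
    (hn : CIdx Γ n) (hE : CRel Γ E) (hA : CPred Γ A) (hB : CPred Γ B) :
    CPred Γ fun s => MinCut.minSep (n s) (E s) (A s) (B s) := by
  have h2n : CIdx Γ fun s => 2 * n s := (CIdx.const 2).mul hn
  have hnet : CRel Γ fun s => MinCut.network (n s) (E s) (A s) (B s) := fun Γ₁ h₁ x y hx hy =>
    have hn := hn.mono h₁
    have h2n := h2n.mono h₁
    have hxn := hx.sub hn.1
    ((CProp.eq hx.1 h2n.1).and ((CProp.lt hy.1 hn.1).and ((hA.mono h₁).app hy))).or
      (((CProp.lt hx.1 hn.1).and (CProp.eq hy.1 (hn.1.add hx.1))).or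
        (((CProp.le hn.1 hx.1).and ((CProp.lt hx.1 h2n.1).and ((CProp.lt hy.1 hn.1).and
          ((hE.mono h₁).app hxn hy)))).or
          ((CProp.le hn.1 hx.1).and ((CProp.lt hx.1 h2n.1).and (((hB.mono h₁).app hxn).and
            (CProp.eq hy.1 (h2n.1.add (.const 1))))))))
  have hN : CIdx Γ fun s => 2 * n s + 2 := h2n.add (.const 2)
  have hside : CPred Γ fun s => MinCut.sourceSide (n s) (E s) (A s) (B s) := fun Γ₁ h₁ v hv =>
    CProp.reach (hN.mono h₁) (fun Γ₂ h₂ x y hx hy =>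
      have h := Ctx.le_trans h₁ h₂
      CProp.relIter (hN.mono h) (hN.mono h) ((hN.mono h).add (.const 1)) (hnet.mono h)
        (fun Γ₃ h₃ R i j hR hi hj =>
          have h' := Ctx.le_trans h h₃
          (CRel.augment (hN.mono h') (h2n.mono h') ((h2n.mono h').add (.const 1)) hR).app hi hj)
        hx.1 hy.1) (h2n.mono h₁).1 hv.1
  intro Γ₁ h₁ v hv
  have hside₁ := hside.mono h₁
  have hn₁ := hn.mono h₁
  have hnv := hside₁.app (hn₁.add hv)
  exact (CProp.lt hv.1 hn₁.1).and
    ((((hA.mono h₁).app hv).and (hside₁.app hv).not).or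
      (((hside₁.app hv).and hnv.not).or ((hnv.and ((hB.mono h₁).app hv)).or
        (CProp.exists_lt hn₁ fun Γ₂ h₂ u hu =>
          ((hside₁.mono h₂).app ((hn₁.mono h₂).add hu)).and
            (((hside₁.mono h₂).app (hv.mono h₂)).not.and
              (((hE.mono h₁).mono h₂).app hu (hv.mono h₂)))))))

end RAM

/-! ### Balanced separators from tree decompositions -/

/-- Numbers of sum at most `m`, each at most `m / 2`, can be split into two groups of sum at most
`2 * m / 3`. -/
theorem exists_balanced_split {ι : Type*} [Fintype ι] [DecidableEq ι] (f : ι → ℕ) (m : ℕ)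
    (hm : ∑ i, f i ≤ m) (hf : ∀ i, 2 * f i ≤ m) :
    ∃ J : Finset ι, 3 * ∑ i ∈ J, f i ≤ 2 * m ∧ 3 * ∑ i ∈ Jᶜ, f i ≤ 2 * m := by
  have hc : ∀ J : Finset ι, ∑ i ∈ J, f i + ∑ i ∈ Jᶜ, f i = ∑ i, f i := fun J =>
    Finset.sum_add_sum_compl J f
  by_cases h0 : 3 * ∑ i, f i ≤ 2 * m
  · exact ⟨Finset.univ, h0, by simp⟩
  -- A minimal set of indices whose sum is at least `m / 3`.
  obtain ⟨J, hJ, hmin⟩ := (wellFounded_lt (α := Finset ι)).has_min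
    {J : Finset ι | m ≤ 3 * ∑ i ∈ J, f i}
    ⟨Finset.univ, by simp only [Set.mem_ofPred_eq]; omega⟩
  simp only [Set.mem_ofPred_eq] at hJ hmin
  by_cases h1 : 3 * ∑ i ∈ J, f i ≤ 2 * m
  · exact ⟨J, h1, by have := hc J; omega⟩
  -- It exceeds `2 * m / 3` only if it consists of one large number.
  have hne : J.Nonempty := by
    rw [Finset.nonempty_iff_ne_empty]
    rintro rfl
    simp at h1
  obtain ⟨j, hj⟩ := hne
  have h2 : ¬ m ≤ 3 * ∑ i ∈ J.erase j, f i := fun h => hmin _ h (Finset.erase_ssubset hj)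
  have h3 := Finset.add_sum_erase J f hj
  have h4 := hf j
  refine ⟨{j}, ?_, ?_⟩
  · rw [Finset.sum_singleton]; omega
  · have := hc {j}
    rw [Finset.sum_singleton] at this
    omega

namespace SimpleGraph

variable {α : Type*} {H : SimpleGraph α}

/-- The node `x` lies in the branch at `t` that starts with the node `t'`. -/
def Branch (H : SimpleGraph α) (t t' x : α) : Prop :=
  Relation.ReflTransGen (fun a b => H.Adj a b ∧ a ≠ t ∧ b ≠ t) t' x

theorem exists_branch (hH : H.Connected) {t x : α} (hx : x ≠ t) :
    ∃ t', H.Adj t t' ∧ H.Branch t t' x := by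
  have h := (reachable_iff_reflTransGen t x).1 (hH.preconnected t x)
  induction h with
  | refl => exact absurd rfl hx
  | @tail y z _ hyz ih =>
    by_cases hy : y = t
    · exact ⟨z, hy ▸ hyz, .refl⟩
    · obtain ⟨t', h1, h2⟩ := ih hy
      exact ⟨t', h1, h2.tail ⟨hyz, hy, hx⟩⟩

theorem Branch.reachable_deleteEdge {t t' x : α} (h : H.Branch t t' x) (u : α) :
    (H.deleteEdges {s(t, u)}).Reachable t' x := by
  induction h with
  | refl => exact .rfl
  | tail _ hyz ih =>
    refine ih.trans (Adj.reachable ?_)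
    simp only [deleteEdges_adj, Set.mem_singleton_iff, Sym2.eq_iff]
    exact ⟨hyz.1, fun h => by rcases h with h | h <;> [exact hyz.2.1 h.1; exact hyz.2.2 h.2]⟩

theorem Branch.unique (hH : H.IsAcyclic) {t t' t'' x : α} (ht' : H.Adj t t') (ht'' : H.Adj t t'')
    (h' : H.Branch t t' x) (h'' : H.Branch t t'' x) : t' = t'' := by
  by_contra hne
  have hb := isAcyclic_iff_forall_adj_isBridge.1 hH ht'
  rw [isBridge_iff] at hb
  refine hb (Reachable.trans (Adj.reachable ?_)
    ((h''.reachable_deleteEdge t').trans (h'.reachable_deleteEdge t').symm))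
  simp only [deleteEdges_adj, Set.mem_singleton_iff, Sym2.eq_iff]
  refine ⟨ht'', fun h => ?_⟩
  rcases h with h | h
  · exact hne h.2.symm
  · exact ht'.ne h.1

theorem Branch.not_opposite (hH : H.IsAcyclic) {t t' x : α} (ht' : H.Adj t t')
    (h : H.Branch t t' x) : ¬ H.Branch t' t x := by
  intro h'
  have hb := isAcyclic_iff_forall_adj_isBridge.1 hH ht'
  rw [isBridge_iff] at hb
  have h1 := h'.reachable_deleteEdge t
  rw [Sym2.eq_swap] at h1
  exact hb (h1.trans (h.reachable_deleteEdge t').symm)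

/-- Every set `W` of vertices has a balanced separator that is a bag. -/
theorem TreeDecomposition.exists_balanced_bag {V : Type*} {G : SimpleGraph V}
    (T : G.TreeDecomposition) (W : Finset V) :
    ∃ (t : Fin T.size) (P Q : Set V), (∀ v, v ∈ T.bag t ∨ v ∈ P ∨ v ∈ Q) ∧
      (∀ v ∈ P, v ∉ T.bag t) ∧ (∀ u ∈ P, ∀ v ∈ Q, ¬ G.Adj u v) ∧
      3 * (W ∩ P : Set V).ncard ≤ 2 * W.card ∧ 3 * (W ∩ Q : Set V).ncard ≤ 2 * W.card := by
  classical
  have hconn := T.isTree.connected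
  have hacyc := T.isTree.isAcyclic
  have hbr : ∀ t x, x ≠ t → ∃ t', T.tree.Adj t t' ∧ T.tree.Branch t t' x :=
    fun t x hx => exists_branch hconn hx
  have hbag : ∀ v, ∃ x, v ∈ T.bag x := fun v => by
    obtain ⟨⟨x, hx⟩⟩ := (T.connected v).nonempty
    exact ⟨x, hx⟩
  choose nd hnd using hbag
  -- `dir t v` is the neighbour of `t` towards the bags that contain `v`.
  have hdir : ∀ t v, ∃ t', v ∉ T.bag t →
      T.tree.Adj t t' ∧ ∀ x, v ∈ T.bag x → T.tree.Branch t t' x := by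
    intro t v
    by_cases hv : v ∈ T.bag t
    · exact ⟨t, fun h => absurd hv h⟩
    have hne : ∀ x, v ∈ T.bag x → x ≠ t := fun x hx h => hv (h ▸ hx)
    obtain ⟨t', h1, h2⟩ := hbr t (nd v) (hne _ (hnd v))
    refine ⟨t', fun _ => ⟨h1, fun x hx => ?_⟩⟩
    have h := (reachable_iff_reflTransGen _ _).1
      ((T.connected v).preconnected ⟨nd v, hnd v⟩ ⟨x, hx⟩)
    have key : ∀ y : {x | v ∈ T.bag x}, Relation.ReflTransGen
        (T.tree.induce {x | v ∈ T.bag x}).Adj ⟨nd v, hnd v⟩ y → T.tree.Branch t t' y := by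
      intro y hy
      induction hy with
      | refl => exact h2
      | @tail y z _ hyz ih => exact ih.tail ⟨hyz, hne _ y.2, hne _ z.2⟩
    exact key _ h
  choose dir hdir using hdir
  have hadj : ∀ t u v, u ∉ T.bag t → v ∉ T.bag t → G.Adj u v → dir t u = dir t v := by
    intro t u v hu hv huv
    obtain ⟨x, hux, hvx⟩ := T.exists_bag_of_adj u v huv
    exact Branch.unique hacyc (hdir t u hu).1 (hdir t v hv).1 ((hdir t u hu).2 x hux)
      ((hdir t v hv).2 x hvx)
  let F : Fin T.size → Fin T.size → Finset V := fun t t' => {v ∈ W | v ∉ T.bag t ∧ dir t v = t'}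
  -- A node at which no branch is heavy.
  obtain ⟨t, ht⟩ : ∃ t, ∀ t', 2 * (F t t').card ≤ W.card := by
    by_contra hcon
    push Not at hcon
    choose g hg using hcon
    have hgadj : ∀ t, T.tree.Adj t (g t) := by
      intro t
      have hpos : 0 < (F t (g t)).card := by have := hg t; omega
      obtain ⟨v, hv⟩ := Finset.card_pos.1 hpos
      simp only [F, Finset.mem_filter] at hv
      exact hv.2.2 ▸ (hdir t v hv.2.1).1
    have hcard : T.tree.edgeFinset.card < (Finset.univ : Finset (Fin T.size)).card := by
      have := T.isTree.card_edgeFinset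
      rw [Finset.card_univ]
      omega
    obtain ⟨t, -, t', -, hne, he⟩ := Finset.exists_ne_map_eq_of_card_lt_of_maps_to hcard
      (f := fun t => s(t, g t)) fun t _ => by
        simpa using hgadj t
    obtain ⟨h1, h2⟩ : t = g t' ∧ g t = t' := by
      rcases Sym2.eq_iff.1 he with h | h
      · exact absurd h.1 hne
      · exact h
    have h3 := hg t
    have h4 := hg t'
    have h5 : (F t (g t) ∪ F t' (g t')).card ≤ W.card :=
      Finset.card_le_card (Finset.union_subset (Finset.filter_subset _ _)
        (Finset.filter_subset _ _))
    have h6 := Finset.card_union_add_card_inter (F t (g t)) (F t' (g t'))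
    have hpos : 0 < (F t (g t) ∩ F t' (g t')).card := by omega
    obtain ⟨v, hv⟩ := Finset.card_pos.1 hpos
    simp only [F, Finset.mem_inter, Finset.mem_filter] at hv
    obtain ⟨⟨-, h7, h8⟩, -, h9, h10⟩ := hv
    have h11 := (hdir t v h7).2 _ (hnd v)
    have h12 := (hdir t' v h9).2 _ (hnd v)
    rw [h8, h2] at h11
    rw [h10, ← h1] at h12
    exact Branch.not_opposite hacyc (h2 ▸ hgadj t) h11 h12
  have hfib : ∀ J : Finset (Fin T.size),
      {v ∈ W | v ∉ T.bag t ∧ dir t v ∈ J}.card = ∑ t' ∈ J, (F t t').card := by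
    intro J
    rw [Finset.card_eq_sum_card_fiberwise (f := dir t) (t := J)
      (fun v hv => (Finset.mem_filter.1 hv).2.2)]
    refine Finset.sum_congr rfl fun t' ht' => congrArg _ ?_
    ext v
    simp only [F, Finset.mem_filter]
    constructor
    · rintro ⟨⟨h1, h2, -⟩, h3⟩; exact ⟨h1, h2, h3⟩
    · rintro ⟨h1, h2, h3⟩; exact ⟨⟨h1, h2, h3 ▸ ht'⟩, h3⟩
  obtain ⟨J, hJ, hJ'⟩ := exists_balanced_split (fun t' => (F t t').card) W.card
    (by rw [← hfib]; exact Finset.card_le_card (Finset.filter_subset _ _)) ht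
  rw [← hfib] at hJ hJ'
  refine ⟨t, {v | v ∉ T.bag t ∧ dir t v ∈ J}, {v | v ∉ T.bag t ∧ dir t v ∉ J},
    fun v => ?_, fun v hv => hv.1, fun u hu v hv huv => ?_, ?_, ?_⟩
  · by_cases h1 : v ∈ T.bag t
    · exact .inl h1
    · by_cases h2 : dir t v ∈ J
      · exact .inr (.inl ⟨h1, h2⟩)
      · exact .inr (.inr ⟨h1, h2⟩)
  · exact hv.2 (hadj t u v hu.1 hv.1 huv ▸ hu.2)
  · convert hJ
    rw [← Set.ncard_coe_finset]
    congr 1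
    ext v
    simp
  · convert hJ'
    rw [← Set.ncard_coe_finset]
    congr 1
    ext v
    simp

/-- The width of some tree decomposition is the treewidth. -/
theorem exists_width_eq_treewidth {V : Type*} [Fintype V] (G : SimpleGraph V) :
    ∃ T : G.TreeDecomposition, T.width = G.treewidth :=
  Nat.sInf_mem (Set.range_nonempty _)

theorem TreeDecomposition.card_bag_le {V : Type*} {G : SimpleGraph V} (T : G.TreeDecomposition)
    (t : Fin T.size) : (T.bag t).card ≤ T.width + 1 := by
  have : (T.bag t).card ≤ Finset.univ.sup fun t => (T.bag t).card :=
    Finset.le_sup (f := fun t => (T.bag t).card) (Finset.mem_univ t)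
  rw [TreeDecomposition.width]
  omega

end SimpleGraph

/-! ### Elimination orders of small width -/

namespace RAM

theorem cnt_mono {n : ℕ} {p q : ℕ → Prop} (h : ∀ x < n, p x → q x) : cnt n p ≤ cnt n q := by
  classical
  refine Finset.card_le_card fun x hx => ?_
  simp only [Finset.mem_filter, Finset.mem_range] at hx ⊢
  exact ⟨hx.1, h x hx.1 hx.2⟩

theorem cnt_pos {n : ℕ} {p : ℕ → Prop} : 0 < cnt n p ↔ ∃ x < n, p x := by
  simp [cnt, Finset.card_pos, Finset.Nonempty]

theorem cnt_eq_zero {n : ℕ} {p : ℕ → Prop} : cnt n p = 0 ↔ ∀ x < n, ¬ p x := by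
  simp [cnt, Finset.filter_eq_empty_iff]

theorem cnt_eq_card {n : ℕ} {p : ℕ → Prop} {s : Finset ℕ} (h : ∀ x, x ∈ s ↔ x < n ∧ p x) :
    cnt n p = s.card := by
  classical
  rw [cnt]
  congr 1
  ext x
  rw [h, Finset.mem_filter, Finset.mem_range]

theorem cnt_or_le (n : ℕ) (p q : ℕ → Prop) : cnt n (fun x => p x ∨ q x) ≤ cnt n p + cnt n q := by
  classical
  rw [cnt_eq_card (s := (Finset.range n).filter p ∪ (Finset.range n).filter q) (by simp; tauto)]
  convert Finset.card_union_le _ _ <;> exact cnt_eq_card (by simp)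

theorem cnt_eq_le_one (n v : ℕ) : cnt n (fun x => x = v) ≤ 1 := by
  classical
  rw [cnt_eq_card (s := (Finset.range n).filter fun x => x = v) fun x => by
    rw [Finset.mem_filter, Finset.mem_range]]
  refine Finset.card_le_one.2 fun x hx y hy => ?_
  rw [(Finset.mem_filter.1 hx).2, (Finset.mem_filter.1 hy).2]

theorem cnt_and_not {n : ℕ} {p q : ℕ → Prop} (h : ∀ x < n, q x → p x) :
    cnt n (fun x => p x ∧ ¬ q x) + cnt n q = cnt n p := by
  classical
  rw [cnt_eq_card (s := (Finset.range n).filter p \ (Finset.range n).filter q)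
      (by simp; tauto), cnt_eq_card (p := q) (s := (Finset.range n).filter q) (by simp),
    cnt_eq_card (p := p) (s := (Finset.range n).filter p) (by simp)]
  refine Finset.card_sdiff_add_card_eq_card fun x hx => ?_
  simp only [Finset.mem_filter, Finset.mem_range] at hx ⊢
  exact ⟨hx.1, h x hx.1 hx.2⟩

theorem cnt_lt_cnt {n m : ℕ} {p : ℕ → Prop} (hnm : n < m) (hp : p n) : cnt n p < cnt m p := by
  classical
  refine Finset.card_lt_card ⟨fun x hx => ?_, fun h => ?_⟩
  · simp only [Finset.mem_filter, Finset.mem_range] at hx ⊢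
    exact ⟨by omega, hx.2⟩
  · have := h (Finset.mem_filter.2 ⟨Finset.mem_range.2 hnm, hp⟩)
    simp at this

/-- The elements of a set are determined by their ranks. -/
theorem eq_of_cnt_eq {u v : ℕ} {p : ℕ → Prop} (hu : p u) (hv : p v) (h : cnt u p = cnt v p) :
    u = v := by
  rcases lt_trichotomy u v with h' | h' | h'
  · have := cnt_lt_cnt h' hu; omega
  · exact h'
  · have := cnt_lt_cnt h' hv; omega

end RAM

theorem Reach.symm {n : ℕ} {R : ℕ → ℕ → Prop} (hR : ∀ x y, R x y → R y x) {u v : ℕ}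
    (h : Reach n R u v) : Reach n R v u := by
  induction h with
  | refl => exact .refl
  | tail _ h ih => exact .head ⟨h.2.1, h.1, hR _ _ h.2.2⟩ ih

theorem Reach.mono {n : ℕ} {R R' : ℕ → ℕ → Prop} (hR : ∀ x y, R x y → R' x y) {u v : ℕ}
    (h : Reach n R u v) : Reach n R' u v :=
  Relation.ReflTransGen.mono (fun _ _ h => ⟨h.1, h.2.1, hR _ _ h.2.2⟩) _ _ h

theorem exists_testBit (m : ℕ) (p : ℕ → Prop) :
    ∃ c < 2 ^ m, ∀ i < m, c.testBit i = true ↔ p i := by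
  classical
  refine ⟨Nat.ofBits fun i : Fin m => decide (p i), Nat.ofBits_lt_two_pow _, fun i hi => ?_⟩
  rw [Nat.testBit_ofBits_lt _ _ hi]
  simp

namespace Elimination

open RAM

/-- The component of `v` in the graph of the vertices that have not been placed: a time `0` marks
these. -/
def InComp (n : ℕ) (E : ℕ → ℕ → Prop) (τ : ℕ → ℕ) (v x : ℕ) : Prop :=
  Reach n (fun a b => E a b ∧ τ a = 0 ∧ τ b = 0) v x

/-- The placed neighbours of the component of `v`. -/
def Front (n : ℕ) (E : ℕ → ℕ → Prop) (τ : ℕ → ℕ) (v u : ℕ) : Prop :=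
  u < n ∧ τ u ≠ 0 ∧ ∃ x < n, InComp n E τ v x ∧ E x u

/-- The first vertex that has not been placed. -/
noncomputable def first (n : ℕ) (τ : ℕ → ℕ) : ℕ := leastLT n fun v => τ v = 0

/-- The subset of `W` that is encoded by the binary digits of `c` from position `o` on, indexed by
the ranks of the elements of `W`. -/
def Coded (W : ℕ → Prop) (o c u : ℕ) : Prop := W u ∧ c.testBit (o + cnt u W) = true

/-- A minimum separator of the two subsets of `W` that are encoded by `c`. -/
def codedSep (n w : ℕ) (E : ℕ → ℕ → Prop) (W : ℕ → Prop) (c : ℕ) : ℕ → Prop :=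
  MinCut.minSep n E (Coded W 0 c) (Coded W (9 * w) c)

/-- The separator of the two subsets of `W` that are encoded by `c` is small. -/
def Splits (n w : ℕ) (E : ℕ → ℕ → Prop) (W : ℕ → Prop) (c : ℕ) : Prop :=
  cnt n (codedSep n w E W c) < cnt n (Coded W 0 c) ∧
    cnt n (codedSep n w E W c) < cnt n (Coded W (9 * w) c) ∧
      cnt n (codedSep n w E W c) ≤ 2 * w

/-- The first code of two subsets of `W` with a small separator. -/
noncomputable def splitCode (n w : ℕ) (E : ℕ → ℕ → Prop) (W : ℕ → Prop) : ℕ :=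
  leastLT (2 ^ (18 * w)) (Splits n w E W)

/-- The vertices that are placed next: the first remaining vertex `v` and, if two subsets of the
front of its component have a small separator, also the part of that separator in the
component. -/
def Next (n w : ℕ) (E : ℕ → ℕ → Prop) (τ : ℕ → ℕ) (u : ℕ) : Prop :=
  u = first n τ ∨
    (splitCode n w E (Front n E τ (first n τ)) < 2 ^ (18 * w) ∧
      codedSep n w E (Front n E τ (first n τ)) (splitCode n w E (Front n E τ (first n τ))) u ∧
      InComp n E τ (first n τ) u)

open Classical in
/-- One round of placing vertices. -/
noncomputable def place (n w : ℕ) (E : ℕ → ℕ → Prop) (t : ℕ) (τ : ℕ → ℕ) (u : ℕ) : ℕ :=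
  if τ u = 0 ∧ Next n w E τ u then t + 1 else τ u

/-- The times at which the vertices are placed, up to time `t`. -/
noncomputable def times (n w : ℕ) (E : ℕ → ℕ → Prop) : ℕ → ℕ → ℕ :=
  arrIter n (fun _ => 0) (place n w E)

/-- The order of the vertices by time, with ties broken by the numbering. -/
def Before (τ : ℕ → ℕ) (u v : ℕ) : Prop := τ u < τ v ∨ τ u = τ v ∧ u < v

/-- The vertices before `v` that have a neighbour in the component of `v` in the graph of the
vertices not before `v`. -/
def Back (n : ℕ) (E : ℕ → ℕ → Prop) (τ : ℕ → ℕ) (v u : ℕ) : Prop :=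
  u < n ∧ Before τ u v ∧
    ∃ x < n, Reach n (fun a b => E a b ∧ ¬ Before τ a v ∧ ¬ Before τ b v) v x ∧ E x u

/-- The bag of `v`. -/
def Bag (n : ℕ) (E : ℕ → ℕ → Prop) (τ : ℕ → ℕ) (v u : ℕ) : Prop := u = v ∨ Back n E τ v u

variable {n w : ℕ} {E : ℕ → ℕ → Prop} {τ : ℕ → ℕ}

theorem InComp.unplaced {v x : ℕ} (hv : τ v = 0) (h : InComp n E τ v x) : τ x = 0 := by
  rcases Relation.ReflTransGen.cases_tail h with rfl | ⟨y, -, h⟩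
  exacts [hv, h.2.2.2.2]

theorem InComp.lt {v x : ℕ} (hv : v < n) (h : InComp n E τ v x) : x < n := by
  rcases Relation.ReflTransGen.cases_tail h with rfl | ⟨y, -, h⟩
  exacts [hv, h.2.1]

theorem InComp.symm (hE : ∀ x y, E x y → E y x) {v x : ℕ} (h : InComp n E τ v x) :
    InComp n E τ x v :=
  Reach.symm (fun _ _ h => ⟨hE _ _ h.1, h.2.2, h.2.1⟩) h

theorem Next.inComp {u : ℕ} (h : Next n w E τ u) : InComp n E τ (first n τ) u := by
  rcases h with rfl | h
  exacts [.refl, h.2.2]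

theorem splits_of_lt (h : splitCode n w E (Front n E τ (first n τ)) < 2 ^ (18 * w)) :
    Splits n w E (Front n E τ (first n τ)) (splitCode n w E (Front n E τ (first n τ))) := by
  by_contra hcon
  have h1 : ∃ c < 2 ^ (18 * w), Splits n w E (Front n E τ (first n τ)) c := by
    by_contra h2
    rw [splitCode, leastLT_eq_of_not h2] at h
    omega
  exact hcon (leastLT_spec h1).2

theorem cnt_next_le : cnt n (Next n w E τ) ≤ 2 * w + 1 := by
  refine (cnt_or_le _ _ _).trans ?_
  have h1 := cnt_eq_le_one n (first n τ)
  by_cases h : splitCode n w E (Front n E τ (first n τ)) < 2 ^ (18 * w)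
  · have h2 := (splits_of_lt h).2.2
    have h3 : cnt n (fun u =>
      splitCode n w E (Front n E τ (first n τ)) < 2 ^ (18 * w) ∧
      codedSep n w E (Front n E τ (first n τ)) (splitCode n w E (Front n E τ (first n τ))) u ∧
      InComp n E τ (first n τ) u) ≤ 2 * w := (cnt_mono fun x _ hx => hx.2.1).trans h2
    omega
  · have h3 : cnt n (fun u =>
      splitCode n w E (Front n E τ (first n τ)) < 2 ^ (18 * w) ∧
      codedSep n w E (Front n E τ (first n τ)) (splitCode n w E (Front n E τ (first n τ))) u ∧
      InComp n E τ (first n τ) u) = 0 := cnt_eq_zero.2 fun x _ hx => h hx.1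
    omega

/-- All sets of vertices have balanced separators of size at most `w + 1`. -/
def Separable (n w : ℕ) (E : ℕ → ℕ → Prop) : Prop :=
  ∀ W : ℕ → Prop, ∃ A B S : ℕ → Prop, (∀ u, A u → W u) ∧ (∀ u, B u → W u) ∧
    MinCut.Separates n E A B S ∧ cnt n S ≤ w + 1 ∧
    cnt n W ≤ 3 * cnt n A ∧ cnt n W ≤ 3 * cnt n B

/-- A front with `9 * w` elements has a separator of size at most `w + 1 ≤ 2 * w` between two
subsets with at least `3 * w` elements. The ranks of the elements of the two subsets form the blocks
of `9 * w` binary digits of the code. -/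
theorem exists_splits (hw : 1 ≤ w) (hE : ∀ v, ¬ E v v) (hsep : Separable n w E) {W : ℕ → Prop}
    (hWn : ∀ u, W u → u < n) (hW : cnt n W = 9 * w) : ∃ c < 2 ^ (18 * w), Splits n w E W c := by
  obtain ⟨A, B, S, hA, hB, hS, hSw, hAW, hBW⟩ := hsep W
  obtain ⟨c, hc, hbit⟩ := exists_testBit (18 * w) fun i =>
    (∃ u, W u ∧ i = 0 + cnt u W ∧ A u) ∨ ∃ u, W u ∧ i = 9 * w + cnt u W ∧ B u
  have hrank : ∀ u, W u → cnt u W < 9 * w := fun u hu => hW ▸ cnt_lt_cnt (hWn u hu) hu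
  have h1 : Coded W 0 c = A := by
    funext u
    refine propext ⟨fun h => ?_, fun h => ⟨hA u h, ?_⟩⟩
    · obtain ⟨hu, h⟩ := h
      have hr := hrank u hu
      rcases (hbit _ (by omega)).1 h with ⟨v, hv, huv, hAv⟩ | ⟨v, hv, huv, -⟩
      · rwa [eq_of_cnt_eq hu hv (by omega)]
      · omega
    · have hr := hrank u (hA u h)
      exact (hbit _ (by omega)).2 (.inl ⟨u, hA u h, rfl, h⟩)
  have h2 : Coded W (9 * w) c = B := by
    funext u
    refine propext ⟨fun h => ?_, fun h => ⟨hB u h, ?_⟩⟩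
    · obtain ⟨hu, h⟩ := h
      have hr := hrank u hu
      rcases (hbit _ (by omega)).1 h with ⟨v, hv, huv, -⟩ | ⟨v, hv, huv, hBv⟩
      · have := hrank v hv
        omega
      · rwa [eq_of_cnt_eq hu hv (by omega)]
    · have hr := hrank u (hB u h)
      exact (hbit _ (by omega)).2 (.inr ⟨u, hB u h, rfl, h⟩)
  refine ⟨c, hc, ?_⟩
  have h3 := MinCut.cnt_minSep_le hE hS
  rw [Splits, codedSep, h1, h2]
  omega

open Classical in
theorem place_eq_zero_iff {t u : ℕ} : place n w E t τ u = 0 ↔ τ u = 0 ∧ ¬ Next n w E τ u := by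
  rw [place]
  split_ifs with h
  · simp [h]
  · tauto

/-- Placing the next vertices keeps the fronts small: a separator of two large subsets of a front
disconnects each new component from the remainder of one of them. -/
theorem cnt_front_place_le (hw : 1 ≤ w) (hE : ∀ v, ¬ E v v) (hsymm : ∀ x y, E x y → E y x)
    (hsep : Separable n w E) (hτ : ∀ v < n, τ v = 0 → cnt n (Front n E τ v) ≤ 9 * w) {t v : ℕ}
    (hvn : v < n) (hv : place n w E t τ v = 0) :
    cnt n (Front n E (place n w E t τ) v) ≤ 9 * w := by
  obtain ⟨hv0, hvN⟩ := place_eq_zero_iff.1 hv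
  set f := first n τ with hf
  have hex : ∃ v < n, τ v = 0 := ⟨v, hvn, hv0⟩
  have hfn : f < n := (leastLT_spec hex).1
  have hf0 : τ f = 0 := (leastLT_spec hex).2
  have hcomp : ∀ x, InComp n E (place n w E t τ) v x → InComp n E τ v x := fun x =>
    Reach.mono fun a b h => ⟨h.1, (place_eq_zero_iff.1 h.2.1).1, (place_eq_zero_iff.1 h.2.2).1⟩
  have hfront : ∀ u, Front n E (place n w E t τ) v u → Front n E τ v u ∨
      Next n w E τ u ∧ InComp n E τ v u := by
    rintro u ⟨hu, hu', x, hx, hvx, hxu⟩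
    by_cases hu0 : τ u = 0
    · right
      refine ⟨?_, (hcomp x hvx).tail ⟨hx, hu, hxu, (hcomp x hvx).unplaced hv0, hu0⟩⟩
      by_contra h
      exact hu' (place_eq_zero_iff.2 ⟨hu0, h⟩)
    · exact .inl ⟨hu, hu0, x, hx, hcomp x hvx, hxu⟩
  by_cases hfv : InComp n E τ f v
  swap
  · refine (cnt_mono fun u _ hu => ?_).trans (hτ v hvn hv0)
    rcases hfront u hu with h | ⟨h, h'⟩
    · exact h
    · exact absurd (h.inComp.trans (h'.symm hsymm)) hfv
  set W := Front n E τ f with hW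
  have hfront' : ∀ u, Front n E (place n w E t τ) v u → W u ∨ Next n w E τ u := by
    intro u hu
    rcases hfront u hu with ⟨h1, h2, x, hx, h3, h4⟩ | h
    · exact .inl ⟨h1, h2, x, hx, hfv.trans h3, h4⟩
    · exact .inr h.1
  have hW9 : cnt n W ≤ 9 * w := hτ f hfn hf0
  by_cases hcode : splitCode n w E W < 2 ^ (18 * w)
  · obtain ⟨h1, h2, -⟩ := splits_of_lt hcode
    set c := splitCode n w E W with hc
    set S := codedSep n w E W c with hS
    have hcompS : ∀ x, InComp n E (place n w E t τ) v x → ¬ S x := fun x hx hSx => by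
      have h3 := (place_eq_zero_iff.1 (hx.unplaced hv)).2
      exact h3 (.inr ⟨hcode, hSx, hfv.trans (hcomp x hx)⟩)
    -- The new component cannot have a neighbour in each of the two sets outside `S`.
    have hnot : (∀ u, Front n E (place n w E t τ) v u → Coded W 0 c u → S u) ∨
        ∀ u, Front n E (place n w E t τ) v u → Coded W (9 * w) c u → S u := by
      by_contra hcon
      push Not at hcon
      obtain ⟨⟨a, ⟨ha, -, x, hx, hvx, hxa⟩, hca, hSa⟩,
        b, ⟨hb, -, y, hy, hvy, hyb⟩, hcb, hSb⟩ := hcon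
      have hvv : ∀ z, InComp n E (place n w E t τ) v z →
          Reach n (fun x y => E x y ∧ ¬ S x ∧ ¬ S y) v z := by
        intro z hz
        induction hz with
        | refl => exact .refl
        | @tail y z hy hyz ih =>
          exact ih.tail ⟨hyz.1, hyz.2.1, hyz.2.2.1, hcompS _ hy, hcompS _ (hy.tail hyz)⟩
      have hsymm' : ∀ x y, (E x y ∧ ¬ S x ∧ ¬ S y) → (E y x ∧ ¬ S y ∧ ¬ S x) :=
        fun x y h => ⟨hsymm _ _ h.1, h.2.2, h.2.1⟩
      refine MinCut.minSep_separates (n := n) (E := E) (A := Coded W 0 c) (B := Coded W (9 * w) c)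
        a b ha hca hSa ?_ hcb
      exact (Relation.ReflTransGen.head ⟨ha, hx, hsymm _ _ hxa, hSa, hcompS x hvx⟩
        (Reach.symm hsymm' (hvv x hvx))).trans ((hvv y hvy).tail ⟨hy, hb, hyb, hcompS y hvy, hSb⟩)
    have hcount : ∀ A : ℕ → Prop, (∀ u, A u → W u) → cnt n S < cnt n A →
        (∀ u, Front n E (place n w E t τ) v u → A u → S u) →
        cnt n (Front n E (place n w E t τ) v) ≤ 9 * w := by
      intro A hAW hSA hA
      have h3 := cnt_and_not (n := n) fun u (_ : u < n) => hAW u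
      have h4 : cnt n (Front n E (place n w E t τ) v) ≤
          cnt n fun u => (W u ∧ ¬ A u) ∨ (S u ∨ u = f) := cnt_mono fun u _ hu => by
        by_cases hAu : A u
        · exact .inr (.inl (hA u hu hAu))
        · rcases hfront' u hu with h | h | h
          · exact .inl ⟨h, hAu⟩
          · exact .inr (.inr h)
          · exact .inr (.inl h.2.1)
      have h5 := cnt_or_le n (fun u => W u ∧ ¬ A u) fun u => S u ∨ u = f
      have h6 := cnt_or_le n S fun u => u = f
      have h7 := cnt_eq_le_one n f
      omega
    rcases hnot with h | h
    · exact hcount _ (fun u hu => hu.1) h1 h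
    · exact hcount _ (fun u hu => hu.1) h2 h
  · have hne : cnt n W ≠ 9 * w := fun h => hcode
      (leastLT_spec (exists_splits hw hE hsep (fun u hu => hu.1) h)).1
    have h4 : cnt n (Front n E (place n w E t τ) v) ≤ cnt n fun u => W u ∨ u = f :=
      cnt_mono fun u _ hu => by
        rcases hfront' u hu with h | h | h
        · exact .inl h
        · exact .inr h
        · exact absurd h.1 hcode
    have h5 := cnt_or_le n W fun u => u = f
    have h6 := cnt_eq_le_one n f
    omega

theorem times_succ_of_lt {t u : ℕ} (hu : u < n) :
    times n w E (t + 1) u = place n w E t (times n w E t) u := by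
  simp only [times, arrIter, clip, hu, if_true]

theorem times_eq_zero_of_le {t u : ℕ} (hu : n ≤ u) : times n w E t u = 0 := by
  cases t <;> simp [times, arrIter, clip, not_lt.2 hu]

theorem times_le (t u : ℕ) : times n w E t u ≤ t := by
  classical
  induction t with
  | zero => simp [times, arrIter, clip]
  | succ t ih =>
    by_cases hu : u < n
    · rw [times_succ_of_lt hu, place]
      split_ifs <;> omega
    · rw [times_eq_zero_of_le (by omega)]
      omega

/-- Between the rounds `s` and `t`, only vertices that have not been placed change their times. -/
theorem times_of_le {s t u : ℕ} (hst : s ≤ t) :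
    (times n w E s u ≠ 0 → times n w E t u = times n w E s u) ∧
      (times n w E s u = 0 → times n w E t u ≠ 0 → s + 1 ≤ times n w E t u) := by
  classical
  by_cases hu : u < n
  swap
  · rw [times_eq_zero_of_le (by omega), times_eq_zero_of_le (by omega)]
    simp
  induction hst with
  | refl => exact ⟨fun _ => rfl, fun h h' => absurd h h'⟩
  | @step m hm ih =>
    rw [times_succ_of_lt hu, place]
    split_ifs with h
    · refine ⟨fun h' => absurd h.1 (by rw [ih.1 h']; exact h'), fun _ _ => ?_⟩
      have : s ≤ m := hm
      omega
    · exact ih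

theorem next_of_times_eq {s t u : ℕ} (hst : s < t) (h : times n w E t u = s + 1) :
    Next n w E (times n w E s) u ∧ times n w E s u = 0 := by
  classical
  have hu : u < n := by
    by_contra hu
    rw [times_eq_zero_of_le (by omega)] at h
    omega
  have h0 : times n w E s u = 0 := by
    by_contra h0
    have h1 := (times_of_le hst.le).1 h0
    have h2 := times_le (n := n) (w := w) (E := E) s u
    omega
  refine ⟨?_, h0⟩
  by_contra hN
  have h1 : times n w E (s + 1) u = 0 := by
    rw [times_succ_of_lt hu]
    exact place_eq_zero_iff.2 ⟨h0, hN⟩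
  have := (times_of_le (n := n) (w := w) (E := E) hst).2 h1 (by omega)
  omega

/-- In each round a vertex is placed. -/
theorem cnt_times_eq_zero_le (t : ℕ) : cnt n (fun u => times n w E t u = 0) ≤ n - t := by
  induction t with
  | zero => exact cnt_le _ _
  | succ t ih =>
    by_cases hex : ∃ v < n, times n w E t v = 0
    · have h1 : cnt n (fun u => times n w E (t + 1) u = 0) ≤
          cnt n (fun u => times n w E t u = 0 ∧ ¬ (u = first n (times n w E t))) :=
        cnt_mono fun u hu h => by
          rw [times_succ_of_lt hu] at h
          have := place_eq_zero_iff.1 h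
          exact ⟨this.1, fun h => this.2 (.inl h)⟩
      obtain ⟨h2, h3⟩ := leastLT_spec hex
      have h4 := cnt_and_not (n := n) (p := fun u => times n w E t u = 0)
        (q := fun u => u = first n (times n w E t)) fun x _ hx => by
          rw [hx]; exact h3
      have h5 : 0 < cnt n (fun u => u = first n (times n w E t)) := cnt_pos.2 ⟨_, h2, rfl⟩
      omega
    · have : cnt n (fun u => times n w E (t + 1) u = 0) = 0 := by
        refine cnt_eq_zero.2 fun u hu h => ?_
        rw [times_succ_of_lt hu] at h
        exact hex ⟨u, hu, (place_eq_zero_iff.1 h).1⟩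
      omega

theorem times_ne_zero {u : ℕ} (hu : u < n) : times n w E n u ≠ 0 := by
  intro h
  have h1 := cnt_times_eq_zero_le (n := n) (w := w) (E := E) n
  have h2 : 0 < cnt n (fun u => times n w E n u = 0) := cnt_pos.2 ⟨u, hu, h⟩
  omega

theorem cnt_front_times_le (hw : 1 ≤ w) (hE : ∀ v, ¬ E v v) (hsymm : ∀ x y, E x y → E y x)
    (hsep : Separable n w E) (t : ℕ) :
    ∀ v < n, times n w E t v = 0 → cnt n (Front n E (times n w E t) v) ≤ 9 * w := by
  induction t with
  | zero =>
    intro v _ _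
    have : cnt n (Front n E (times n w E 0) v) = 0 :=
      cnt_eq_zero.2 fun u _ h => h.2.1 (Nat.le_zero.1 (times_le 0 u))
    omega
  | succ t ih =>
    intro v hv h
    rw [times_succ_of_lt hv] at h
    have h1 : times n w E (t + 1) = place n w E t (times n w E t) := by
      funext u
      by_cases hu : u < n
      · exact times_succ_of_lt hu
      · have hfn : first n (times n w E t) < n :=
          (leastLT_spec ⟨v, hv, (place_eq_zero_iff.1 h).1⟩).1
        rw [times_eq_zero_of_le (by omega), eq_comm, place_eq_zero_iff]
        exact ⟨times_eq_zero_of_le (by omega), fun h => hu (h.inComp.lt hfn)⟩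
    rw [h1]
    exact cnt_front_place_le hw hE hsymm hsep ih hv h

/-- The bags of the elimination order have at most `12 * w` elements: the bag of a vertex that is
placed in some round is contained in the union of the front and the placed vertices of that
round. -/
theorem cnt_bag_le (hw : 1 ≤ w) (hE : ∀ v, ¬ E v v) (hsymm : ∀ x y, E x y → E y x)
    (hsep : Separable n w E) {v : ℕ} (hv : v < n) :
    cnt n (Bag n E (times n w E n) v) ≤ 12 * w := by
  set τ := times n w E n with hτ
  have hv0 : τ v ≠ 0 := times_ne_zero hv
  obtain ⟨s, hs⟩ := Nat.exists_eq_succ_of_ne_zero hv0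
  have hsn : s < n := by
    have : τ v ≤ n := times_le n v
    omega
  set σ := times n w E s with hσ
  have hplaced : ∀ u < n, τ u ≤ s → σ u ≠ 0 := fun u hu h h0 => by
    have := (times_of_le (n := n) (w := w) (E := E) hsn.le).2 h0 (times_ne_zero hu)
    change s + 1 ≤ τ u at this
    omega
  have hunplaced : ∀ u, s < τ u → σ u = 0 := fun u h => by
    by_contra h0
    have h1 := (times_of_le (n := n) (w := w) (E := E) hsn.le).1 h0
    have h2 := times_le (n := n) (w := w) (E := E) s u
    change τ u = _ at h1
    omega
  obtain ⟨hvN, hvσ⟩ := next_of_times_eq hsn hs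
  have hex : ∃ v < n, σ v = 0 := ⟨v, hv, hvσ⟩
  have hle : cnt n (Bag n E τ v) ≤
      cnt n fun u => Front n E σ (first n σ) u ∨ Next n w E σ u := by
    refine cnt_mono fun u hu h => ?_
    rcases h with rfl | ⟨-, hb, x, hx, hvx, hxu⟩
    · exact .inr hvN
    · by_cases hu' : τ u = s + 1
      · exact .inr (next_of_times_eq hsn hu').1
      · left
        have hus : τ u ≤ s := by
          rcases hb with h | h <;> omega
        refine ⟨hu, hplaced u hu hus, x, hx, hvN.inComp.trans ?_, hxu⟩
        refine Reach.mono (fun a b h => ⟨h.1, hunplaced a ?_, hunplaced b ?_⟩) hvx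
        · have := h.2.1
          simp only [Before] at this
          omega
        · have := h.2.2
          simp only [Before] at this
          omega
  have h1 := cnt_or_le n (Front n E σ (first n σ)) (Next n w E σ)
  have h2 := cnt_front_times_le hw hE hsymm hsep s _ (leastLT_spec hex).1 (leastLT_spec hex).2
  have h3 := cnt_next_le (n := n) (w := w) (E := E) (τ := σ)
  change cnt n (Front n E σ (first n σ)) ≤ 9 * w at h2
  omega

end Elimination

namespace RAM

variable {Γ : Ctx}

theorem CRel.inComp {n : State → ℕ} {E : State → ℕ → ℕ → Prop} {τ : State → ℕ → ℕ}
    (hn : CIdx Γ n) (hE : CRel Γ E) (hτ : CFun Γ τ) :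
    CRel Γ fun s => Elimination.InComp (n s) (E s) (τ s) := fun _ h₁ _ _ hx hy =>
  CProp.reach (hn.mono h₁) (fun _ h₂ _ _ ha hb =>
    have h := Ctx.le_trans h₁ h₂
    ((hE.mono h).app ha hb).and ((CProp.eq ((hτ.mono h).app ha) (.const 0)).and
      (CProp.eq ((hτ.mono h).app hb) (.const 0)))) hx.1 hy.1

theorem CPred.front {n v : State → ℕ} {E : State → ℕ → ℕ → Prop} {τ : State → ℕ → ℕ}
    (hn : CIdx Γ n) (hE : CRel Γ E) (hτ : CFun Γ τ) (hv : CIdx Γ v) :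
    CPred Γ fun s => Elimination.Front (n s) (E s) (τ s) (v s) := fun _ h₁ _ hu =>
  (CProp.lt hu.1 (hn.mono h₁).1).and ((CProp.eq ((hτ.mono h₁).app hu) (.const 0)).not.and
    (CProp.exists_lt (hn.mono h₁) fun _ h₂ _ hx =>
      have h := Ctx.le_trans h₁ h₂
      ((CRel.inComp (hn.mono h) (hE.mono h) (hτ.mono h)).app (hv.mono h) hx).and
        ((hE.mono h).app hx (hu.mono h₂))))

theorem CIdx.first {n : State → ℕ} {τ : State → ℕ → ℕ} (hn : CIdx Γ n) (hτ : CFun Γ τ) :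
    CIdx Γ fun s => Elimination.first (n s) (τ s) :=
  CIdx.leastLT hn fun _ h₁ _ hx => CProp.eq ((hτ.mono h₁).app hx) (.const 0)

theorem CPred.coded {W : State → ℕ → Prop} {o c : State → ℕ} (hW : CPred Γ W) (ho : CIdx Γ o)
    (hc : CIdx Γ c) : CPred Γ fun s => Elimination.Coded (W s) (o s) (c s) := fun _ h₁ _ hu =>
  ((hW.mono h₁).app hu).and (CProp.testBit (hc.mono h₁) ((ho.mono h₁).add
    (CIdx.cnt hu (hW.mono h₁))))

theorem CPred.codedSep {n w c : State → ℕ} {E : State → ℕ → ℕ → Prop} {W : State → ℕ → Prop}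
    (hn : CIdx Γ n) (hw : CIdx Γ w) (hE : CRel Γ E) (hW : CPred Γ W) (hc : CIdx Γ c) :
    CPred Γ fun s => Elimination.codedSep (n s) (w s) (E s) (W s) (c s) :=
  CPred.minSep hn hE (CPred.coded hW (.const 0) hc)
    (CPred.coded hW ((CIdx.const 9).mul hw) hc)

theorem CIdx.splitCode {n w : State → ℕ} {E : State → ℕ → ℕ → Prop} {W : State → ℕ → Prop}
    (hn : CIdx Γ n) (hw : CIdx Γ w) (hw' : PolyBdd fun s => 2 ^ w s) (hE : CRel Γ E)
    (hW : CPred Γ W) : CIdx Γ fun s => Elimination.splitCode (n s) (w s) (E s) (W s) := by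
  refine CIdx.leastLT ⟨CNat.pow (.const 2) ((CIdx.const 18).mul hw), ?_⟩ fun Γ₁ h₁ c hc => ?_
  · obtain ⟨e, he⟩ := hw'
    refine ⟨e * 18, fun s => ?_⟩
    change 2 ^ (18 * w s) ≤ _
    rw [mul_comm 18, pow_mul, pow_mul]
    exact Nat.pow_le_pow_left (he s) 18
  · have hn := hn.mono h₁
    have hw := hw.mono h₁
    have hW := hW.mono h₁
    have hS := (CIdx.cnt hn (CPred.codedSep hn hw (hE.mono h₁) hW hc)).1
    exact (CProp.lt hS (CIdx.cnt hn (CPred.coded hW (.const 0) hc)).1).and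
      ((CProp.lt hS (CIdx.cnt hn (CPred.coded hW ((CIdx.const 9).mul hw) hc)).1).and
        (CProp.le hS ((CIdx.const 2).mul hw).1))

theorem CPred.next {n w : State → ℕ} {E : State → ℕ → ℕ → Prop} {τ : State → ℕ → ℕ}
    (hn : CIdx Γ n) (hw : CIdx Γ w) (hw' : PolyBdd fun s => 2 ^ w s) (hE : CRel Γ E)
    (hτ : CFun Γ τ) : CPred Γ fun s => Elimination.Next (n s) (w s) (E s) (τ s) := by
  intro Γ₁ h₁ u hu
  replace hn := hn.mono h₁
  replace hw := hw.mono h₁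
  replace hE := hE.mono h₁
  replace hτ := hτ.mono h₁
  have hf := CIdx.first hn hτ
  have hW := CPred.front hn hE hτ hf
  have hc := CIdx.splitCode hn hw hw' hE hW
  exact (CProp.eq hu.1 hf.1).or
    ((CProp.lt hc.1 (CNat.pow (.const 2) ((CIdx.const 18).mul hw))).and
      (((CPred.codedSep hn hw hE hW hc).app hu).and ((CRel.inComp hn hE hτ).app hf hu)))

open Classical in
theorem CFun.times {n w T : State → ℕ} {E : State → ℕ → ℕ → Prop}
    (hn : CIdx Γ n) (hw : CIdx Γ w) (hw' : PolyBdd fun s => 2 ^ w s) (hE : CRel Γ E)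
    (hT : CIdx Γ T) : CFun Γ fun s => Elimination.times (n s) (w s) (E s) (T s) := by
  intro Γ₁ h₁ u hu
  refine CNat.arrIter (hn.mono h₁) (hT.mono h₁) (fun _ _ _ _ => .const 0)
    (fun Γ₂ h₂ t τ i ht hτ hi => ?_) hu.1
  have h := Ctx.le_trans h₁ h₂
  exact CNat.ite ((CProp.eq (hτ.app hi) (.const 0)).and
    ((CPred.next (hn.mono h) (hw.mono h) hw' (hE.mono h) hτ).app hi))
    (ht.1.add (.const 1)) (hτ.app hi)

theorem CRel.before {τ : State → ℕ → ℕ} (hτ : CFun Γ τ) :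
    CRel Γ fun s => Elimination.Before (τ s) := fun _ h₁ _ _ hu hv =>
  (CProp.lt ((hτ.mono h₁).app hu) ((hτ.mono h₁).app hv)).or
    ((CProp.eq ((hτ.mono h₁).app hu) ((hτ.mono h₁).app hv)).and (CProp.lt hu.1 hv.1))

theorem CRel.back {n : State → ℕ} {E : State → ℕ → ℕ → Prop} {τ : State → ℕ → ℕ}
    (hn : CIdx Γ n) (hE : CRel Γ E) (hτ : CFun Γ τ) :
    CRel Γ fun s => Elimination.Back (n s) (E s) (τ s) := fun _ h₁ _ _ hv hu =>
  (CProp.lt hu.1 (hn.mono h₁).1).and (((CRel.before (hτ.mono h₁)).app hu hv).and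
    (CProp.exists_lt (hn.mono h₁) fun _ h₂ _ hx =>
      have h := Ctx.le_trans h₁ h₂
      (CProp.reach (hn.mono h) (fun _ h₃ _ _ ha hb =>
        have h' := Ctx.le_trans h h₃
        have hv' := (hv.mono h₂).mono h₃
        ((hE.mono h').app ha hb).and (((CRel.before (hτ.mono h')).app ha hv').not.and
          ((CRel.before (hτ.mono h')).app hb hv').not)) (hv.mono h₂).1 hx.1).and
        ((hE.mono h).app hx (hu.mono h₂))))

theorem CRel.bag {n : State → ℕ} {E : State → ℕ → ℕ → Prop} {τ : State → ℕ → ℕ}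
    (hn : CIdx Γ n) (hE : CRel Γ E) (hτ : CFun Γ τ) :
    CRel Γ fun s => Elimination.Bag (n s) (E s) (τ s) := fun _ h₁ _ _ hv hu =>
  (CProp.eq hu.1 hv.1).or (((CRel.back hn hE hτ).mono h₁).app hv hu)

end RAM

/-! ### Dynamic programming along an elimination order -/

namespace Elimination

variable {n : ℕ} {E : ℕ → ℕ → Prop} {τ : ℕ → ℕ}

theorem Before.trans {u v x : ℕ} (h : Before τ u v) (h' : Before τ v x) : Before τ u x := by
  simp only [Before] at *
  omega

theorem Before.irrefl (u : ℕ) : ¬ Before τ u u := by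
  simp only [Before]
  omega

theorem Before.total {u v : ℕ} (h : u ≠ v) : Before τ u v ∨ Before τ v u := by
  simp only [Before]
  omega

theorem Back.of_adj {u v : ℕ} (hu : u < n) (hv : v < n) (hE : E v u) (h : Before τ u v) :
    Back n E τ v u := ⟨hu, h, v, hv, .refl, hE⟩

/-- The number of vertices before `v`. -/
noncomputable def rank (n : ℕ) (τ : ℕ → ℕ) (v : ℕ) : ℕ := RAM.cnt n fun u => Before τ u v

theorem rank_lt_rank {u v : ℕ} (hu : u < n) (h : Before τ u v) : rank n τ u < rank n τ v := by
  have h1 := RAM.cnt_and_not (n := n) (p := fun x => Before τ x v) (q := fun x => Before τ x u)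
    fun x _ hx => hx.trans h
  have h2 : 0 < RAM.cnt n fun x => Before τ x v ∧ ¬ Before τ x u :=
    RAM.cnt_pos.2 ⟨u, hu, h, Before.irrefl u⟩
  rw [rank, rank]
  omega

theorem rank_lt {v : ℕ} (hv : v < n) : rank n τ v < n := by
  have h1 := RAM.cnt_and_not (n := n) (p := fun _ => True) (q := fun x => Before τ x v)
    fun _ _ _ => trivial
  have h2 : 0 < RAM.cnt n fun x => True ∧ ¬ Before τ x v :=
    RAM.cnt_pos.2 ⟨v, hv, trivial, Before.irrefl v⟩
  have h3 := RAM.cnt_le n fun _ => True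
  rw [rank]
  omega

/-- The vertices in the back of `v` all lie in the bag of the last of them. -/
theorem exists_parent (hsymm : ∀ x y, E x y → E y x) {v u₀ : ℕ} (hu₀ : Back n E τ v u₀) :
    ∃ p < n, Before τ p v ∧ ∀ u, Back n E τ v u → Bag n E τ p u := by
  classical
  obtain ⟨p, hp, hmax⟩ := Finset.exists_max_image ((Finset.range n).filter (Back n E τ v))
    (rank n τ) ⟨u₀, Finset.mem_filter.2 ⟨Finset.mem_range.2 hu₀.1, hu₀⟩⟩
  obtain ⟨hpn, hpb, y, hy, hvy, hyp⟩ := (Finset.mem_filter.1 hp).2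
  refine ⟨p, hpn, hpb, fun u hu => ?_⟩
  by_cases hup : u = p
  · exact .inl hup
  have hbu : Before τ u p := by
    rcases Before.total (τ := τ) hup with h | h
    · exact h
    · have h1 := rank_lt_rank hpn h
      have h2 := hmax u (Finset.mem_filter.2 ⟨Finset.mem_range.2 hu.1, hu⟩)
      omega
  obtain ⟨hun, -, x, hx, hvx, hxu⟩ := hu
  refine .inr ⟨hun, hbu, x, hx, ?_, hxu⟩
  have hmono : ∀ {z}, Reach n (fun a b => E a b ∧ ¬ Before τ a v ∧ ¬ Before τ b v) v z →
      Reach n (fun a b => E a b ∧ ¬ Before τ a p ∧ ¬ Before τ b p) v z := fun h =>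
    Reach.mono (fun a b h => ⟨h.1, fun h' => h.2.1 (h'.trans hpb),
      fun h' => h.2.2 (h'.trans hpb)⟩) h
  have hsymm' : ∀ a b, (E a b ∧ ¬ Before τ a p ∧ ¬ Before τ b p) →
      (E b a ∧ ¬ Before τ b p ∧ ¬ Before τ a p) := fun a b h => ⟨hsymm _ _ h.1, h.2.2, h.2.1⟩
  have hyv : ¬ Before τ y p := by
    rcases Relation.ReflTransGen.cases_tail hvy with rfl | ⟨z, -, h⟩
    · exact fun h => Before.irrefl _ (h.trans hpb)
    · exact fun h' => h.2.2.2.2 (h'.trans hpb)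
  exact (Relation.ReflTransGen.head ⟨hpn, hy, hsymm _ _ hyp, Before.irrefl p, hyv⟩
    (Reach.symm hsymm' (hmono hvy))).trans (hmono hvx)

end Elimination

namespace Inversion

open RAM Elimination

/-- An arc whose ends have the colours `a` and `b` is reversed by an odd number of the `k`
inversions. The binary digits of a colour tell which of the sets contain the vertex. -/
def Flip (k a b : ℕ) : Prop := cnt k (fun i => a.testBit i = true ∧ b.testBit i = true) % 2 = 1

/-- The colours `c` and the positions `p` describe a solution: after the inversions all arcs go
forward. -/
def IsSolution {α : Type*} [LT α] (n k : ℕ) (D : ℕ → ℕ → Prop) (c : ℕ → ℕ) (p : ℕ → α) : Prop :=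
  (∀ u < n, c u < 2 ^ k) ∧ ∀ u < n, ∀ v < n, D u v →
    (Flip k (c u) (c v) → p v < p u) ∧ (¬ Flip k (c u) (c v) → p u < p v)

/-- The number of different labels of a vertex in a partial solution. A label consists of a colour
and a position within the bag. -/
def base (k w : ℕ) : ℕ := 2 ^ (k + 12 * w)

/-- The number of codes of partial solutions for a bag. -/
def codes (k w : ℕ) : ℕ := base k w ^ (12 * w)

/-- The label of the vertex `u` in the partial solution with code `x` for the bag of `v`: the digit
of `x` at the rank of `u` in the bag. -/
noncomputable def label (n k w : ℕ) (E : ℕ → ℕ → Prop) (τ : ℕ → ℕ) (v x u : ℕ) : ℕ :=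
  x / base k w ^ cnt u (Bag n E τ v) % base k w

/-- The colour of `u` in the partial solution `x` for the bag of `v`. -/
noncomputable def col (n k w : ℕ) (E : ℕ → ℕ → Prop) (τ : ℕ → ℕ) (v x u : ℕ) : ℕ :=
  label n k w E τ v x u % 2 ^ k

/-- The position of `u` in the partial solution `x` for the bag of `v`. -/
noncomputable def pos (n k w : ℕ) (E : ℕ → ℕ → Prop) (τ : ℕ → ℕ) (v x u : ℕ) : ℕ :=
  label n k w E τ v x u / 2 ^ k

/-- The arcs within the bag of `v` go forward in the partial solution `x`. -/
def Valid (n k w : ℕ) (D E : ℕ → ℕ → Prop) (τ : ℕ → ℕ) (v x : ℕ) : Prop :=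
  ∀ u < n, ∀ u' < n, Bag n E τ v u → Bag n E τ v u' → D u u' →
    (Flip k (col n k w E τ v x u) (col n k w E τ v x u') →
      pos n k w E τ v x u' < pos n k w E τ v x u) ∧
    (¬ Flip k (col n k w E τ v x u) (col n k w E τ v x u') →
      pos n k w E τ v x u < pos n k w E τ v x u')

/-- The partial solutions `x` for the bag of `v` and `y` for the bag of `v'` have the same colours
and the same order on the back of `v'`. -/
def Agrees (n k w : ℕ) (E : ℕ → ℕ → Prop) (τ : ℕ → ℕ) (v x v' y : ℕ) : Prop :=
  ∀ u < n, Back n E τ v' u → col n k w E τ v' y u = col n k w E τ v x u ∧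
    ∀ u' < n, Back n E τ v' u' → (pos n k w E τ v' y u < pos n k w E τ v' y u' ↔
      pos n k w E τ v x u < pos n k w E τ v x u')

/-- One round of the dynamic program: a valid partial solution for the bag of `v` is kept if it
extends to the bags of all later vertices whose back lies in this bag. -/
def extend (n k w : ℕ) (D E : ℕ → ℕ → Prop) (τ : ℕ → ℕ) (F : ℕ → ℕ → Prop) (v x : ℕ) : Prop :=
  Valid n k w D E τ v x ∧ ∀ v' < n, Before τ v v' → (∀ u < n, Back n E τ v' u → Bag n E τ v u) →
    ∃ y < codes k w, F v' y ∧ Agrees n k w E τ v x v' y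

/-- The partial solutions that survive `i` rounds. -/
def table (n k w : ℕ) (D E : ℕ → ℕ → Prop) (τ : ℕ → ℕ) : ℕ → ℕ → ℕ → Prop :=
  relIter n (codes k w) (fun _ _ => True) (extend n k w D E τ)

/-- The outcome of the dynamic program. -/
def Accepts (n k w : ℕ) (D E : ℕ → ℕ → Prop) (τ : ℕ → ℕ) : Prop :=
  ∀ v < n, ∃ x < codes k w, table n k w D E τ n v x

variable {n k w : ℕ} {D E : ℕ → ℕ → Prop} {τ : ℕ → ℕ}

theorem exists_digits (Q m : ℕ) (d : ℕ → ℕ) (hd : ∀ i < m, d i < Q) :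
    ∃ x < Q ^ m, ∀ i < m, x / Q ^ i % Q = d i := by
  induction m with
  | zero => exact ⟨0, by simp, by simp⟩
  | succ m ih =>
    obtain ⟨x, hx, h⟩ := ih fun i hi => hd i (by omega)
    have hdm := hd m (by omega)
    have hQ : 0 < Q := by omega
    refine ⟨x + Q ^ m * d m, ?_, fun i hi => ?_⟩
    · calc x + Q ^ m * d m < Q ^ m * (d m + 1) := by rw [mul_add, mul_one]; omega
        _ ≤ Q ^ (m + 1) := by rw [pow_succ]; exact Nat.mul_le_mul_left _ hdm
    · rcases Nat.lt_succ_iff_lt_or_eq.1 hi with hi | rfl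
      · rw [← h i hi]
        obtain ⟨e, rfl⟩ := Nat.exists_eq_add_of_lt hi
        rw [show Q ^ (i + e + 1) * d (i + e + 1) = Q ^ i * (Q * (Q ^ e * d (i + e + 1))) by ring,
          Nat.add_mul_div_left _ _ (pow_pos hQ i), Nat.add_mul_mod_self_left]
      · rw [Nat.add_mul_div_left _ _ (pow_pos hQ _), Nat.div_eq_of_lt hx, zero_add,
          Nat.mod_eq_of_lt hdm]

theorem col_lt (v x u : ℕ) : col n k w E τ v x u < 2 ^ k := Nat.mod_lt _ (by positivity)

/-- All colours and positions within a bag are encoded by some number. -/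
theorem exists_code {v : ℕ} (hbag : cnt n (Bag n E τ v) ≤ 12 * w) (c p : ℕ → ℕ)
    (hc : ∀ u < n, c u < 2 ^ k) (hp : ∀ u < n, p u < 2 ^ (12 * w)) :
    ∃ x < codes k w, ∀ u < n, Bag n E τ v u →
      col n k w E τ v x u = c u ∧ pos n k w E τ v x u = p u := by
  have hlt : ∀ u < n, c u + 2 ^ k * p u < base k w := fun u hu => by
    rw [base, pow_add]
    calc c u + 2 ^ k * p u < 2 ^ k * (p u + 1) := by rw [mul_add, mul_one]; have := hc u hu; omega
      _ ≤ _ := Nat.mul_le_mul_left _ (hp u hu)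
  have hbase : 0 < base k w := by rw [base]; positivity
  let g : ℕ → ℕ := fun i => leastLT n fun u => Bag n E τ v u ∧ cnt u (Bag n E τ v) = i
  obtain ⟨x, hx, h⟩ := exists_digits (base k w) (12 * w)
    (fun i => if g i < n then c (g i) + 2 ^ k * p (g i) else 0) fun i _ => by
      split_ifs with hi
      exacts [hlt _ hi, hbase]
  refine ⟨x, hx, fun u hu hb => ?_⟩
  have hr : cnt u (Bag n E τ v) < 12 * w := (cnt_lt_cnt hu hb).trans_le hbag
  have hg := leastLT_spec (n := n) (p := fun z => Bag n E τ v z ∧ cnt z (Bag n E τ v) =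
    cnt u (Bag n E τ v)) ⟨u, hu, hb, rfl⟩
  have hgu : g (cnt u (Bag n E τ v)) = u := eq_of_cnt_eq hg.2.1 hb hg.2.2
  have hlab : label n k w E τ v x u = c u + 2 ^ k * p u := by
    rw [label, h _ hr, hgu, if_pos hu]
  constructor
  · rw [col, hlab, Nat.add_mul_mod_self_left, Nat.mod_eq_of_lt (hc u hu)]
  · rw [pos, hlab, Nat.add_mul_div_left _ _ (by positivity), Nat.div_eq_of_lt (hc u hu), zero_add]

theorem table_succ_iff {i v x : ℕ} : table n k w D E τ (i + 1) v x ↔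
    v < n ∧ x < codes k w ∧ extend n k w D E τ (table n k w D E τ i) v x := Iff.rfl

theorem table_of_succ {i v x : ℕ} (h : table n k w D E τ (i + 1) v x) :
    table n k w D E τ i v x := by
  induction i generalizing v x with
  | zero => exact ⟨h.1, h.2.1, trivial⟩
  | succ i ih =>
    obtain ⟨h1, h2, h3, h4⟩ := table_succ_iff.1 h
    refine ⟨h1, h2, h3, fun v' hv' hb hs => ?_⟩
    obtain ⟨y, hy, hF, hA⟩ := h4 v' hv' hb hs
    exact ⟨y, hy, ih hF, hA⟩

theorem table_of_le {i j v x : ℕ} (hij : i ≤ j) (h : table n k w D E τ j v x) :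
    table n k w D E τ i v x := by
  induction hij with
  | refl => exact h
  | step _ ih => exact ih (table_of_succ h)

/-- The restrictions of a solution survive all rounds. -/
theorem IsSolution.accepts {c p : ℕ → ℕ} (hsol : IsSolution n k D c p)
    (hbag : ∀ v < n, cnt n (Bag n E τ v) ≤ 12 * w) : Accepts n k w D E τ := by
  classical
  -- Positions within a bag are obtained by counting the vertices of the bag that come before.
  let q : ℕ → ℕ → ℕ := fun v u => cnt n fun u' => Bag n E τ v u' ∧ p u' < p u
  have hq : ∀ v u u', u < n → Bag n E τ v u → (q v u < q v u' ↔ p u < p u') := by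
    intro v u u' hu hb
    constructor
    · intro h
      by_contra hcon
      have : q v u' ≤ q v u := cnt_mono fun x _ hx => ⟨hx.1, by have := hx.2; omega⟩
      omega
    · intro h
      have h1 : cnt n (fun x => (Bag n E τ v x ∧ p x < p u') ∧ ¬ (Bag n E τ v x ∧ p x < p u)) +
          q v u = q v u' := cnt_and_not fun x _ hx => ⟨hx.1, hx.2.trans h⟩
      have h2 : 0 < cnt n (fun x => (Bag n E τ v x ∧ p x < p u') ∧
          ¬ (Bag n E τ v x ∧ p x < p u)) := cnt_pos.2 ⟨u, hu, ⟨hb, h⟩, fun h => lt_irrefl _ h.2⟩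
      omega
  have hq2 : ∀ v < n, ∀ u < n, q v u < 2 ^ (12 * w) := fun v hv u _ =>
    ((cnt_mono fun x _ hx => hx.1).trans (hbag v hv)).trans_lt Nat.lt_two_pow_self
  have hex : ∀ v, ∃ x, v < n → x < codes k w ∧ ∀ u < n, Bag n E τ v u →
      col n k w E τ v x u = c u ∧ pos n k w E τ v x u = q v u := by
    intro v
    by_cases hv : v < n
    · obtain ⟨x, h⟩ := exists_code (k := k) (hbag v hv) c (q v) hsol.1 (hq2 v hv)
      exact ⟨x, fun _ => h⟩
    · exact ⟨0, fun h => absurd h hv⟩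
  choose x hx using hex
  have key : ∀ i, ∀ v < n, table n k w D E τ i v (x v) := by
    intro i
    induction i with
    | zero => exact fun v hv => ⟨hv, (hx v hv).1, trivial⟩
    | succ i ih =>
      intro v hv
      refine ⟨hv, (hx v hv).1, fun u hu u' hu' hb hb' hD => ?_, fun v' hv' _ hs =>
        ⟨x v', (hx v' hv').1, ih v' hv', fun u hu hub => ⟨?_, fun u' hu' hub' => ?_⟩⟩⟩
      · obtain ⟨h1, h2⟩ := (hx v hv).2 u hu hb
        obtain ⟨h3, h4⟩ := (hx v hv).2 u' hu' hb'
        rw [h1, h2, h3, h4, hq v u u' hu hb, hq v u' u hu' hb']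
        exact hsol.2 u hu u' hu' hD
      · rw [((hx v' hv').2 u hu (.inr hub)).1, ((hx v hv).2 u hu (hs u hu hub)).1]
      · rw [((hx v' hv').2 u hu (.inr hub)).2, ((hx v hv).2 u hu (hs u hu hub)).2,
          ((hx v' hv').2 u' hu' (.inr hub')).2, ((hx v hv).2 u' hu' (hs u' hu' hub')).2,
          hq _ _ _ hu (.inr hub), hq _ _ _ hu (hs u hu hub)]
  exact fun v hv => ⟨x v, (hx v hv).1, key n v hv⟩

/-- A new element can be inserted into a linear order at a position that is prescribed relative to
finitely many elements. -/
theorem exists_insert (s : Finset ℕ) (f : ℕ → ℕ) (p : ℕ → ℚ) (a : ℕ)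
    (h : ∀ u ∈ s, ∀ u' ∈ s, (f u < f u' ↔ p u < p u')) :
    ∃ q : ℚ, ∀ u ∈ s, (f u < a ↔ p u < q) ∧ (a < f u ↔ q < p u) := by
  by_cases htie : ∃ u₀ ∈ s, f u₀ = a
  · obtain ⟨u₀, hu₀, rfl⟩ := htie
    exact ⟨p u₀, fun u hu => ⟨h u hu u₀ hu₀, h u₀ hu₀ u hu⟩⟩
  · push Not at htie
    obtain ⟨q, hq1, hq2⟩ := Order.exists_between_finsets
      (lo := (s.filter fun u => f u < a).image p) (hi := (s.filter fun u => a < f u).image p)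
      (fun x hx y hy => by
        obtain ⟨u, hu, rfl⟩ := Finset.mem_image.1 hx
        obtain ⟨u', hu', rfl⟩ := Finset.mem_image.1 hy
        rw [Finset.mem_filter] at hu hu'
        exact (h u hu.1 u' hu'.1).1 (hu.2.trans hu'.2))
    have h1 : ∀ u ∈ s, f u < a → p u < q := fun u hu h =>
      hq1 _ (Finset.mem_image_of_mem p (Finset.mem_filter.2 ⟨hu, h⟩))
    have h2 : ∀ u ∈ s, a < f u → q < p u := fun u hu h =>
      hq2 _ (Finset.mem_image_of_mem p (Finset.mem_filter.2 ⟨hu, h⟩))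
    refine ⟨q, fun u hu => ⟨⟨h1 u hu, fun h' => ?_⟩, h2 u hu, fun h' => ?_⟩⟩
    · rcases lt_trichotomy (f u) a with h3 | h3 | h3
      · exact h3
      · exact absurd h3 (htie u hu)
      · exact absurd (h2 u hu h3) (not_lt.2 h'.le)
    · rcases lt_trichotomy (f u) a with h3 | h3 | h3
      · exact absurd (h1 u hu h3) (not_lt.2 h'.le)
      · exact absurd h3 (htie u hu)
      · exact h3

/-- The colours `c` and positions `p` restrict to the partial solution `x` for the bag of `v`. -/
def Restricts (n k w : ℕ) (E : ℕ → ℕ → Prop) (τ : ℕ → ℕ) (c : ℕ → ℕ) (p : ℕ → ℚ) (v x : ℕ)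
    (A : ℕ → Prop) : Prop :=
  ∀ u < n, A u → col n k w E τ v x u = c u ∧
    ∀ u' < n, A u' → (pos n k w E τ v x u < pos n k w E τ v x u' ↔ p u < p u')

/-- Surviving partial solutions are combined into a solution by adding one vertex after the other,
in the elimination order. -/
theorem Accepts.exists_partial (hsymm : ∀ x y, E x y → E y x) (h : Accepts n k w D E τ) (j : ℕ) :
    ∃ (c : ℕ → ℕ) (p : ℕ → ℚ), ∀ v < n, rank n τ v < j → ∃ x,
      table n k w D E τ (n - rank n τ v) v x ∧ Restricts n k w E τ c p v x (Bag n E τ v) := by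
  classical
  induction j with
  | zero => exact ⟨fun _ => 0, fun _ => 0, fun v _ h => absurd h (Nat.not_lt_zero _)⟩
  | succ j ih =>
    obtain ⟨c, p, hcp⟩ := ih
    by_cases hex : ∃ v < n, rank n τ v = j
    swap
    · refine ⟨c, p, fun v hv hj => hcp v hv ?_⟩
      have : rank n τ v ≠ j := fun h => hex ⟨v, hv, h⟩
      omega
    obtain ⟨v, hv, hvj⟩ := hex
    -- A surviving partial solution for the bag of `v` that fits what has been chosen before.
    obtain ⟨y, hy, hyr⟩ : ∃ y, table n k w D E τ (n - j) v y ∧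
        Restricts n k w E τ c p v y (Back n E τ v) := by
      by_cases hne : ∃ u, Back n E τ v u
      · obtain ⟨u₀, hu₀⟩ := hne
        obtain ⟨b, hb, hbv, hs⟩ := exists_parent hsymm hu₀
        have h1 := rank_lt_rank hb hbv
        obtain ⟨x, hx, hxr⟩ := hcp b hb (by omega)
        obtain ⟨i, hi⟩ : ∃ i, n - rank n τ b = i + 1 :=
          ⟨n - rank n τ b - 1, by have := rank_lt (τ := τ) hb; omega⟩
        rw [hi] at hx
        obtain ⟨y, -, hF, hA⟩ := (table_succ_iff.1 hx).2.2.2 v hv hbv fun u _ hu => hs u hu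
        refine ⟨y, table_of_le (by omega) hF, fun u hu hub => ?_⟩
        obtain ⟨h2, h3⟩ := hA u hu hub
        obtain ⟨h4, h5⟩ := hxr u hu (hs u hub)
        exact ⟨h2.trans h4, fun u' hu' hub' => (h3 u' hu' hub').trans (h5 u' hu' (hs u' hub'))⟩
      · obtain ⟨y, -, hy⟩ := h v hv
        exact ⟨y, table_of_le (Nat.sub_le _ _) hy, fun u _ hu => absurd ⟨u, hu⟩ hne⟩
    obtain ⟨q, hq⟩ := exists_insert ((Finset.range n).filter (Back n E τ v))
      (pos n k w E τ v y) p (pos n k w E τ v y v) (by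
        intro u hu u' hu'
        simp only [Finset.mem_filter, Finset.mem_range] at hu hu'
        exact (hyr u hu.1 hu.2).2 u' hu'.1 hu'.2)
    have hq' : ∀ u < n, Back n E τ v u → (pos n k w E τ v y u < pos n k w E τ v y v ↔ p u < q) ∧
        (pos n k w E τ v y v < pos n k w E τ v y u ↔ q < p u) := fun u hu hub =>
      hq u (Finset.mem_filter.2 ⟨Finset.mem_range.2 hu, hub⟩)
    refine ⟨Function.update c v (col n k w E τ v y v), Function.update p v q, fun v₂ hv₂ hj => ?_⟩
    by_cases hvv : v₂ = v
    · subst hvv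
      have hne : ∀ u, Back n E τ v₂ u → u ≠ v₂ := fun u hu h =>
        Before.irrefl v₂ (h ▸ hu.2.1)
      refine ⟨y, by rwa [hvj], fun u hu hub => ?_⟩
      rcases hub with rfl | hub
      · refine ⟨by simp, fun u' hu' hub' => ?_⟩
        rcases hub' with rfl | hub'
        · simp
        · rw [Function.update_self, Function.update_of_ne (hne u' hub')]
          exact (hq' u' hu' hub').2
      · rw [Function.update_of_ne (hne u hub), Function.update_of_ne (hne u hub)]
        refine ⟨(hyr u hu hub).1, fun u' hu' hub' => ?_⟩
        rcases hub' with rfl | hub'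
        · rw [Function.update_self]
          exact (hq' u hu hub).1
        · rw [Function.update_of_ne (hne u' hub')]
          exact (hyr u hu hub).2 u' hu' hub'
    · have hr : rank n τ v₂ < j := by
        rcases Before.total (τ := τ) hvv with h | h
        · have := rank_lt_rank hv₂ h
          omega
        · have := rank_lt_rank hv h
          omega
      have hne : ∀ u, Bag n E τ v₂ u → u ≠ v := by
        rintro u (rfl | hu) rfl
        · exact hvv rfl
        · have := rank_lt_rank hv hu.2.1
          omega
      obtain ⟨x, hx, hxr⟩ := hcp v₂ hv₂ hr
      refine ⟨x, hx, fun u hu hub => ?_⟩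
      rw [Function.update_of_ne (hne u hub), Function.update_of_ne (hne u hub)]
      refine ⟨(hxr u hu hub).1, fun u' hu' hub' => ?_⟩
      rw [Function.update_of_ne (hne u' hub')]
      exact (hxr u hu hub).2 u' hu' hub'

theorem Accepts.exists_isSolution (hsymm : ∀ x y, E x y → E y x) (hD : ∀ u, ¬ D u u)
    (hDE : ∀ u v, D u v → E u v) (h : Accepts n k w D E τ) :
    ∃ (c : ℕ → ℕ) (p : ℕ → ℚ), IsSolution n k D c p := by
  obtain ⟨c, p, hcp⟩ := h.exists_partial hsymm n
  refine ⟨c, p, fun u hu => ?_, fun u hu v hv huv => ?_⟩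
  · obtain ⟨x, -, hx⟩ := hcp u hu (rank_lt hu)
    rw [← (hx u hu (.inl rfl)).1]
    exact col_lt u x u
  · have key : ∀ z < n, Bag n E τ z u → Bag n E τ z v →
        (Flip k (c u) (c v) → p v < p u) ∧ (¬ Flip k (c u) (c v) → p u < p v) := by
      intro z hz hzu hzv
      obtain ⟨x, hx, hxr⟩ := hcp z hz (rank_lt hz)
      obtain ⟨i, hi⟩ : ∃ i, n - rank n τ z = i + 1 :=
        ⟨n - rank n τ z - 1, by have := rank_lt (τ := τ) hz; omega⟩
      rw [hi] at hx
      have h1 := (table_succ_iff.1 hx).2.2.1 u hu v hv hzu hzv huv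
      obtain ⟨h2, h3⟩ := hxr u hu hzu
      obtain ⟨h4, h5⟩ := hxr v hv hzv
      rwa [h2, h4, h3 v hv hzv, h5 u hu hzu] at h1
    have hne : u ≠ v := by
      rintro rfl
      exact hD u huv
    rcases Before.total (τ := τ) hne with hb | hb
    · exact key v hv (.inr (Back.of_adj hu hv (hsymm _ _ (hDE _ _ huv)) hb)) (.inl rfl)
    · exact key u hu (.inl rfl) (.inr (Back.of_adj hv hu (hDE _ _ huv) hb))

end Inversion

namespace RAM

variable {Γ : Ctx}

theorem CProp.flip {k a b : State → ℕ} (hk : CIdx Γ k) (ha : CIdx Γ a) (hb : CIdx Γ b) :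
    CProp Γ fun s => Inversion.Flip (k s) (a s) (b s) :=
  CProp.eq ((CIdx.cnt hk fun _ h₁ _ hi => (CProp.testBit (ha.mono h₁) hi).and
    (CProp.testBit (hb.mono h₁) hi)).mod (.const 2)).1 (.const 1)

/-- The data of the dynamic program are computable. -/
structure DPData (Γ : Ctx) (n k w : State → ℕ) (D E : State → ℕ → ℕ → Prop)
    (τ : State → ℕ → ℕ) : Prop where
  base : CIdx Γ fun s => Inversion.base (k s) (w s)
  codes : CIdx Γ fun s => Inversion.codes (k s) (w s)
  n : CIdx Γ n
  k : CIdx Γ k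
  w : CIdx Γ w
  D : CRel Γ D
  E : CRel Γ E
  τ : CFun Γ τ

variable {Γ' : Ctx} {n k w : State → ℕ} {D E : State → ℕ → ℕ → Prop} {τ : State → ℕ → ℕ}

theorem DPData.mono (h : DPData Γ n k w D E τ) (hΓ : Γ ≤ Γ') : DPData Γ' n k w D E τ :=
  ⟨h.base.mono hΓ, h.codes.mono hΓ, h.n.mono hΓ, h.k.mono hΓ, h.w.mono hΓ, h.D.mono hΓ,
    h.E.mono hΓ, h.τ.mono hΓ⟩

theorem DPData.label (h : DPData Γ n k w D E τ) {v x u : State → ℕ} (hv : CIdx Γ v)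
    (hx : CIdx Γ x) (hu : CIdx Γ u) :
    CIdx Γ fun s => Inversion.label (n s) (k s) (w s) (E s) (τ s) (v s) (x s) (u s) :=
  (hx.div (CNat.pow h.base (CIdx.cnt hu fun _ h₁ _ hz =>
    ((CRel.bag h.n h.E h.τ).mono h₁).app (hv.mono h₁) hz))).mod h.base.1

theorem DPData.col (h : DPData Γ n k w D E τ) {v x u : State → ℕ} (hv : CIdx Γ v)
    (hx : CIdx Γ x) (hu : CIdx Γ u) :
    CIdx Γ fun s => Inversion.col (n s) (k s) (w s) (E s) (τ s) (v s) (x s) (u s) :=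
  (h.label hv hx hu).mod (CNat.pow (.const 2) h.k)

theorem DPData.pos (h : DPData Γ n k w D E τ) {v x u : State → ℕ} (hv : CIdx Γ v)
    (hx : CIdx Γ x) (hu : CIdx Γ u) :
    CIdx Γ fun s => Inversion.pos (n s) (k s) (w s) (E s) (τ s) (v s) (x s) (u s) :=
  (h.label hv hx hu).div (CNat.pow (.const 2) h.k)

theorem DPData.valid (h : DPData Γ n k w D E τ) {v x : State → ℕ} (hv : CIdx Γ v)
    (hx : CIdx Γ x) :
    CProp Γ fun s => Inversion.Valid (n s) (k s) (w s) (D s) (E s) (τ s) (v s) (x s) := by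
  refine CProp.forall_lt h.n fun Γ₁ h₁ u hu => CProp.forall_lt (h.n.mono h₁)
    fun Γ₂ h₂ u' hu' => ?_
  replace h := (h.mono h₁).mono h₂
  replace hv := (hv.mono h₁).mono h₂
  replace hx := (hx.mono h₁).mono h₂
  replace hu := hu.mono h₂
  have hbag := CRel.bag h.n h.E h.τ
  have hflip := CProp.flip h.k (h.col hv hx hu) (h.col hv hx hu')
  have hp := (h.pos hv hx hu).1
  have hp' := (h.pos hv hx hu').1
  exact (hbag.app hv hu).imp ((hbag.app hv hu').imp ((h.D.app hu hu').imp
    ((hflip.imp (CProp.lt hp' hp)).and (hflip.not.imp (CProp.lt hp hp')))))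

theorem DPData.agrees (h : DPData Γ n k w D E τ) {v x v' y : State → ℕ} (hv : CIdx Γ v)
    (hx : CIdx Γ x) (hv' : CIdx Γ v') (hy : CIdx Γ y) :
    CProp Γ fun s =>
      Inversion.Agrees (n s) (k s) (w s) (E s) (τ s) (v s) (x s) (v' s) (y s) := by
  refine CProp.forall_lt h.n fun Γ₁ h₁ u hu => ?_
  replace h := h.mono h₁
  replace hv := hv.mono h₁
  replace hx := hx.mono h₁
  replace hv' := hv'.mono h₁
  replace hy := hy.mono h₁
  refine ((CRel.back h.n h.E h.τ).app hv' hu).imp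
    ((CProp.eq (h.col hv' hy hu).1 (h.col hv hx hu).1).and
      (CProp.forall_lt h.n fun Γ₂ h₂ u' hu' => ?_))
  replace h := h.mono h₂
  replace hv := hv.mono h₂
  replace hx := hx.mono h₂
  replace hv' := hv'.mono h₂
  replace hy := hy.mono h₂
  replace hu := hu.mono h₂
  exact ((CRel.back h.n h.E h.τ).app hv' hu').imp
    ((CProp.lt (h.pos hv' hy hu).1 (h.pos hv' hy hu').1).iff
      (CProp.lt (h.pos hv hx hu).1 (h.pos hv hx hu').1))

theorem DPData.extend (h : DPData Γ n k w D E τ) {F : State → ℕ → ℕ → Prop} (hF : CRel Γ F)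
    {v x : State → ℕ} (hv : CIdx Γ v) (hx : CIdx Γ x) :
    CProp Γ fun s =>
      Inversion.extend (n s) (k s) (w s) (D s) (E s) (τ s) (F s) (v s) (x s) := by
  refine (h.valid hv hx).and (CProp.forall_lt h.n fun Γ₁ h₁ v' hv' => ?_)
  replace h := h.mono h₁
  replace hv := hv.mono h₁
  replace hx := hx.mono h₁
  replace hF := hF.mono h₁
  refine ((CRel.before h.τ).app hv hv').imp (CProp.imp ?_ ?_)
  · exact CProp.forall_lt h.n fun Γ₂ h₂ u hu =>
      (((CRel.back h.n h.E h.τ).mono h₂).app (hv'.mono h₂) hu).imp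
        (((CRel.bag h.n h.E h.τ).mono h₂).app (hv.mono h₂) hu)
  · exact CProp.exists_lt h.codes fun Γ₂ h₂ y hy => ((hF.mono h₂).app (hv'.mono h₂) hy).and
      ((h.mono h₂).agrees (hv.mono h₂) (hx.mono h₂) (hv'.mono h₂) hy)

theorem DPData.accepts (h : DPData Γ n k w D E τ) :
    CProp Γ fun s => Inversion.Accepts (n s) (k s) (w s) (D s) (E s) (τ s) := by
  refine CProp.forall_lt h.n fun Γ₁ h₁ v hv => CProp.exists_lt (h.codes.mono h₁)
    fun Γ₂ h₂ x hx => ?_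
  replace h := (h.mono h₁).mono h₂
  exact CProp.relIter h.n h.codes h.n
    (fun _ _ _ _ _ _ => (CProp.eq (.const 0) (.const 0)).congr fun _ => by simp)
    (fun Γ₃ h₃ F i j hF hi hj => (h.mono h₃).extend hF hi hj) (hv.mono h₂).1 hx.1

end RAM

/-! ### Decycling families, colours and positions -/

namespace RAM

theorem cnt_succ (n : ℕ) (p : ℕ → Prop) : cnt (n + 1) p = cnt n p + ind (p n) := by
  rw [cnt, cnt, Finset.range_add_one, Finset.filter_insert, ind]
  split_ifs <;> simp

theorem cnt_congr_of_le {n m : ℕ} (hnm : n ≤ m) {p q : ℕ → Prop} (h : ∀ i < n, p i ↔ q i)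
    (h' : ∀ i < m, n ≤ i → ¬ q i) : cnt n p = cnt m q := by
  classical
  rw [cnt_eq_card (p := q) (s := (Finset.range m).filter q) (by simp)]
  refine cnt_eq_card fun x => ?_
  simp only [Finset.mem_filter, Finset.mem_range]
  constructor
  · rintro ⟨hx, hq⟩
    have hxn : x < n := by
      by_contra hx'
      exact h' x hx (by omega) hq
    exact ⟨hxn, (h x hxn).2 hq⟩
  · rintro ⟨hx, hp⟩
    exact ⟨by omega, (h x hx).1 hp⟩

theorem cnt_eq_ncard {n : ℕ} (p : ℕ → Prop) : cnt n p = {u : Fin n | p u}.ncard := by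
  classical
  rw [cnt_eq_card (s := (Finset.univ.filter fun u : Fin n => p u).map Fin.valEmbedding)]
  · rw [Finset.card_map, ← Set.ncard_coe_finset]
    congr 1
    ext u
    simp
  · intro x
    simp only [Finset.mem_map, Finset.mem_filter, Finset.mem_univ, true_and, Fin.valEmbedding_apply]
    constructor
    · rintro ⟨u, hu, rfl⟩
      exact ⟨u.2, hu⟩
    · rintro ⟨hx, hp⟩
      exact ⟨⟨x, hx⟩, hp, rfl⟩

end RAM

namespace Inversion

open RAM

theorem flip_comm {k a b : ℕ} : Flip k a b ↔ Flip k b a := by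
  simp only [Flip, and_comm]

/-- The arcs of a digraph on `Fin n`, as a relation on the natural numbers. -/
def Arc {n : ℕ} (D : Digraph (Fin n)) (u v : ℕ) : Prop :=
  ∃ a b : Fin n, (a : ℕ) = u ∧ (b : ℕ) = v ∧ D.Adj a b

@[simp] theorem arc_coe {n : ℕ} {D : Digraph (Fin n)} {a b : Fin n} : Arc D a b ↔ D.Adj a b := by
  constructor
  · rintro ⟨a', b', ha, hb, h⟩
    rwa [Fin.ext ha, Fin.ext hb] at h
  · exact fun h => ⟨a, b, rfl, rfl, h⟩

end Inversion

namespace Digraph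

open RAM Inversion

variable {V : Type*}

/-- An arc is reversed in total if it is reversed by an odd number of the inversions. -/
theorem invertAll_map_range_adj (D : Digraph V) (Y : ℕ → Set V) (k : ℕ) (u v : V) :
    (D.invertAll ((List.range k).map Y)).Adj u v ↔
      (cnt k (fun i => u ∈ Y i ∧ v ∈ Y i) % 2 = 1 ∧ D.Adj v u) ∨
        (¬ cnt k (fun i => u ∈ Y i ∧ v ∈ Y i) % 2 = 1 ∧ D.Adj u v) := by
  induction k generalizing u v with
  | zero => simp [invertAll, cnt]
  | succ k ih =>
    have hc : (fun i => v ∈ Y i ∧ u ∈ Y i) = fun i => u ∈ Y i ∧ v ∈ Y i := by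
      funext i
      exact propext and_comm
    have h : D.invertAll ((List.range (k + 1)).map Y) =
        (D.invertAll ((List.range k).map Y)).invert (Y k) := by
      simp [invertAll, List.range_succ]
    rw [h, invert, cnt_succ, ind]
    dsimp only
    rw [ih, ih, hc]
    by_cases hY : u ∈ Y k ∧ v ∈ Y k
    · rw [if_pos hY]
      by_cases hp : cnt k (fun i => u ∈ Y i ∧ v ∈ Y i) % 2 = 1
      · have hp' : ¬ (cnt k (fun i => u ∈ Y i ∧ v ∈ Y i) + 1) % 2 = 1 := by omega
        simp [hY, hp, hp']
      · have hp' : (cnt k (fun i => u ∈ Y i ∧ v ∈ Y i) + 1) % 2 = 1 := by omega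
        simp [hY, hp, hp']
    · rw [if_neg hY, add_zero]
      tauto

/-- A decycling family yields colours and positions: the position of a vertex is the number of
vertices from which it can be reached after the inversions. -/
theorem IsInvertibleWith.exists_isSolution {n k : ℕ} {D : Digraph (Fin n)}
    (h : D.IsInvertibleWith k) : ∃ c p : ℕ → ℕ, IsSolution n k (Arc D) c p := by
  classical
  obtain ⟨Ys, hlen, hYs⟩ := h
  let Y : ℕ → Set (Fin n) := fun i => Ys.getD i ∅
  have hY : Ys = (List.range Ys.length).map Y := by
    refine List.ext_getElem (by simp) fun i h1 h2 => ?_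
    simp [Y, h1]
  have hc : ∀ u : ℕ, ∃ c < 2 ^ k, ∀ i < k, c.testBit i = true ↔
      ∃ a : Fin n, (a : ℕ) = u ∧ a ∈ Y i := fun u => exists_testBit k _
  choose c hck hc using hc
  have hcoe : ∀ (a : Fin n) (i : ℕ), (∃ b : Fin n, (b : ℕ) = a ∧ b ∈ Y i) ↔ a ∈ Y i := by
    intro a i
    constructor
    · rintro ⟨b, hb, h⟩
      rwa [Fin.ext hb] at h
    · exact fun h => ⟨a, rfl, h⟩
  have hflip : ∀ a b : Fin n, Flip k (c a) (c b) ↔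
      cnt Ys.length (fun i => a ∈ Y i ∧ b ∈ Y i) % 2 = 1 := by
    intro a b
    rw [Flip, cnt_congr_of_le hlen fun i hi => ?_]
    · intro i hik hi
      rw [hc a i hik, hcoe]
      simp [Y, hi]
    · rw [hc a i (by omega), hc b i (by omega), hcoe, hcoe]
  have hadj : ∀ a b : Fin n, (D.invertAll Ys).Adj a b ↔
      (Flip k (c a) (c b) ∧ D.Adj b a) ∨ (¬ Flip k (c a) (c b) ∧ D.Adj a b) := by
    intro a b
    rw [hflip]
    conv_lhs => rw [hY]
    exact invertAll_map_range_adj D Y _ a b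
  let P : Fin n → ℕ := fun a =>
    (Finset.univ.filter fun x => Relation.TransGen (D.invertAll Ys).Adj x a).card
  have hP : ∀ a b, (D.invertAll Ys).Adj a b → P a < P b := by
    intro a b hab
    refine Finset.card_lt_card ⟨fun x hx => ?_, fun hs => ?_⟩
    · simp only [Finset.mem_filter, Finset.mem_univ, true_and] at hx ⊢
      exact hx.tail hab
    · have := hs (Finset.mem_filter.2 ⟨Finset.mem_univ a, .single hab⟩)
      exact hYs a (Finset.mem_filter.1 this).2
  refine ⟨c, fun u => if hu : u < n then P ⟨u, hu⟩ else 0, fun u _ => hck u, ?_⟩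
  rintro _ hu _ hv ⟨a, b, rfl, rfl, hab⟩
  simp only [hu, hv, dif_pos]
  exact ⟨fun hf => hP _ _ ((hadj b a).2 (.inl ⟨flip_comm.1 hf, hab⟩)),
    fun hf => hP _ _ ((hadj a b).2 (.inr ⟨hf, hab⟩))⟩

/-- Conversely, the binary digits of the colours yield a decycling family. -/
theorem isInvertibleWith_of_isSolution {α : Type*} [Preorder α] {n k : ℕ} {D : Digraph (Fin n)}
    {c : ℕ → ℕ} {p : ℕ → α} (h : IsSolution n k (Arc D) c p) : D.IsInvertibleWith k := by
  refine ⟨(List.range k).map fun i => {u : Fin n | (c u).testBit i = true}, by simp, ?_⟩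
  intro v hv
  have key : ∀ a b : Fin n, (D.invertAll ((List.range k).map
      fun i => {u : Fin n | (c u).testBit i = true})).Adj a b → p a < p b := by
    intro a b hab
    rcases (invertAll_map_range_adj _ _ _ _ _).1 hab with ⟨hf, hab⟩ | ⟨hf, hab⟩
    · exact (h.2 b b.2 a a.2 (arc_coe.2 hab)).1 (flip_comm.1 hf)
    · exact (h.2 a a.2 b b.2 (arc_coe.2 hab)).2 hf
  have key' : ∀ a b : Fin n, Relation.TransGen (D.invertAll ((List.range k).map
      fun i => {u : Fin n | (c u).testBit i = true})).Adj a b → p a < p b := by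
    intro a b hab
    induction hab with
    | single h => exact key _ _ h
    | tail _ h ih => exact ih.trans (key _ _ h)
  exact lt_irrefl _ (key' v v hv)

end Digraph

namespace Elimination

open RAM Inversion

/-- Adjacency of distinct numbers in one of the two directions. -/
def Edge (D : ℕ → ℕ → Prop) (u v : ℕ) : Prop := u ≠ v ∧ (D u v ∨ D v u)

theorem Edge.symm {D : ℕ → ℕ → Prop} {u v : ℕ} (h : Edge D u v) : Edge D v u :=
  ⟨h.1.symm, h.2.symm⟩

theorem Edge.irrefl {D : ℕ → ℕ → Prop} (u : ℕ) : ¬ Edge D u u := fun h => h.1 rfl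

theorem edge_arc_iff {n : ℕ} {D : Digraph (Fin n)} {a b : Fin n} :
    Edge (Arc D) a b ↔ D.toSimpleGraphInclusive.Adj a b := by
  rw [Edge, arc_coe, arc_coe, Digraph.toSimpleGraphInclusive, SimpleGraph.fromRel_adj, Ne, Ne,
    Fin.ext_iff]

theorem separable_of_treewidth_le {n w : ℕ} {D : Digraph (Fin n)}
    (hw : D.toSimpleGraphInclusive.treewidth ≤ w) : Separable n w (Edge (Arc D)) := by
  classical
  intro W
  obtain ⟨T, hT⟩ := SimpleGraph.exists_width_eq_treewidth D.toSimpleGraphInclusive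
  obtain ⟨t, P, Q, hcov, hPt, hPQ, hP, hQ⟩ :=
    T.exists_balanced_bag (Finset.univ.filter fun a : Fin n => W a)
  set W' := Finset.univ.filter fun a : Fin n => W a with hW'
  have hWc : cnt n W = W'.card := by
    rw [cnt_eq_ncard, ← Set.ncard_coe_finset]
    simp [hW']
  have hsub : ∀ R : Set (Fin n), cnt n (fun u => ∃ a : Fin n, (a : ℕ) = u ∧ W u ∧ a ∉ R) +
      (W' ∩ R : Set (Fin n)).ncard = W'.card := by
    intro R
    have h1 : (W' ∩ R : Set (Fin n)).ncard =
        cnt n fun u => ∃ a : Fin n, (a : ℕ) = u ∧ W u ∧ a ∈ R := by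
      rw [cnt_eq_ncard]
      congr 1
      ext a
      simp only [hW', Finset.coe_filter, Finset.mem_univ, true_and, Set.mem_inter_iff,
        Set.mem_ofPred_eq]
      constructor
      · rintro ⟨h, h'⟩
        exact ⟨a, rfl, h, h'⟩
      · rintro ⟨b, hb, h, h'⟩
        obtain rfl := Fin.ext hb
        exact ⟨h, h'⟩
    rw [h1, ← hWc, ← cnt_and_not (p := W)
      (q := fun u => ∃ a : Fin n, (a : ℕ) = u ∧ W u ∧ a ∈ R) fun u _ ⟨_, _, h, _⟩ => h]
    congr 1
    refine cnt_congr_of_le _root_.le_rfl (fun u hu => ?_) fun u hu hu' => by omega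
    constructor
    · rintro ⟨a, rfl, h, h'⟩
      refine ⟨h, ?_⟩
      rintro ⟨b, hb, -, hbR⟩
      exact h' (Fin.ext hb ▸ hbR)
    · rintro ⟨h, h'⟩
      exact ⟨⟨u, hu⟩, rfl, h, fun hR => h' ⟨⟨u, hu⟩, rfl, h, hR⟩⟩
  refine ⟨fun u => ∃ a : Fin n, (a : ℕ) = u ∧ W u ∧ a ∉ Q,
    fun u => ∃ a : Fin n, (a : ℕ) = u ∧ W u ∧ a ∉ P,
    fun u => ∃ a : Fin n, (a : ℕ) = u ∧ a ∈ T.bag t, fun u ⟨_, _, h, _⟩ => h,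
    fun u ⟨_, _, h, _⟩ => h, ?_, ?_, ?_, ?_⟩
  · -- A walk that avoids the bag and starts in `P` stays in `P`.
    rintro u v hu ⟨a, rfl, -, haQ⟩ haS huv ⟨b, rfl, -, hbP⟩
    have haP : a ∈ P := by
      rcases hcov a with h | h | h
      · exact absurd ⟨a, rfl, h⟩ haS
      · exact h
      · exact absurd h haQ
    have key : ∀ v, Reach n (fun x y => Edge (Arc D) x y ∧
        (¬ ∃ a : Fin n, (a : ℕ) = x ∧ a ∈ T.bag t) ∧
          ¬ ∃ a : Fin n, (a : ℕ) = y ∧ a ∈ T.bag t) a v → ∃ b ∈ P, (b : ℕ) = v := by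
      intro v hv
      induction hv with
      | refl => exact ⟨a, haP, rfl⟩
      | @tail x y _ hxy ih =>
        obtain ⟨b, hb, rfl⟩ := ih
        obtain ⟨-, hy, hE, -, hS⟩ := hxy
        refine ⟨⟨y, hy⟩, ?_, rfl⟩
        rcases hcov ⟨y, hy⟩ with h | h | h
        · exact absurd ⟨_, rfl, h⟩ hS
        · exact h
        · exact absurd (edge_arc_iff.1 hE) (hPQ b hb ⟨y, hy⟩ h)
    obtain ⟨b', hb', hbb⟩ := key _ huv
    exact hbP (Fin.ext hbb ▸ hb')
  · rw [cnt_eq_ncard]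
    have h1 := T.card_bag_le t
    have h2 : {u : Fin n | ∃ a : Fin n, (a : ℕ) = u ∧ a ∈ T.bag t} = T.bag t := by
      ext u
      constructor
      · rintro ⟨a, ha, h⟩
        rwa [Fin.ext ha] at h
      · exact fun h => ⟨u, rfl, h⟩
    rw [h2, Set.ncard_coe_finset]
    omega
  · have := hsub Q
    omega
  · have := hsub P
    omega

end Elimination

namespace SimpleGraph

theorem treewidth_le_card {V : Type*} [Fintype V] (G : SimpleGraph V) :
    G.treewidth ≤ Fintype.card V := by
  obtain ⟨T⟩ := TreeDecomposition.instNonempty G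
  refine (Nat.sInf_le ⟨T, rfl⟩ : G.treewidth ≤ T.width).trans ?_
  exact (Nat.sub_le _ _).trans (Finset.sup_le fun t _ => Finset.card_le_univ _)

/-- A graph with an edge has positive treewidth. -/
theorem treewidth_pos {V : Type*} [Fintype V] {G : SimpleGraph V} {u v : V} (h : G.Adj u v) :
    0 < G.treewidth := by
  obtain ⟨T, hT⟩ := exists_width_eq_treewidth G
  obtain ⟨t, hu, hv⟩ := T.exists_bag_of_adj u v h
  have h1 : 1 < (T.bag t).card := Finset.one_lt_card.2 ⟨u, hu, v, hv, h.ne⟩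
  have := T.card_bag_le t
  omega

end SimpleGraph

/-! ### The algorithm -/

namespace Inversion

open RAM Elimination

open Classical in
/-- The attempt with the guess `w` for the treewidth. Loops and pairs of opposite arcs, which no
inversion removes, and digraphs without arcs are treated first; in the cases that remain, the
treewidth is positive. The value is `0` if the guess is recognized to be too small; otherwise it is
`2` or `1`, depending on whether the digraph is a yes-instance. -/
noncomputable def attempt (n k w : ℕ) (D : ℕ → ℕ → Prop) : ℕ :=
  if ∃ u < n, ∃ v < n, D u v ∧ D v u then 1
  else if ∀ u < n, ∀ v < n, ¬ D u v then 2
  else if w = 0 then 0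
  else if ∃ v < n, 12 * w < cnt n (Bag n (Edge D) (times n w (Edge D) n) v) then 0
  else if Accepts n k w D (Edge D) (times n w (Edge D) n) then 2 else 1

/-- Every value of `attempt` other than `0` is correct. -/
theorem attempt_spec (n k w : ℕ) (D : Digraph (Fin n)) : attempt n k w (Arc D) = 0 ∨
    attempt n k w (Arc D) = 1 ∧ ¬ D.IsInvertibleWith k ∨
      attempt n k w (Arc D) = 2 ∧ D.IsInvertibleWith k := by
  rw [attempt]
  by_cases h2 : ∃ u < n, ∃ v < n, Arc D u v ∧ Arc D v u
  · rw [if_pos h2]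
    refine .inr (.inl ⟨rfl, fun h => ?_⟩)
    obtain ⟨c, p, hcp⟩ := h.exists_isSolution
    obtain ⟨u, hu, v, hv, huv, hvu⟩ := h2
    have h3 := hcp.2 u hu v hv huv
    have h4 := hcp.2 v hv u hu hvu
    rw [flip_comm] at h4
    by_cases hf : Flip k (c u) (c v)
    · exact lt_asymm (h3.1 hf) (h4.1 hf)
    · exact lt_asymm (h3.2 hf) (h4.2 hf)
  rw [if_neg h2]
  by_cases h3 : ∀ u < n, ∀ v < n, ¬ Arc D u v
  · rw [if_pos h3]
    exact .inr (.inr ⟨rfl, Digraph.isInvertibleWith_of_isSolution (c := fun _ => 0)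
      (p := fun _ => (0 : ℕ)) ⟨fun _ _ => by positivity,
        fun u hu v hv h => absurd h (h3 u hu v hv)⟩⟩)
  rw [if_neg h3]
  by_cases hw : w = 0
  · exact .inl (if_pos hw)
  rw [if_neg hw]
  by_cases h4 : ∃ v < n, 12 * w < cnt n (Bag n (Edge (Arc D)) (times n w (Edge (Arc D)) n) v)
  · exact .inl (if_pos h4)
  rw [if_neg h4]
  push Not at h4
  have hirr : ∀ u, ¬ Arc D u u := by
    rintro _ ⟨a, b, rfl, hb, h⟩
    exact h2 ⟨a, a.2, a, a.2, ⟨a, b, rfl, hb, h⟩, ⟨a, b, rfl, hb, h⟩⟩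
  by_cases h5 : Accepts n k w (Arc D) (Edge (Arc D)) (times n w (Edge (Arc D)) n)
  · rw [if_pos h5]
    obtain ⟨c, p, hcp⟩ := h5.exists_isSolution (fun _ _ => Edge.symm) hirr
      fun u v h => ⟨fun huv => hirr u (by rwa [← huv] at h), .inl h⟩
    exact .inr (.inr ⟨rfl, Digraph.isInvertibleWith_of_isSolution hcp⟩)
  · rw [if_neg h5]
    refine .inr (.inl ⟨rfl, fun h => h5 ?_⟩)
    obtain ⟨c, p, hcp⟩ := h.exists_isSolution
    exact hcp.accepts h4

/-- The attempt succeeds at the latest when the guess is the treewidth. -/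
theorem attempt_ne_zero {n k w : ℕ} {D : Digraph (Fin n)}
    (hw : D.toSimpleGraphInclusive.treewidth ≤ w) : attempt n k w (Arc D) ≠ 0 := by
  rw [attempt]
  split_ifs with h2 h3 h4 h5
  · simp
  · simp
  · exfalso
    push Not at h3
    obtain ⟨u, hu, v, hv, huv⟩ := h3
    have hne : u ≠ v := by
      rintro rfl
      exact h2 ⟨u, hu, u, hv, huv, huv⟩
    have hadj := edge_arc_iff.1 (⟨hne, .inl huv⟩ : Edge (Arc D) (⟨u, hu⟩ : Fin n) (⟨v, hv⟩ : Fin n))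
    have := SimpleGraph.treewidth_pos hadj
    omega
  · exfalso
    obtain ⟨v, hv, h⟩ := h5
    have := cnt_bag_le (by omega) Edge.irrefl (fun _ _ => Edge.symm)
      (separable_of_treewidth_le hw) hv
    omega
  · simp
  · simp

end Inversion

namespace RAM

open Inversion Elimination

variable {Γ : Ctx}

/-- The arcs of the input digraph, as they are stored in the array `0`. -/
def inputArc (s : State) (u v : ℕ) : Prop :=
  u < s.reg 0 ∧ v < s.reg 0 ∧ s.arr 0 (u * s.reg 0 + v) ≠ 0

theorem reg_le_budget (s : State) : s.reg 0 ≤ budget s :=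
  (by omega : s.reg 0 ≤ 1 * (s.reg 0 + 2)).trans (Nat.mul_le_mul_right _ Nat.one_le_two_pow)

theorem two_pow_le_budget_pow {s : State} {e m : ℕ} (h : e ≤ s.reg 2 * (s.reg 1 + s.reg 2) * m) :
    2 ^ e ≤ budget s ^ m := by
  refine (Nat.pow_le_pow_right (by omega) h).trans ?_
  rw [pow_mul]
  exact Nat.pow_le_pow_left (Nat.le_mul_of_pos_right _ (by omega)) m

theorem CIdx.reg_zero : CIdx Γ fun s => s.reg 0 :=
  ⟨CNat.reg (by have := Γ.hL; omega), 1, fun s => by simpa using reg_le_budget s⟩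

theorem polyBdd_two_pow_reg_two : PolyBdd fun s => 2 ^ s.reg 2 :=
  ⟨1, fun s => two_pow_le_budget_pow (by
    nlinarith [Nat.zero_le (s.reg 2 * s.reg 1), Nat.le_mul_self (s.reg 2)])⟩

theorem CIdx.reg_two : CIdx Γ fun s => s.reg 2 :=
  ⟨CNat.reg (by have := Γ.hL; omega),
    polyBdd_two_pow_reg_two.of_le fun _ => Nat.lt_two_pow_self.le⟩

/-- The number of inversions, replaced by `0` for `w = 0` to make it polynomially bounded. -/
def cappedK (s : State) : ℕ := if s.reg 2 ≠ 0 then s.reg 1 else 0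

theorem cappedK_le (s : State) : cappedK s ≤ s.reg 2 * s.reg 1 := by
  rw [cappedK]
  split_ifs with h
  · exact Nat.le_mul_of_pos_left _ (Nat.pos_of_ne_zero h)
  · exact Nat.zero_le _

theorem CIdx.cappedK : CIdx Γ cappedK :=
  ⟨CNat.ite_ne_zero CIdx.reg_two.1 (CNat.reg (by have := Γ.hL; omega)) (.const 0), 1, fun s =>
    Nat.lt_two_pow_self.le.trans (two_pow_le_budget_pow (by
      have := cappedK_le s
      nlinarith [Nat.zero_le (s.reg 2 * s.reg 2)]))⟩

theorem CRel.inputArc : CRel Γ inputArc := fun Γ₁ h₁ u v hu hv =>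
  (CProp.lt hu.1 CIdx.reg_zero.1).and ((CProp.lt hv.1 CIdx.reg_zero.1).and
    (CProp.ne_zero (CNat.load (by have := Γ₁.hL; omega)
      ((hu.1.mul CIdx.reg_zero).add hv.1))))

theorem CRel.edge {D : State → ℕ → ℕ → Prop} (hD : CRel Γ D) : CRel Γ fun s => Edge (D s) :=
  fun _ h₁ _ _ hu hv => (CProp.eq hu.1 hv.1).not.and
    (((hD.mono h₁).app hu hv).or ((hD.mono h₁).app hv hu))

theorem dpData : DPData Γ (fun s => s.reg 0) cappedK (fun s => s.reg 2) inputArc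
    (fun s => Edge (inputArc s))
    fun s => times (s.reg 0) (s.reg 2) (Edge (inputArc s)) (s.reg 0) := by
  have hbase : CIdx Γ fun s => base (cappedK s) (s.reg 2) := by
    refine ⟨CNat.pow (.const 2) (CIdx.cappedK.add ((CIdx.const 12).mul CIdx.reg_two)), 12,
      fun s => two_pow_le_budget_pow ?_⟩
    have := cappedK_le s
    nlinarith [Nat.zero_le (s.reg 2 * s.reg 1), Nat.le_mul_self (s.reg 2)]
  refine ⟨hbase, ⟨CNat.pow hbase ((CIdx.const 12).mul CIdx.reg_two), 12 * 12, fun s => ?_⟩,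
    CIdx.reg_zero, CIdx.cappedK, CIdx.reg_two, CRel.inputArc, CRel.inputArc.edge,
    CFun.times CIdx.reg_zero CIdx.reg_two polyBdd_two_pow_reg_two CRel.inputArc.edge
      CIdx.reg_zero⟩
  change codes (cappedK s) (s.reg 2) ≤ _
  rw [codes, base, ← pow_mul]
  refine two_pow_le_budget_pow ?_
  have h : cappedK s ≤ s.reg 1 := by
    rw [cappedK]
    split_ifs
    exacts [_root_.le_rfl, Nat.zero_le _]
  calc (cappedK s + 12 * s.reg 2) * (12 * s.reg 2) ≤ (12 * (s.reg 1 + s.reg 2)) * (12 * s.reg 2) :=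
        Nat.mul_le_mul_right _ (by omega)
    _ = _ := by ring

theorem CNat.attempt :
    CNat Γ fun s => attempt (s.reg 0) (s.reg 1) (s.reg 2) (inputArc s) := by
  classical
  have hn : CIdx Γ fun s => s.reg 0 := CIdx.reg_zero
  have hD : CRel Γ inputArc := CRel.inputArc
  have hdp : DPData Γ _ _ _ _ _ _ := dpData
  have h : CNat Γ fun s => Inversion.attempt (s.reg 0) (cappedK s) (s.reg 2) (inputArc s) := by
    refine CNat.ite (CProp.exists_lt hn fun Γ₁ h₁ u hu => CProp.exists_lt (hn.mono h₁)
      fun Γ₂ h₂ v hv => ?_) (.const 1) (CNat.ite (CProp.forall_lt hn fun Γ₁ h₁ u hu =>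
        CProp.forall_lt (hn.mono h₁) fun Γ₂ h₂ v hv => ?_) (.const 2)
        (CNat.ite (CProp.eq CIdx.reg_two.1 (.const 0)) (.const 0)
        (CNat.ite (CProp.exists_lt hn fun Γ₁ h₁ v hv => ?_) (.const 0)
          (CNat.ite hdp.accepts (.const 2) (.const 1)))))
    · exact (CRel.inputArc.app (hu.mono h₂) hv).and (CRel.inputArc.app hv (hu.mono h₂))
    · exact (CRel.inputArc.app (hu.mono h₂) hv).not
    · exact CProp.lt ((CIdx.const 12).mul CIdx.reg_two).1 (CIdx.cnt (hn.mono h₁)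
        fun Γ₂ h₂ u hu => (CRel.bag ((hn.mono h₁).mono h₂) ((hdp.E.mono h₁).mono h₂)
          ((hdp.τ.mono h₁).mono h₂)).app (hv.mono h₂) hu).1
  refine h.congr fun s => ?_
  by_cases hw : s.reg 2 = 0
  · simp [Inversion.attempt, hw]
  · simp [cappedK, hw]

theorem inputArc_inversionInput {n : ℕ} (D : Digraph (Fin n)) (k : ℕ) :
    inputArc (inversionInput D k) = Arc D := by
  classical
  funext u v
  refine propext ⟨fun ⟨hu, hv, h⟩ => ?_, ?_⟩
  · replace hu : u < n := hu
    replace hv : v < n := hv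
    have h' : ∃ a b : Fin n, u * n + v = (a : ℕ) * n + b ∧ D.Adj a b := by
      by_contra h'
      exact h (if_neg fun h'' => h' h''.2)
    obtain ⟨a, b, hab, hD⟩ := h'
    have hb := b.2
    have h1 : u = a := by
      have h1 := congrArg (· / n) hab
      simpa [Nat.mul_comm _ n, Nat.mul_add_div (by omega : 0 < n), Nat.div_eq_of_lt hv,
        Nat.div_eq_of_lt hb] using h1
    subst h1
    exact ⟨a, b, rfl, by omega, hD⟩
  · rintro ⟨a, b, rfl, rfl, h⟩
    refine ⟨a.2, b.2, ?_⟩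
    have : (inversionInput D k).arr 0 (a * n + b) = 1 := if_pos ⟨rfl, a, b, rfl, h⟩
    change (inversionInput D k).arr 0 (a * n + b) ≠ 0
    omega

theorem Agree.inputArc_eq {s s' : State} (h : Agree 2 s s') : inputArc s' = inputArc s := by
  funext u v
  rw [inputArc, inputArc, h.1 0 (by omega), h.2 0 (by omega)]

/-- One round of the search: register `4` receives the outcome of an attempt; after a successful
attempt the flag in register `3` is cleared, and otherwise the guess in register `2` is
increased. -/
def searchRound (p : Prog) : Prog :=
  .seq p (.ite 4 (.const 3 0) (.seq (.const 5 1) (.add 2 2 5)))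

/-- The program: the guesses for the treewidth are increased until an attempt succeeds. -/
def search (p : Prog) : Prog :=
  .seq (.const 2 0) (.seq (.const 3 1) (.seq (.loop 3 (searchRound p))
    (.seq (.const 2 1) (.sub 0 4 2))))

variable {p : Prog} {e : ℕ}

theorem runs_searchRound
    (hp : ∀ s, Runs p s (budget s ^ e) fun s' =>
      s'.reg 4 = attempt (s.reg 0) (s.reg 1) (s.reg 2) (inputArc s) ∧ Agree 4 s s') (s : State) :
    Runs (searchRound p) s (budget s ^ e + 3) fun s' =>
      s'.reg 4 = attempt (s.reg 0) (s.reg 1) (s.reg 2) (inputArc s) ∧ Agree 2 s s' ∧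
        (s'.reg 4 ≠ 0 → s'.reg 3 = 0) ∧
        (s'.reg 4 = 0 → s'.reg 3 = s.reg 3 ∧ s'.reg 2 = s.reg 2 + 1) := by
  refine (hp s).seq fun s₁ ⟨h4, hA⟩ => ?_
  by_cases h : s₁.reg 4 = 0
  · refine ⟨_, _, .ite_else h (.seq (.const 5 1 _) (.add 2 2 5 _)), by omega, ?_⟩
    have hA' : Agree 2 s (((s₁.setReg 5 1).setReg 2 ((s₁.setReg 5 1).reg 2 +
        (s₁.setReg 5 1).reg 5))) :=
      ((hA.mono (by omega)).setReg (by omega) _).setReg (by omega) _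
    have h2 := hA.1 2 (by omega)
    have h3 := hA.1 3 (by omega)
    simp only [State.setReg] at hA' ⊢
    simpa [h, ← h4, h2, h3] using hA'
  · refine ⟨_, _, .ite_then h (.const 3 0 _), by omega, ?_⟩
    have hA' : Agree 2 s (s₁.setReg 3 0) := (hA.mono (by omega)).setReg (by omega) _
    simp only [State.setReg] at hA' ⊢
    simp [h, ← h4, hA']

/-- The loop stops with the outcome of a successful attempt, and the guesses do not exceed the
treewidth. -/
theorem runs_search_loop
    (hp : ∀ s, Runs p s (budget s ^ e) fun s' =>
      s'.reg 4 = attempt (s.reg 0) (s.reg 1) (s.reg 2) (inputArc s) ∧ Agree 4 s s')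
    {n k t : ℕ} {D : Digraph (Fin n)} (ht : D.toSimpleGraphInclusive.treewidth = t) (m : ℕ) :
    ∀ s, s.reg 0 = n → s.reg 1 = k → s.reg 2 + m = t → s.reg 3 ≠ 0 → inputArc s = Arc D →
      Runs (.loop 3 (searchRound p)) s
        (1 + (m + 1) * ((2 ^ (t * (k + t)) * (n + 2)) ^ e + 4))
        fun s' => s'.reg 4 ≠ 0 ∧ ∃ w, s'.reg 4 = attempt n k w (Arc D) := by
  induction m with
  | zero =>
    intro s h0 h1 h2 h3 hD
    obtain ⟨T, s', hex, hT, h4, -, h5, -⟩ := runs_searchRound hp s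
    rw [h0, h1, hD] at h4
    have hne : s'.reg 4 ≠ 0 := h4 ▸ attempt_ne_zero (by omega)
    refine ⟨_, s', .loop_step h3 hex (Exec.loop_stop (h5 hne)), ?_, hne, _, h4⟩
    have hb : budget s = 2 ^ (t * (k + t)) * (n + 2) := by
      rw [budget, h0, h1, ← h2, add_zero]
    rw [hb] at hT
    omega
  | succ m ih =>
    intro s h0 h1 h2 h3 hD
    obtain ⟨T, s', hex, hT, h4, hA, h5, h6⟩ := runs_searchRound hp s
    rw [h0, h1, hD] at h4
    have hb : budget s ^ e ≤ (2 ^ (t * (k + t)) * (n + 2)) ^ e := by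
      refine Nat.pow_le_pow_left ?_ e
      rw [budget, h0, h1]
      have h7 : s.reg 2 ≤ t := by omega
      exact Nat.mul_le_mul_right _ (Nat.pow_le_pow_right (by omega) (by gcongr))
    by_cases hne : s'.reg 4 = 0
    · obtain ⟨h7, h8⟩ := h6 hne
      obtain ⟨T', s'', hex', hT', h9⟩ := ih s' ((hA.1 0 (by omega)).trans h0)
        ((hA.1 1 (by omega)).trans h1) (by omega) (by omega) (hA.inputArc_eq.trans hD)
      refine ⟨_, s'', .loop_step h3 hex hex', ?_, h9⟩
      rw [add_mul (m + 1) 1]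
      omega
    · refine ⟨_, s', .loop_step h3 hex (Exec.loop_stop (h5 hne)), ?_, hne, _, h4⟩
      rw [add_mul (m + 1) 1]
      omega

/-- The running time in the required form. -/
theorem search_time_le (n e t X : ℕ) (ht : t ≤ n) :
    1 + (1 + (1 + (t + 1) * ((2 ^ X * (n + 2)) ^ e + 4) + (1 + 1))) ≤
      (10 * 2 ^ e + e + 1) * 2 ^ ((10 * 2 ^ e + e + 1) * X) * (n + 1) ^ (10 * 2 ^ e + e + 1) := by
  have hM : (2 ^ X * (n + 2)) ^ e ≤ 2 ^ e * 2 ^ (e * X) * (n + 1) ^ e := by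
    calc (2 ^ X * (n + 2)) ^ e ≤ (2 ^ X * (2 * (n + 1))) ^ e :=
          Nat.pow_le_pow_left (Nat.mul_le_mul_left _ (by omega)) e
      _ = _ := by rw [mul_pow, mul_pow, ← pow_mul, mul_comm X e]; ring
  have h1 : 1 ≤ 2 ^ e * 2 ^ (e * X) * (n + 1) ^ e := Nat.one_le_iff_ne_zero.2 (by positivity)
  set M := 2 ^ e * 2 ^ (e * X) * (n + 1) ^ e
  calc 1 + (1 + (1 + (t + 1) * ((2 ^ X * (n + 2)) ^ e + 4) + (1 + 1)))
      ≤ 5 + (n + 1) * (M + 4) := by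
        have := Nat.mul_le_mul (by omega : t + 1 ≤ n + 1)
          (by omega : (2 ^ X * (n + 2)) ^ e + 4 ≤ M + 4)
        omega
    _ ≤ (n + 1) * (10 * M) := by nlinarith
    _ = 10 * 2 ^ e * 2 ^ (e * X) * (n + 1) ^ (e + 1) := by simp only [M]; ring
    _ ≤ _ := Nat.mul_le_mul (Nat.mul_le_mul (by omega)
        (Nat.pow_le_pow_right (by omega) (Nat.mul_le_mul_right _ (by omega))))
        (Nat.pow_le_pow_right (by omega) (by omega))

end RAM

theorem theorem3 :
    ∃ (p : RAM.Prog) (c : ℕ), ∀ (n k : ℕ) (D : Digraph (Fin n)),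
      ∃ (T : ℕ) (s : RAM.State),
        RAM.Exec p (RAM.inversionInput D k) T s ∧
        (s.reg 0 = 1 ↔ D.IsInvertibleWith k) ∧
        (s.reg 0 = 0 ↔ ¬ D.IsInvertibleWith k) ∧
        T ≤ c * 2 ^ (c * (D.toSimpleGraphInclusive.treewidth *
              (k + D.toSimpleGraphInclusive.treewidth))) * (n + 1) ^ c := by
  obtain ⟨p, e, hp⟩ := (RAM.CNat.attempt (Γ := ⟨4, by omega, True⟩)).2 trivial 4 le_rfl
  refine ⟨RAM.search p, 10 * 2 ^ e + e + 1, fun n k D => ?_⟩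
  set t := D.toSimpleGraphInclusive.treewidth with ht
  have htn : t ≤ n := by simpa using D.toSimpleGraphInclusive.treewidth_le_card
  have hrun : RAM.Runs (RAM.search p) (RAM.inversionInput D k)
      (1 + (1 + (1 + (t + 1) * ((2 ^ (t * (k + t)) * (n + 2)) ^ e + 4) + (1 + 1))))
      fun s => (s.reg 0 = 1 ↔ D.IsInvertibleWith k) ∧ (s.reg 0 = 0 ↔ ¬ D.IsInvertibleWith k) := by
    set s₀ := RAM.inversionInput D k with hs₀
    refine RAM.Runs.seq (RAM.Runs.const (Q := fun s => s = s₀.setReg 2 0) rfl) ?_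
    rintro _ rfl
    refine RAM.Runs.seq (RAM.Runs.const (Q := fun s => s = (s₀.setReg 2 0).setReg 3 1) rfl) ?_
    rintro _ rfl
    have hA : RAM.Agree 2 s₀ ((s₀.setReg 2 0).setReg 3 1) :=
      ((RAM.Agree.refl 2 s₀).setReg le_rfl 0).setReg (by omega) 1
    refine RAM.Runs.seq (RAM.runs_search_loop hp ht.symm t _ (hA.1 0 (by omega))
      (hA.1 1 (by omega)) ?_ ?_
      (hA.inputArc_eq.trans (RAM.inputArc_inversionInput D k))) ?_
    · rw [RAM.setReg_reg_ne _ _ (by omega), RAM.setReg_reg_self, zero_add]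
    · rw [RAM.setReg_reg_self]
      omega
    rintro s ⟨hne, w, hw⟩
    refine RAM.Runs.seq (RAM.Runs.const (Q := fun s' => s' = s.setReg 2 1) rfl) ?_
    rintro _ rfl
    refine RAM.Runs.sub ?_
    rw [RAM.setReg_reg_self, RAM.setReg_reg_self, RAM.setReg_reg_ne _ _ (by omega)]
    rcases Inversion.attempt_spec n k w D with h | ⟨h, h'⟩ | ⟨h, h'⟩
    · omega
    · rw [hw, h]
      simp [h']
    · rw [hw, h]
      simp [h']
  obtain ⟨T, s, hex, hT, h1, h2⟩ := hrun
  exact ⟨T, s, hex, h1, h2, hT.trans (RAM.search_time_le n e t _ htn)⟩
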